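/- **Theorem 3.5.** Let $M$ be a Hausdorff, $\sigma$-compact smooth manifold of finite dimension, $A=C^\infty(M,\mathbb C)$ and $\Omega^1$ its $A$-module of smooth (complex) one-forms. Vector bundles are given by their finitely generated projective $A$-modules of sections; a connection on $E$ is an additive map $\nabla_E:E\to\Omega^1\otimes_A E$ with $\nabla_E(ae)=da\otimes e+a\nabla_E e$. In local coordinates write $\nabla_E e=dx^i\otimes\nabla_{E_i}e$. Let $\mathcal D_0$ be the monoidal category of bundles with connection $(E,\nabla_E)$: morphisms are the bundle maps that intertwine the connections, the tensor product is $\otimes_0=\otimes_A$ with the usual tensor product connection, and the unit is $(A,d)$. Let $\omega=\omega^{ij}\partial_i\otimes\partial_j$ be an antisymmetric bivector on $M$ (not necessarily Poisson), $\{a,b\}=\omega^{ij}a_{,i}b_{,j}$, and let $\nabla$ be a linear connection on $\Omega^1$ with $$d(\omega^{ij})-\omega^{kj}\nabla_k(dx^i)-\omega^{ik}\nabla_k(dx^j)=0 .\tag{3.1}$$ Work over $\mathbb C[\lambda]/(\lambda^2)$. Let $A_1=A\oplus\lambda A$ be the algebra with the $\lambda$-bilinear product determined by $a\bullet b=ab+\frac\lambda2\{a,b\}$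 for $a,b\in A$. For $(E,\nabla_E)$ in $\mathcal D_0$ let $Q(E)=E\oplus\lambda E$ be the $A_1$-bimodule with the $\lambda$-bilinear actions determined by $$a\bullet e=ae+\tfrac\lambda2\,\omega^{ij}a_{,i}\nabla_{E_j}e,\qquad e\bullet a=ae-\tfrac\lambda2\,\omega^{ij}a_{,i}\nabla_{E_j}e\qquad(a\in A,\ e\in E).$$ Let $\Omega^1A_1=Q(\Omega^1)$, formed with $\nabla$, with $d:A_1\to\Omega^1A_1$ the $\lambda$-linear extension of $d$; this is a first order differential calculus on $A_1$. Let $\otimes_1$ be the tensor product of bimodules over $A_1$, and let $$q_{E,F}:Q(E)\otimes_1Q(F)\to Q(E\otimes_0F),\qquad q_{E,F}(e\otimes_1f)=e\otimes_0f+\tfrac\lambda2\,\omega^{ij}\nabla_{E_i}e\otimes_0\nabla_{F_j}f\qquad(e\in E,\ f\in F),$$ extended $\lambda$-linearly. A bimodule connection on an $A_1$-bimodule $V$ is a $\mathbb C[\lambda]/(\lambda^2)$-linear map $\nabla_V:V\to\Omega^1A_1\otimes_1V$ together with a bimodule map $\sigma_V:V\otimes_1\Omega^1A_1\to\Omega^1A_1\otimes_1V$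 such that $\nabla_V(av)=da\otimes_1v+a\nabla_V v$ and $\nabla_V(va)=(\nabla_Vv)a+\sigma_V(v\otimes_1da)$ for all $a\in A_1$, $v\in V$. Let $\mathcal D_1$ be the monoidal category of $A_1$-bimodules over $\mathbb C[\lambda]/(\lambda^2)$ with bimodule connection: morphisms are the bimodule maps that intertwine the connections, the tensor product is $\otimes_1$ with $\nabla_{V\otimes_1W}=\nabla_V\otimes\mathrm{id}+(\sigma_V\otimes\mathrm{id})(\mathrm{id}\otimes\nabla_W)$, and the unit is $(A_1,d)$. Then, for every $(E,\nabla_E)$ in $\mathcal D_0$, the map $q_{\Omega^1,E}$ is bijective and $Q(E)$ has a bimodule connection $(\nabla_{Q(E)},\sigma_{Q(E)})$ with, for $e\in E$ and $\xi\in\Omega^1$, $$\nabla_{Q(E)}e=q_{\Omega^1,E}^{-1}(\nabla_Ee)-\tfrac\lambda2\,\omega^{ij}\,dx^k\otimes_1[\nabla_{E_k},\nabla_{E_j}]\nabla_{E_i}e,$$ $$\sigma_{Q(E)}(e\otimes_1\xi)=\xi\otimes_1e+\lambda\,\omega^{ij}\,\nabla_j\xi\otimes_1\nabla_{E_i}e+\lambda\,\omega^{ij}\xi_j\,dx^k\otimes_1[\nabla_{E_k},\nabla_{E_i}]e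 .$$ Moreover $(E,\nabla_E)\mapsto(Q(E),\nabla_{Q(E)},\sigma_{Q(E)})$, with a morphism $T$ sent to its $\lambda$-linear extension, is a functor $Q:\mathcal D_0\to\mathcal D_1$, and it is (strong) monoidal with structure isomorphisms $q_{E,F}:Q(E)\otimes_1Q(F)\to Q(E\otimes_0F)$ and unit isomorphism the identity $A_1=Q(A)$. -/

import Mathlib

open CategoryTheory MonoidalCategory
open scoped TensorProduct Manifold

universe u v

noncomputable section

/-! ### Bimodules over a noncommutative algebra and their tensor product -/

/-- Bimodules over an algebra `B` over a commutative ring `R`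
(the two actions of `R` through `B` agree). -/
structure BimoduleCat (R : Type v) (B : Type u) [CommRing R] [Ring B] [Algebra R B] where
  carrier : Type u
  [addCommGroup : AddCommGroup carrier]
  [scalar : Module R carrier]
  [left : Module B carrier]
  [right : Module Bᵐᵒᵖ carrier]
  [comm : SMulCommClass B Bᵐᵒᵖ carrier]
  [towerLeft : IsScalarTower R B carrier]
  [towerRight : IsScalarTower R Bᵐᵒᵖ carrier]

attribute [instance] BimoduleCat.addCommGroup BimoduleCat.scalar BimoduleCat.left
  BimoduleCat.right BimoduleCat.comm BimoduleCat.towerLeft BimoduleCat.towerRight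

section Bimodules

variable {R : Type v} {B : Type u} [CommRing R] [Ring B] [Algebra R B]

instance : CoeSort (BimoduleCat R B) (Type u) := ⟨BimoduleCat.carrier⟩

/-- The action of `b` from the right. -/
abbrev rsmul {X : BimoduleCat R B} (x : X) (b : B) : X := MulOpposite.op b • x

lemma rsmul_add {X : BimoduleCat R B} (x y : X) (b : B) :
    rsmul (x + y) b = rsmul x b + rsmul y b := smul_add _ _ _

lemma rsmul_one {X : BimoduleCat R B} (x : X) : rsmul x (1 : B) = x := one_smul _ x

/-- Bimodule maps. -/
@[ext]
structure BimoduleHom (X Y : BimoduleCat R B) where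
  toLin : X →ₗ[R] Y
  map_left : ∀ (b : B) (x : X), toLin (b • x) = b • toLin x
  map_right : ∀ (x : X) (b : B), toLin (rsmul x b) = rsmul (toLin x) b

instance (X Y : BimoduleCat R B) : CoeFun (BimoduleHom X Y) (fun _ => X → Y) := ⟨fun f => f.toLin⟩

def BimoduleHom.id (X : BimoduleCat R B) : BimoduleHom X X := ⟨LinearMap.id, by simp, by simp⟩

def BimoduleHom.comp {X Y Z : BimoduleCat R B} (g : BimoduleHom Y Z) (f : BimoduleHom X Y) :
    BimoduleHom X Z :=
  ⟨g.toLin ∘ₗ f.toLin, by simp [f.map_left, g.map_left], by simp [f.map_right, g.map_right]⟩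

/-- The relations `x b ⊗ y = x ⊗ b y`. -/
def balancedRel (X Y : BimoduleCat R B) : Submodule R (X ⊗[R] Y) :=
  Submodule.span R {t | ∃ (x : X) (b : B) (y : Y), t = rsmul x b ⊗ₜ[R] y - x ⊗ₜ[R] (b • y)}

/-- The tensor product `X ⊗_B Y` of bimodules, as an `R`-module. -/
def BTensor (X Y : BimoduleCat R B) : Type u := (X ⊗[R] Y) ⧸ balancedRel X Y

namespace BTensor

variable {X Y Z W : BimoduleCat R B}

instance : AddCommGroup (BTensor X Y) := inferInstanceAs (AddCommGroup ((X ⊗[R] Y) ⧸ balancedRel X Y))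
instance : Module R (BTensor X Y) := inferInstanceAs (Module R ((X ⊗[R] Y) ⧸ balancedRel X Y))

/-- The pure tensors, as a bilinear map. -/
def mkₗ (X Y : BimoduleCat R B) : X →ₗ[R] Y →ₗ[R] BTensor X Y :=
  (TensorProduct.mk R X Y).compr₂ (balancedRel X Y).mkQ

/-- The pure tensor `x ⊗_B y`. -/
abbrev mk (x : X) (y : Y) : BTensor X Y := mkₗ X Y x y

lemma mk_balanced (x : X) (b : B) (y : Y) : mk (rsmul x b) y = mk x (b • y) := by
  refine (Submodule.Quotient.eq (balancedRel X Y)).2 ?_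
  exact Submodule.subset_span ⟨x, b, y, rfl⟩

/-- Linear maps out of `X ⊗_B Y` from balanced bilinear maps. -/
def lift {P : Type*} [AddCommGroup P] [Module R P] (f : X →ₗ[R] Y →ₗ[R] P)
    (hf : ∀ (x : X) (b : B) (y : Y), f (rsmul x b) y = f x (b • y)) : BTensor X Y →ₗ[R] P :=
  (balancedRel X Y).liftQ (TensorProduct.lift f) (by
    refine Submodule.span_le.2 ?_
    rintro _ ⟨x, b, y, rfl⟩
    simp [hf])

@[simp] lemma lift_mk {P : Type*} [AddCommGroup P] [Module R P] (f : X →ₗ[R] Y →ₗ[R] P)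
    (hf : ∀ (x : X) (b : B) (y : Y), f (rsmul x b) y = f x (b • y)) (x : X) (y : Y) :
    lift f hf (mk x y) = f x y := by
  exact ((balancedRel X Y).liftQ_apply (TensorProduct.lift f) (x ⊗ₜ y)).trans
    (TensorProduct.lift.tmul x y)

@[elab_as_elim]
lemma ind {p : BTensor X Y → Prop} (t : BTensor X Y) (hmk : ∀ x y, p (mk x y))
    (hadd : ∀ s t, p s → p t → p (s + t)) : p t := by
  obtain ⟨t, rfl⟩ := (balancedRel X Y).mkQ_surjective t
  induction t using TensorProduct.induction_on with
  | zero =>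
    have h := hmk 0 0
    rwa [mk, map_zero] at h
  | tmul x y => exact hmk x y
  | add s t hs ht => rw [map_add]; exact hadd _ _ hs ht

lemma hom_ext {P : Type*} [AddCommGroup P] [Module R P] {f g : BTensor X Y →ₗ[R] P}
    (h : ∀ x y, f (mk x y) = g (mk x y)) : f = g := by
  ext t
  induction t using ind with
  | hmk x y => exact h x y
  | hadd s t hs ht => rw [map_add, map_add, hs, ht]

/-- `b (x ⊗ y) = (b x) ⊗ y`. -/
def lactₗ (X Y : BimoduleCat R B) (b : B) : BTensor X Y →ₗ[R] BTensor X Y :=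
  lift ((mkₗ X Y) ∘ₗ (Algebra.lsmul R R X b)) (by
    intro x c y
    change mk (b • rsmul x c) y = mk (b • x) (c • y)
    rw [← mk_balanced, rsmul, rsmul, smul_comm])

/-- `(x ⊗ y) b = x ⊗ (y b)`. -/
def ractₗ (X Y : BimoduleCat R B) (b : Bᵐᵒᵖ) : BTensor X Y →ₗ[R] BTensor X Y :=
  lift ((mkₗ X Y).compl₂ (Algebra.lsmul R R Y b)) (by
    intro x c y
    change mk (rsmul x c) (b • y) = mk x (b • c • y)
    rw [mk_balanced, smul_comm])

lemma lactₗ_mk (b : B) (x : X) (y : Y) : lactₗ X Y b (mk x y) = mk (b • x) y := by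
  simp [lactₗ]

lemma ractₗ_mk (b : Bᵐᵒᵖ) (x : X) (y : Y) : ractₗ X Y b (mk x y) = mk x (b • y) := by
  simp [ractₗ]

instance : Module B (BTensor X Y) where
  smul b t := lactₗ X Y b t
  one_smul t := by
    change lactₗ X Y 1 t = t
    induction t using ind with
    | hmk x y => rw [lactₗ_mk, one_smul]
    | hadd s t hs ht => rw [map_add, hs, ht]
  mul_smul b c t := by
    change lactₗ X Y (b * c) t = lactₗ X Y b (lactₗ X Y c t)
    induction t using ind with
    | hmk x y => rw [lactₗ_mk, lactₗ_mk, lactₗ_mk, mul_smul]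
    | hadd s t hs ht => simp only [map_add, hs, ht]
  smul_zero b := map_zero (lactₗ X Y b)
  smul_add b := map_add (lactₗ X Y b)
  add_smul b c t := by
    change lactₗ X Y (b + c) t = lactₗ X Y b t + lactₗ X Y c t
    induction t using ind with
    | hmk x y => simp only [lactₗ_mk, add_smul, mk, map_add, LinearMap.add_apply]
    | hadd s t hs ht => simp only [map_add, hs, ht]; abel
  zero_smul t := by
    change lactₗ X Y 0 t = 0
    induction t using ind with
    | hmk x y => simp only [lactₗ_mk, zero_smul, mk, map_zero, LinearMap.zero_apply]
    | hadd s t hs ht => simp only [map_add, hs, ht, add_zero]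

instance : Module Bᵐᵒᵖ (BTensor X Y) where
  smul b t := ractₗ X Y b t
  one_smul t := by
    change ractₗ X Y 1 t = t
    induction t using ind with
    | hmk x y => rw [ractₗ_mk, one_smul]
    | hadd s t hs ht => rw [map_add, hs, ht]
  mul_smul b c t := by
    change ractₗ X Y (b * c) t = ractₗ X Y b (ractₗ X Y c t)
    induction t using ind with
    | hmk x y => rw [ractₗ_mk, ractₗ_mk, ractₗ_mk, mul_smul]
    | hadd s t hs ht => simp only [map_add, hs, ht]
  smul_zero b := map_zero (ractₗ X Y b)
  smul_add b := map_add (ractₗ X Y b)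
  add_smul b c t := by
    change ractₗ X Y (b + c) t = ractₗ X Y b t + ractₗ X Y c t
    induction t using ind with
    | hmk x y => simp only [ractₗ_mk, add_smul, mk, map_add]
    | hadd s t hs ht => simp only [map_add, hs, ht]; abel
  zero_smul t := by
    change ractₗ X Y 0 t = 0
    induction t using ind with
    | hmk x y => simp only [ractₗ_mk, zero_smul, mk, map_zero]
    | hadd s t hs ht => simp only [map_add, hs, ht, add_zero]

lemma smul_mk (b : B) (x : X) (y : Y) : b • mk x y = mk (b • x) y := lactₗ_mk b x y

lemma op_smul_mk (b : Bᵐᵒᵖ) (x : X) (y : Y) : b • mk x y = mk x (b • y) := ractₗ_mk b x y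

instance : SMulCommClass B Bᵐᵒᵖ (BTensor X Y) where
  smul_comm b c t := by
    induction t using ind with
    | hmk x y => simp only [smul_mk, op_smul_mk]
    | hadd s t hs ht => simp only [smul_add, hs, ht]

instance : IsScalarTower R B (BTensor X Y) where
  smul_assoc r b t := by
    induction t using ind with
    | hmk x y => simp only [smul_mk, smul_assoc, mk, map_smul, LinearMap.smul_apply]
    | hadd s t hs ht => simp only [smul_add, hs, ht]

instance : IsScalarTower R Bᵐᵒᵖ (BTensor X Y) where
  smul_assoc r b t := by
    induction t using ind with
    | hmk x y => simp only [op_smul_mk, smul_assoc, mk, map_smul]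
    | hadd s t hs ht => simp only [smul_add, hs, ht]

end BTensor

/-- The bimodule `X ⊗_B Y`. -/
def tensB (X Y : BimoduleCat R B) : BimoduleCat R B where
  carrier := BTensor X Y

/-- The algebra as a bimodule over itself. -/
def unitB (R : Type v) (B : Type u) [CommRing R] [Ring B] [Algebra R B] : BimoduleCat R B where
  carrier := B

/-- The pure tensor `x ⊗_B y`. -/
def tmulB {X Y : BimoduleCat R B} (x : X) (y : Y) : tensB X Y := BTensor.mk x y

infixl:100 "⊗ᵇ" => tmulB

section API

variable {X Y Z W X' Y' : BimoduleCat R B}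

@[elab_as_elim]
lemma tensB_ind {p : tensB X Y → Prop} (t : tensB X Y) (hmk : ∀ (x : X) (y : Y), p (x ⊗ᵇ y))
    (hadd : ∀ s t, p s → p t → p (s + t)) : p t := BTensor.ind t hmk hadd

lemma tmulB_balanced (x : X) (b : B) (y : Y) : rsmul x b ⊗ᵇ y = x ⊗ᵇ (b • y) :=
  BTensor.mk_balanced x b y

lemma smul_tmulB (b : B) (x : X) (y : Y) : b • (x ⊗ᵇ y) = (b • x) ⊗ᵇ y := BTensor.smul_mk b x y

lemma rsmul_tmulB (x : X) (y : Y) (b : B) : rsmul (x ⊗ᵇ y) b = x ⊗ᵇ rsmul y b :=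
  BTensor.op_smul_mk _ x y

lemma add_tmulB (x x' : X) (y : Y) : (x + x') ⊗ᵇ y = x ⊗ᵇ y + x' ⊗ᵇ y :=
  LinearMap.map_add₂ (BTensor.mkₗ X Y) x x' y

lemma tmulB_add (x : X) (y y' : Y) : x ⊗ᵇ (y + y') = x ⊗ᵇ y + x ⊗ᵇ y' :=
  map_add (BTensor.mkₗ X Y x) y y'

lemma scal_tmulB (r : R) (x : X) (y : Y) : (r • x) ⊗ᵇ y = r • (x ⊗ᵇ y) :=
  LinearMap.map_smul₂ (BTensor.mkₗ X Y) r x y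

lemma tmulB_scal (r : R) (x : X) (y : Y) : x ⊗ᵇ (r • y) = r • (x ⊗ᵇ y) :=
  map_smul (BTensor.mkₗ X Y x) r y

/-- Linear maps out of `X ⊗_B Y` from balanced bilinear functions. -/
def liftB {P : Type*} [AddCommGroup P] [Module R P] (f : X → Y → P)
    (h1 : ∀ x x' y, f (x + x') y = f x y + f x' y) (h2 : ∀ (r : R) x y, f (r • x) y = r • f x y)
    (h3 : ∀ x y y', f x (y + y') = f x y + f x y') (h4 : ∀ (r : R) x y, f x (r • y) = r • f x y)
    (hf : ∀ (x : X) (b : B) (y : Y), f (rsmul x b) y = f x (b • y)) : tensB X Y →ₗ[R] P :=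
  BTensor.lift (LinearMap.mk₂ R f h1 h2 h3 h4) hf

@[simp] lemma liftB_tmulB {P : Type*} [AddCommGroup P] [Module R P] (f : X → Y → P)
    (h1 : ∀ x x' y, f (x + x') y = f x y + f x' y) (h2 : ∀ (r : R) x y, f (r • x) y = r • f x y)
    (h3 : ∀ x y y', f x (y + y') = f x y + f x y') (h4 : ∀ (r : R) x y, f x (r • y) = r • f x y)
    (hf : ∀ (x : X) (b : B) (y : Y), f (rsmul x b) y = f x (b • y)) (x : X) (y : Y) :
    liftB f h1 h2 h3 h4 hf (x ⊗ᵇ y) = f x y :=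
  BTensor.lift_mk _ _ x y

/-- A linear map on `X ⊗_B Y` is a bimodule map if it is so on pure tensors. -/
def homOfTens (f : tensB X Y →ₗ[R] Z)
    (hl : ∀ (b : B) (x : X) (y : Y), f ((b • x) ⊗ᵇ y) = b • f (x ⊗ᵇ y))
    (hr : ∀ (x : X) (y : Y) (b : B), f (x ⊗ᵇ rsmul y b) = rsmul (f (x ⊗ᵇ y)) b) :
    BimoduleHom (tensB X Y) Z where
  toLin := f
  map_left b t := by
    induction t using tensB_ind with
    | hmk x y => rw [smul_tmulB, hl]
    | hadd s t hs ht => rw [smul_add, map_add, hs, ht, map_add, smul_add]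
  map_right t b := by
    induction t using tensB_ind with
    | hmk x y => rw [rsmul_tmulB, hr]
    | hadd s t hs ht => rw [rsmul, smul_add, map_add, hs, ht, map_add, rsmul, rsmul, rsmul, smul_add]

@[simp] lemma homOfTens_apply (f : tensB X Y →ₗ[R] Z)
    (hl : ∀ (b : B) (x : X) (y : Y), f ((b • x) ⊗ᵇ y) = b • f (x ⊗ᵇ y))
    (hr : ∀ (x : X) (y : Y) (b : B), f (x ⊗ᵇ rsmul y b) = rsmul (f (x ⊗ᵇ y)) b) (t : tensB X Y) :
    homOfTens f hl hr t = f t := rfl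

/-- The bimodule map `f ⊗ g`. -/
def mapB (f : BimoduleHom X X') (g : BimoduleHom Y Y') : BimoduleHom (tensB X Y) (tensB X' Y') :=
  homOfTens (liftB (fun x y => f x ⊗ᵇ g y)
    (by simp [add_tmulB]) (by simp [scal_tmulB]) (by simp [tmulB_add]) (by simp [tmulB_scal])
    (by intro x b y; rw [f.map_right, g.map_left, tmulB_balanced]))
    (by simp [f.map_left, smul_tmulB]) (by simp only [liftB_tmulB, g.map_right, rsmul_tmulB, implies_true])

@[simp] lemma mapB_tmulB (f : BimoduleHom X X') (g : BimoduleHom Y Y') (x : X) (y : Y) :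
    mapB f g (x ⊗ᵇ y) = f x ⊗ᵇ g y := by simp [mapB]

/-- The associator `(X ⊗ Y) ⊗ Z → X ⊗ (Y ⊗ Z)`. -/
def assocB (X Y Z : BimoduleCat R B) :
    BimoduleHom (tensB (tensB X Y) Z) (tensB X (tensB Y Z)) :=
  homOfTens (liftB (fun t z => liftB (fun x y => x ⊗ᵇ (y ⊗ᵇ z))
      (by simp [add_tmulB]) (by simp [scal_tmulB]) (by simp [add_tmulB, tmulB_add])
      (by simp [scal_tmulB, tmulB_scal])
      (by intro x b y; rw [tmulB_balanced, smul_tmulB]) t)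
      (by simp) (by simp)
      (by
        intro t z z'
        induction t using tensB_ind with
        | hmk x y => simp [tmulB_add]
        | hadd s t hs ht => simp only [map_add, hs, ht]; abel)
      (by
        intro r t z
        induction t using tensB_ind with
        | hmk x y => simp [tmulB_scal]
        | hadd s t hs ht => simp only [map_add, hs, ht, smul_add])
      (by
        intro t b z
        induction t using tensB_ind with
        | hmk x y => simp only [rsmul_tmulB, liftB_tmulB, tmulB_balanced]
        | hadd s t hs ht => rw [rsmul, smul_add, map_add, map_add, hs, ht]))
    (by
      intro b t z
      simp only [liftB_tmulB]
      induction t using tensB_ind with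
      | hmk x y => simp only [smul_tmulB, liftB_tmulB]
      | hadd s t hs ht => rw [smul_add, map_add, map_add, hs, ht, smul_add])
    (by
      intro t z b
      simp only [liftB_tmulB]
      induction t using tensB_ind with
      | hmk x y => simp only [liftB_tmulB, rsmul_tmulB]
      | hadd s t hs ht => rw [map_add, map_add, hs, ht, rsmul, rsmul, rsmul, smul_add])

@[simp] lemma assocB_tmulB (x : X) (y : Y) (z : Z) :
    assocB X Y Z (x ⊗ᵇ y ⊗ᵇ z) = x ⊗ᵇ (y ⊗ᵇ z) := by simp [assocB]

/-- The inverse associator `X ⊗ (Y ⊗ Z) → (X ⊗ Y) ⊗ Z`. -/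
def assocInvB (X Y Z : BimoduleCat R B) :
    BimoduleHom (tensB X (tensB Y Z)) (tensB (tensB X Y) Z) :=
  homOfTens (liftB (fun x t => liftB (fun y z => x ⊗ᵇ y ⊗ᵇ z)
      (by simp [add_tmulB, tmulB_add]) (by simp [scal_tmulB, tmulB_scal]) (by simp [tmulB_add])
      (by simp [tmulB_scal])
      (by intro y b z; rw [← tmulB_balanced, rsmul_tmulB]) t)
      (by
        intro x x' t
        induction t using tensB_ind with
        | hmk y z => simp [add_tmulB]
        | hadd s t hs ht => simp only [map_add, hs, ht]; abel)
      (by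
        intro r x t
        induction t using tensB_ind with
        | hmk y z => simp [scal_tmulB]
        | hadd s t hs ht => simp only [map_add, hs, ht, smul_add])
      (by simp) (by simp)
      (by
        intro x b t
        induction t using tensB_ind with
        | hmk y z => simp only [smul_tmulB, liftB_tmulB, tmulB_balanced]
        | hadd s t hs ht => rw [smul_add, map_add, map_add, hs, ht]))
    (by
      intro b x t
      simp only [liftB_tmulB]
      induction t using tensB_ind with
      | hmk y z => simp only [liftB_tmulB, smul_tmulB]
      | hadd s t hs ht => rw [map_add, map_add, hs, ht, smul_add])
    (by
      intro x t b
      simp only [liftB_tmulB]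
      induction t using tensB_ind with
      | hmk y z => simp only [liftB_tmulB, rsmul_tmulB]
      | hadd s t hs ht => rw [rsmul, smul_add, map_add, map_add, hs, ht, rsmul, rsmul, rsmul, smul_add])

@[simp] lemma assocInvB_tmulB (x : X) (y : Y) (z : Z) :
    assocInvB X Y Z (x ⊗ᵇ (y ⊗ᵇ z)) = x ⊗ᵇ y ⊗ᵇ z := by simp [assocInvB]

/-- An element of `B`, seen in the bimodule `B`. -/
def toUnitB : B ≃ₗ[R] unitB R B := LinearEquiv.refl R B

lemma smul_toUnitB (b c : B) : b • (toUnitB c : unitB R B) = toUnitB (b * c) := rfl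

lemma rsmul_toUnitB (c b : B) : rsmul (toUnitB c : unitB R B) b = toUnitB (c * b) := rfl

lemma toUnitB_symm_smul (b : B) (c : unitB R B) :
    (toUnitB (R := R)).symm (b • c) = b * (toUnitB (R := R)).symm c := rfl

lemma toUnitB_symm_rsmul (c : unitB R B) (b : B) :
    (toUnitB (R := R)).symm (rsmul c b) = (toUnitB (R := R)).symm c * b := rfl

/-- `B ⊗ X → X`. -/
def lunitB (X : BimoduleCat R B) : BimoduleHom (tensB (unitB R B) X) X :=
  homOfTens (liftB (fun b x => (toUnitB (R := R)).symm b • x)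
    (fun b c x => by rw [map_add, add_smul])
    (fun r b x => by rw [map_smul, smul_assoc]) (fun b x y => smul_add _ x y)
    (fun r b x => (smul_algebra_smul_comm r _ x))
    (fun b c x => by rw [toUnitB_symm_rsmul, mul_smul]))
    (by intro b c x; rw [liftB_tmulB, liftB_tmulB, toUnitB_symm_smul, mul_smul])
    (by intro b x c; rw [liftB_tmulB, liftB_tmulB, rsmul, rsmul, smul_comm])

@[simp] lemma lunitB_tmulB (b : B) (x : X) : lunitB X (toUnitB b ⊗ᵇ x) = b • x := by
  simp [lunitB]

/-- `X → B ⊗ X`. -/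
def lunitInvB (X : BimoduleCat R B) : BimoduleHom X (tensB (unitB R B) X) where
  toLin := BTensor.mkₗ (unitB R B) X (toUnitB 1)
  map_left b x := by
    change toUnitB 1 ⊗ᵇ (b • x) = b • (toUnitB 1 ⊗ᵇ x)
    rw [← tmulB_balanced, smul_tmulB, rsmul_toUnitB, smul_toUnitB, one_mul, mul_one]
  map_right x b := (rsmul_tmulB (toUnitB (R := R) (1 : B)) x b).symm

lemma lunitInvB_apply (x : X) : lunitInvB X x = toUnitB 1 ⊗ᵇ x := rfl

/-- `X ⊗ B → X`. -/
def runitB (X : BimoduleCat R B) : BimoduleHom (tensB X (unitB R B)) X :=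
  homOfTens (liftB (fun x b => rsmul x ((toUnitB (R := R)).symm b)) (fun x y b => smul_add _ x y)
    (fun r x b => by
      rw [rsmul, rsmul, smul_algebra_smul_comm])
    (fun x b c => by rw [map_add, rsmul, MulOpposite.op_add, add_smul])
    (fun r x b => by rw [map_smul, rsmul, MulOpposite.op_smul, smul_assoc])
    (fun x b c => by
      rw [toUnitB_symm_smul, rsmul, rsmul, rsmul, MulOpposite.op_mul, mul_smul]))
    (by intro b c x; rw [liftB_tmulB, liftB_tmulB, rsmul, rsmul]; exact (smul_comm _ _ _).symm)
    (by
      intro x c b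
      rw [liftB_tmulB, liftB_tmulB, toUnitB_symm_rsmul, rsmul, rsmul, rsmul, MulOpposite.op_mul,
        mul_smul])

@[simp] lemma runitB_tmulB (x : X) (b : B) : runitB X (x ⊗ᵇ toUnitB b) = rsmul x b := by
  simp [runitB]

/-- `X → X ⊗ B`. -/
def runitInvB (X : BimoduleCat R B) : BimoduleHom X (tensB X (unitB R B)) where
  toLin := (BTensor.mkₗ X (unitB R B)).flip (toUnitB 1)
  map_left b x := (smul_tmulB b x (toUnitB (R := R) (1 : B))).symm
  map_right x b := by
    change rsmul x b ⊗ᵇ toUnitB 1 = rsmul (x ⊗ᵇ toUnitB 1) b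
    rw [tmulB_balanced, rsmul_tmulB, rsmul_toUnitB, smul_toUnitB, one_mul, mul_one]

lemma runitInvB_apply (x : X) : runitInvB X x = x ⊗ᵇ toUnitB 1 := rfl

lemma BimoduleHom.ext' {f g : BimoduleHom X Y} (h : ∀ x, f x = g x) : f = g :=
  BimoduleHom.ext (LinearMap.ext h)

@[simp] lemma BimoduleHom.id_apply (x : X) : BimoduleHom.id X x = x := rfl

@[simp] lemma BimoduleHom.comp_apply (g : BimoduleHom Y Z) (f : BimoduleHom X Y) (x : X) :
    (g.comp f) x = g (f x) := rfl

end API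

end Bimodules

/-! ### Differential calculi and the monoidal category of bimodule connections -/

/-- A first order differential calculus on `B`: a bimodule `Ω` of one-forms, generated by exact
forms, with a derivation `d : B → Ω`. -/
structure DiffCalculus (R : Type v) (B : Type u) [CommRing R] [Ring B] [Algebra R B] where
  Ω : BimoduleCat R B
  d : B →ₗ[R] Ω
  leibniz : ∀ a b : B, d (a * b) = rsmul (d a) b + a • d b
  generated : Submodule.span B (Set.range d) = ⊤

section Connections

variable {R : Type v} {B : Type u} [CommRing R] [Ring B] [Algebra R B]

/-- A bimodule connection on `E`: a left connection `∇ : E → Ω ⊗_B E` with a generalised braiding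
`σ : E ⊗_B Ω → Ω ⊗_B E`, a bimodule map. -/
structure BimodConn (𝒞 : DiffCalculus R B) (E : BimoduleCat R B) where
  nabla : E →ₗ[R] tensB 𝒞.Ω E
  braid : BimoduleHom (tensB E 𝒞.Ω) (tensB 𝒞.Ω E)
  leibniz_left : ∀ (b : B) (e : E), nabla (b • e) = 𝒞.d b ⊗ᵇ e + b • nabla e
  leibniz_right : ∀ (e : E) (b : B), nabla (rsmul e b) = rsmul (nabla e) b + braid (e ⊗ᵇ 𝒞.d b)

/-- Bimodules with bimodule connection. -/
structure ConnBimod (𝒞 : DiffCalculus R B) where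
  bimod : BimoduleCat R B
  conn : BimodConn 𝒞 bimod

variable {𝒞 : DiffCalculus R B}

/-- A bimodule map intertwines the connections. -/
def Intertwines {E F : BimoduleCat R B} (CE : BimodConn 𝒞 E) (CF : BimodConn 𝒞 F)
    (f : BimoduleHom E F) : Prop :=
  ∀ e, CF.nabla (f e) = mapB (BimoduleHom.id 𝒞.Ω) f (CE.nabla e)

/-- The morphisms are the bimodule maps that intertwine the connections. -/
@[ext]
structure ConnBimod.Hom (X Y : ConnBimod 𝒞) where
  hom : BimoduleHom X.bimod Y.bimod
  comm : Intertwines X.conn Y.conn hom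

lemma mapB_id_id (E F : BimoduleCat R B) :
    mapB (BimoduleHom.id E) (BimoduleHom.id F) = BimoduleHom.id (tensB E F) := by
  refine BimoduleHom.ext' fun t => ?_
  induction t using tensB_ind with
  | hmk x y => simp
  | hadd s t hs ht => rw [map_add, map_add, hs, ht]

lemma mapB_comp_apply {E E' E'' F F' F'' : BimoduleCat R B} (f : BimoduleHom E E')
    (f' : BimoduleHom E' E'') (g : BimoduleHom F F') (g' : BimoduleHom F' F'') (t : tensB E F) :
    mapB (f'.comp f) (g'.comp g) t = mapB f' g' (mapB f g t) := by
  induction t using tensB_ind with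
  | hmk x y => simp
  | hadd s t hs ht => simp only [map_add, hs, ht]

lemma id_comp_id (E : BimoduleCat R B) :
    (BimoduleHom.id E).comp (BimoduleHom.id E) = BimoduleHom.id E := rfl

lemma mapB_id_comp_apply {G F F' F'' : BimoduleCat R B}
    (g : BimoduleHom F F') (g' : BimoduleHom F' F'') (t : tensB G F) :
    mapB (BimoduleHom.id G) (g'.comp g) t =
      mapB (BimoduleHom.id G) g' (mapB (BimoduleHom.id G) g t) := by
  rw [← mapB_comp_apply, id_comp_id]

instance : Category (ConnBimod 𝒞) where
  Hom := ConnBimod.Hom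
  id X := ⟨BimoduleHom.id _, fun e => by rw [mapB_id_id]; rfl⟩
  comp f g := ⟨g.hom.comp f.hom, fun e => by
    rw [mapB_id_comp_apply, ← f.comm, ← g.comm]; rfl⟩

@[ext] lemma ConnBimod.hom_ext {X Y : ConnBimod 𝒞} {f g : X ⟶ Y}
    (h : ∀ x, f.hom x = g.hom x) : f = g :=
  ConnBimod.Hom.ext (BimoduleHom.ext' h)

@[simp] lemma ConnBimod.id_hom (X : ConnBimod 𝒞) (x : X.bimod) :
    ConnBimod.Hom.hom (𝟙 X) x = x := rfl

@[simp] lemma ConnBimod.comp_hom {X Y Z : ConnBimod 𝒞} (f : X ⟶ Y) (g : Y ⟶ Z) (x : X.bimod) :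
    ConnBimod.Hom.hom (f ≫ g) x = g.hom (f.hom x) := rfl

/-- The generalised braiding is natural, since `Ω` is generated by exact forms. -/
lemma Intertwines.braid {E F : BimoduleCat R B} {CE : BimodConn 𝒞 E} {CF : BimodConn 𝒞 F}
    {f : BimoduleHom E F} (h : Intertwines CE CF f) (e : E) (ξ : 𝒞.Ω) :
    CF.braid (f e ⊗ᵇ ξ) = mapB (BimoduleHom.id 𝒞.Ω) f (CE.braid (e ⊗ᵇ ξ)) := by
  have key : ∀ (b : B) (e : E), CF.braid (f e ⊗ᵇ 𝒞.d b) =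
      mapB (BimoduleHom.id 𝒞.Ω) f (CE.braid (e ⊗ᵇ 𝒞.d b)) := by
    intro b e
    have h1 := h (rsmul e b)
    rw [CE.leibniz_right, map_add, f.map_right, CF.leibniz_right, h e, BimoduleHom.map_right] at h1
    exact add_left_cancel h1
  have hξ : ξ ∈ Submodule.span B (Set.range 𝒞.d) := by rw [𝒞.generated]; trivial
  induction hξ using Submodule.span_induction generalizing e with
  | mem x hx => obtain ⟨b, rfl⟩ := hx; exact key b e
  | zero =>
    have h0 : ∀ (G : BimoduleCat R B) (g : G), g ⊗ᵇ (0 : 𝒞.Ω) = 0 := fun G g =>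
      map_zero (BTensor.mkₗ G 𝒞.Ω g)
    rw [h0, h0, map_zero, map_zero, map_zero]
  | add x y _ _ hx hy => rw [tmulB_add, tmulB_add, map_add, map_add, map_add, hx, hy]
  | smul b x _ hx => rw [← tmulB_balanced, ← tmulB_balanced, ← f.map_right, hx]

/-- `e ⊗ (ξ ⊗ f) ↦ σ(e ⊗ ξ) ⊗ f`. -/
def braidPast {E : BimoduleCat R B} (C : BimodConn 𝒞 E) (F : BimoduleCat R B) :
    BimoduleHom (tensB E (tensB 𝒞.Ω F)) (tensB 𝒞.Ω (tensB E F)) :=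
  (assocB 𝒞.Ω E F).comp ((mapB C.braid (BimoduleHom.id F)).comp (assocInvB E 𝒞.Ω F))

@[simp] lemma braidPast_tmulB {E : BimoduleCat R B} (C : BimodConn 𝒞 E) (F : BimoduleCat R B)
    (e : E) (ξ : 𝒞.Ω) (f : F) :
    braidPast C F (e ⊗ᵇ (ξ ⊗ᵇ f)) = assocB 𝒞.Ω E F (C.braid (e ⊗ᵇ ξ) ⊗ᵇ f) := by
  simp [braidPast]

/-- The map `e ⊗ f ↦ ∇ e ⊗ f + (σ ⊗ id)(e ⊗ ∇ f)`. -/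
def tensorNabla {E F : BimoduleCat R B} (CE : BimodConn 𝒞 E) (CF : BimodConn 𝒞 F) :
    tensB E F →ₗ[R] tensB 𝒞.Ω (tensB E F) :=
  liftB (fun e f => assocB 𝒞.Ω E F (CE.nabla e ⊗ᵇ f) + braidPast CE F (e ⊗ᵇ CF.nabla f))
    (by intro x x' y; simp only [map_add, add_tmulB]; abel)
    (by intro r x y; simp only [map_smul, scal_tmulB, smul_add])
    (by intro x y y'; simp only [map_add, tmulB_add]; abel)
    (by intro r x y; simp only [map_smul, tmulB_scal, smul_add])
    (by
      intro e b f
      rw [CE.leibniz_right, CF.leibniz_left, add_tmulB, map_add, tmulB_balanced, tmulB_add, map_add,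
        braidPast_tmulB, tmulB_balanced, add_assoc])

lemma tensorNabla_tmulB {E F : BimoduleCat R B} (CE : BimodConn 𝒞 E)
    (CF : BimodConn 𝒞 F) (e : E) (f : F) :
    tensorNabla CE CF (e ⊗ᵇ f) =
      assocB 𝒞.Ω E F (CE.nabla e ⊗ᵇ f) + braidPast CE F (e ⊗ᵇ CF.nabla f) :=
  liftB_tmulB _ _ _ _ _ _ _ _

/-- The map `e ⊗ f ⊗ ξ ↦ (σ ⊗ id)(e ⊗ σ(f ⊗ ξ))`. -/
def tensorBraid {E F : BimoduleCat R B} (CE : BimodConn 𝒞 E) (CF : BimodConn 𝒞 F) :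
    BimoduleHom (tensB (tensB E F) 𝒞.Ω) (tensB 𝒞.Ω (tensB E F)) :=
  (braidPast CE F).comp ((mapB (BimoduleHom.id E) CF.braid).comp (assocB E F 𝒞.Ω))

lemma tensorBraid_tmulB {E F : BimoduleCat R B} (CE : BimodConn 𝒞 E)
    (CF : BimodConn 𝒞 F) (e : E) (f : F) (ξ : 𝒞.Ω) :
    tensorBraid CE CF (e ⊗ᵇ f ⊗ᵇ ξ) = braidPast CE F (e ⊗ᵇ CF.braid (f ⊗ᵇ ξ)) := by
  rw [tensorBraid, BimoduleHom.comp_apply, BimoduleHom.comp_apply, assocB_tmulB, mapB_tmulB,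
    BimoduleHom.id_apply]

lemma tensorNabla_left {E F : BimoduleCat R B} (CE : BimodConn 𝒞 E) (CF : BimodConn 𝒞 F)
    (b : B) (t : tensB E F) :
    tensorNabla CE CF (b • t) = 𝒞.d b ⊗ᵇ t + b • tensorNabla CE CF t := by
  induction t using tensB_ind with
  | hmk e f =>
    rw [smul_tmulB, tensorNabla_tmulB, tensorNabla_tmulB, CE.leibniz_left, add_tmulB, map_add,
      assocB_tmulB, ← smul_tmulB, BimoduleHom.map_left, ← smul_tmulB, BimoduleHom.map_left,
      smul_add, add_assoc]
  | hadd s t hs ht => rw [smul_add, map_add, map_add, hs, ht, tmulB_add, smul_add]; abel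

lemma tensorNabla_right {E F : BimoduleCat R B} (CE : BimodConn 𝒞 E) (CF : BimodConn 𝒞 F)
    (t : tensB E F) (b : B) :
    tensorNabla CE CF (rsmul t b) =
      rsmul (tensorNabla CE CF t) b + tensorBraid CE CF (t ⊗ᵇ 𝒞.d b) := by
  induction t using tensB_ind with
  | hmk e f =>
    rw [rsmul_tmulB, tensorNabla_tmulB, tensorNabla_tmulB, CF.leibniz_right, ← rsmul_tmulB,
      BimoduleHom.map_right, tmulB_add, map_add, ← rsmul_tmulB, BimoduleHom.map_right,
      tensorBraid_tmulB, rsmul_add, add_assoc]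
  | hadd s t hs ht =>
    rw [rsmul_add, map_add, map_add, hs, ht, add_tmulB, map_add, rsmul_add]; abel

/-- The tensor product connection
`∇(e ⊗ f) = ∇ e ⊗ f + (σ ⊗ id)(e ⊗ ∇ f)`. -/
def BimodConn.tensor {E F : BimoduleCat R B} (CE : BimodConn 𝒞 E) (CF : BimodConn 𝒞 F) :
    BimodConn 𝒞 (tensB E F) where
  nabla := tensorNabla CE CF
  braid := tensorBraid CE CF
  leibniz_left := tensorNabla_left CE CF
  leibniz_right := tensorNabla_right CE CF

lemma BimodConn.tensor_nabla_tmulB {E F : BimoduleCat R B} (CE : BimodConn 𝒞 E)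
    (CF : BimodConn 𝒞 F) (e : E) (f : F) :
    (CE.tensor CF).nabla (e ⊗ᵇ f) =
      assocB 𝒞.Ω E F (CE.nabla e ⊗ᵇ f) + braidPast CE F (e ⊗ᵇ CF.nabla f) :=
  tensorNabla_tmulB CE CF e f

lemma BimodConn.tensor_braid_tmulB {E F : BimoduleCat R B} (CE : BimodConn 𝒞 E)
    (CF : BimodConn 𝒞 F) (e : E) (f : F) (ξ : 𝒞.Ω) :
    (CE.tensor CF).braid (e ⊗ᵇ f ⊗ᵇ ξ) = braidPast CE F (e ⊗ᵇ CF.braid (f ⊗ᵇ ξ)) :=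
  tensorBraid_tmulB CE CF e f ξ

/-- The connection `d` on the algebra itself, `b ↦ d b ⊗ 1`. -/
def unitConn (𝒞 : DiffCalculus R B) : BimodConn 𝒞 (unitB R B) where
  nabla := (runitInvB 𝒞.Ω).toLin ∘ₗ 𝒞.d ∘ₗ (toUnitB (R := R)).symm.toLinearMap
  braid := (runitInvB 𝒞.Ω).comp (lunitB 𝒞.Ω)
  leibniz_left b c := by
    obtain ⟨c, rfl⟩ := (toUnitB (R := R)).surjective c
    simp only [LinearMap.comp_apply, LinearEquiv.coe_coe, smul_toUnitB, LinearEquiv.symm_apply_apply,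
      𝒞.leibniz, map_add, BimoduleHom.map_left, BimoduleHom.map_right]
    congr 1
    rw [runitInvB_apply, rsmul_tmulB, rsmul_toUnitB, one_mul]
  leibniz_right c b := by
    obtain ⟨c, rfl⟩ := (toUnitB (R := R)).surjective c
    simp only [LinearMap.comp_apply, LinearEquiv.coe_coe, rsmul_toUnitB,
      LinearEquiv.symm_apply_apply, 𝒞.leibniz, map_add, BimoduleHom.map_left,
      BimoduleHom.map_right, BimoduleHom.comp_apply, lunitB_tmulB]

lemma unitConn_nabla (b : B) : (unitConn 𝒞).nabla (toUnitB b) = 𝒞.d b ⊗ᵇ toUnitB 1 := rfl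

lemma unitConn_braid (b : B) (ξ : 𝒞.Ω) :
    (unitConn 𝒞).braid (toUnitB b ⊗ᵇ ξ) = (b • ξ) ⊗ᵇ toUnitB 1 := by
  change runitInvB 𝒞.Ω (lunitB 𝒞.Ω _) = _
  rw [lunitB_tmulB, runitInvB_apply]

lemma Intertwines.tensor {E E' F F' : BimoduleCat R B} {CE : BimodConn 𝒞 E} {CE' : BimodConn 𝒞 E'}
    {CF : BimodConn 𝒞 F} {CF' : BimodConn 𝒞 F'} {f : BimoduleHom E E'} {g : BimoduleHom F F'}
    (hf : Intertwines CE CE' f) (hg : Intertwines CF CF' g) :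
    Intertwines (CE.tensor CF) (CE'.tensor CF') (mapB f g) := by
  have h1 : ∀ (z : tensB 𝒞.Ω E) (y : F), mapB (BimoduleHom.id 𝒞.Ω) (mapB f g) (assocB _ _ _ (z ⊗ᵇ y)) =
      assocB _ _ _ (mapB (BimoduleHom.id 𝒞.Ω) f z ⊗ᵇ g y) := by
    intro z y
    induction z using tensB_ind with
    | hmk ξ x => simp
    | hadd s t hs ht => simp only [add_tmulB, map_add, hs, ht]
  have h2 : ∀ (x : E) (w : tensB 𝒞.Ω F), mapB (BimoduleHom.id 𝒞.Ω) (mapB f g) (braidPast CE F (x ⊗ᵇ w)) =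
      braidPast CE' F' (f x ⊗ᵇ mapB (BimoduleHom.id 𝒞.Ω) g w) := by
    intro x w
    induction w using tensB_ind with
    | hmk ξ y => rw [braidPast_tmulB, h1, mapB_tmulB, braidPast_tmulB, BimoduleHom.id_apply, hf.braid]
    | hadd s t hs ht => simp only [tmulB_add, map_add, hs, ht]
  intro t
  induction t using tensB_ind with
  | hmk x y =>
    rw [mapB_tmulB, BimodConn.tensor_nabla_tmulB, BimodConn.tensor_nabla_tmulB, map_add, h1, h2,
      hf x, hg y]
  | hadd s t hs ht => simp only [map_add, hs, ht]

lemma Intertwines.assoc {E F G : BimoduleCat R B} (CE : BimodConn 𝒞 E) (CF : BimodConn 𝒞 F)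
    (CG : BimodConn 𝒞 G) :
    Intertwines ((CE.tensor CF).tensor CG) (CE.tensor (CF.tensor CG)) (assocB E F G) := by
  have h1 : ∀ (z : tensB 𝒞.Ω E) (f : F) (g : G), mapB (BimoduleHom.id 𝒞.Ω) (assocB E F G)
      (assocB _ _ _ (assocB _ _ _ (z ⊗ᵇ f) ⊗ᵇ g)) = assocB _ _ _ (z ⊗ᵇ (f ⊗ᵇ g)) := by
    intro z f g
    induction z using tensB_ind with
    | hmk ξ x => simp
    | hadd s t hs ht => simp only [add_tmulB, map_add, hs, ht]
  have h2 : ∀ (e : E) (w : tensB 𝒞.Ω F) (g : G), mapB (BimoduleHom.id 𝒞.Ω) (assocB E F G)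
      (assocB _ _ _ (braidPast CE F (e ⊗ᵇ w) ⊗ᵇ g)) =
      braidPast CE (tensB F G) (e ⊗ᵇ assocB _ _ _ (w ⊗ᵇ g)) := by
    intro e w g
    induction w using tensB_ind with
    | hmk ξ y => rw [braidPast_tmulB, h1, assocB_tmulB, braidPast_tmulB]
    | hadd s t hs ht => simp only [tmulB_add, add_tmulB, map_add, hs, ht]
  have h3 : ∀ (e : E) (f : F) (w : tensB 𝒞.Ω G), mapB (BimoduleHom.id 𝒞.Ω) (assocB E F G)
      (braidPast (CE.tensor CF) G (e ⊗ᵇ f ⊗ᵇ w)) =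
      braidPast CE (tensB F G) (e ⊗ᵇ braidPast CF G (f ⊗ᵇ w)) := by
    intro e f w
    induction w using tensB_ind with
    | hmk ξ y => rw [braidPast_tmulB, BimodConn.tensor_braid_tmulB, h2, braidPast_tmulB]
    | hadd s t hs ht => simp only [tmulB_add, map_add, hs, ht]
  intro t
  induction t using tensB_ind with
  | hmk t g =>
    induction t using tensB_ind with
    | hmk e f =>
      rw [assocB_tmulB, BimodConn.tensor_nabla_tmulB, BimodConn.tensor_nabla_tmulB,
        BimodConn.tensor_nabla_tmulB, BimodConn.tensor_nabla_tmulB, add_tmulB, map_add, map_add,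
        map_add, h1, h2, h3, tmulB_add, map_add, add_assoc]
    | hadd s t hs ht => simp only [add_tmulB, map_add, hs, ht]
  | hadd s t hs ht => simp only [map_add, hs, ht]

lemma Intertwines.lunit {E : BimoduleCat R B} (CE : BimodConn 𝒞 E) :
    Intertwines ((unitConn 𝒞).tensor CE) CE (lunitB E) := by
  have h2 : ∀ (b : B) (w : tensB 𝒞.Ω E), mapB (BimoduleHom.id 𝒞.Ω) (lunitB E)
      (braidPast (unitConn 𝒞) E (toUnitB b ⊗ᵇ w)) = b • w := by
    intro b w
    induction w using tensB_ind with
    | hmk ξ y =>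
      rw [braidPast_tmulB, unitConn_braid, assocB_tmulB, mapB_tmulB, lunitB_tmulB, smul_tmulB,
        one_smul, BimoduleHom.id_apply]
    | hadd s t hs ht => simp only [tmulB_add, map_add, hs, ht, smul_add]
  intro t
  induction t using tensB_ind with
  | hmk b x =>
    obtain ⟨b, rfl⟩ := (toUnitB (R := R)).surjective b
    rw [lunitB_tmulB, BimodConn.tensor_nabla_tmulB, map_add, h2, unitConn_nabla, assocB_tmulB,
      mapB_tmulB, lunitB_tmulB, one_smul, CE.leibniz_left, BimoduleHom.id_apply]
  | hadd s t hs ht => simp only [map_add, hs, ht]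

lemma Intertwines.runit {E : BimoduleCat R B} (CE : BimodConn 𝒞 E) :
    Intertwines (CE.tensor (unitConn 𝒞)) CE (runitB E) := by
  have h1 : ∀ (z : tensB 𝒞.Ω E) (b : B), mapB (BimoduleHom.id 𝒞.Ω) (runitB E)
      (assocB _ _ _ (z ⊗ᵇ toUnitB b)) = rsmul z b := by
    intro z b
    induction z using tensB_ind with
    | hmk ξ x =>
      rw [assocB_tmulB, mapB_tmulB, runitB_tmulB, BimoduleHom.id_apply, rsmul_tmulB]
    | hadd s t hs ht => rw [add_tmulB, map_add, map_add, hs, ht]; exact (smul_add _ _ _).symm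
  intro t
  induction t using tensB_ind with
  | hmk x b =>
    obtain ⟨b, rfl⟩ := (toUnitB (R := R)).surjective b
    rw [runitB_tmulB, BimodConn.tensor_nabla_tmulB, map_add, h1, unitConn_nabla, braidPast_tmulB, h1,
      CE.leibniz_right, rsmul_one]
  | hadd s t hs ht => simp only [map_add, hs, ht]

lemma Intertwines.inv {E F : BimoduleCat R B} {CE : BimodConn 𝒞 E} {CF : BimodConn 𝒞 F}
    {f : BimoduleHom E F} (h : Intertwines CE CF f) (g : BimoduleHom F E)
    (hfg : f.comp g = BimoduleHom.id F) (hgf : g.comp f = BimoduleHom.id E) :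
    Intertwines CF CE g := by
  intro y
  have h1 : f (g y) = y := congrArg (fun k : BimoduleHom F F => k y) hfg
  have h2 := h (g y)
  rw [h1] at h2
  rw [h2, ← mapB_id_comp_apply, hgf, mapB_id_id]
  rfl

/-- An invertible bimodule map that intertwines the connections is an isomorphism. -/
def ConnBimod.isoMk {X Y : ConnBimod 𝒞} (f : BimoduleHom X.bimod Y.bimod)
    (h : Intertwines X.conn Y.conn f) (g : BimoduleHom Y.bimod X.bimod)
    (hfg : f.comp g = BimoduleHom.id _) (hgf : g.comp f = BimoduleHom.id _) : X ≅ Y where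
  hom := ⟨f, h⟩
  inv := ⟨g, h.inv g hfg hgf⟩
  hom_inv_id := ConnBimod.Hom.ext hgf
  inv_hom_id := ConnBimod.Hom.ext hfg

lemma tensB_hom_ext {E F G : BimoduleCat R B} {f g : BimoduleHom (tensB E F) G}
    (h : ∀ x y, f (x ⊗ᵇ y) = g (x ⊗ᵇ y)) : f = g :=
  BimoduleHom.ext (BTensor.hom_ext h)

lemma tensB_hom_ext₃ {E F G H : BimoduleCat R B} {f g : BimoduleHom (tensB (tensB E F) G) H}
    (h : ∀ x y z, f (x ⊗ᵇ y ⊗ᵇ z) = g (x ⊗ᵇ y ⊗ᵇ z)) : f = g := by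
  refine tensB_hom_ext fun t z => ?_
  induction t using tensB_ind with
  | hmk x y => exact h x y z
  | hadd s t hs ht => simp only [add_tmulB, map_add, hs, ht]

lemma tensB_hom_ext₃' {E F G H : BimoduleCat R B} {f g : BimoduleHom (tensB E (tensB F G)) H}
    (h : ∀ x y z, f (x ⊗ᵇ (y ⊗ᵇ z)) = g (x ⊗ᵇ (y ⊗ᵇ z))) : f = g := by
  refine tensB_hom_ext fun x t => ?_
  induction t using tensB_ind with
  | hmk y z => exact h x y z
  | hadd s t hs ht => simp only [tmulB_add, map_add, hs, ht]

lemma tensB_hom_ext₄ {E F G H K : BimoduleCat R B}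
    {f g : BimoduleHom (tensB (tensB (tensB E F) G) H) K}
    (h : ∀ x y z w, f (x ⊗ᵇ y ⊗ᵇ z ⊗ᵇ w) = g (x ⊗ᵇ y ⊗ᵇ z ⊗ᵇ w)) : f = g := by
  refine tensB_hom_ext₃ fun t z w => ?_
  induction t using tensB_ind with
  | hmk x y => exact h x y z w
  | hadd s t hs ht => simp only [add_tmulB, map_add, hs, ht]

instance : MonoidalCategoryStruct (ConnBimod 𝒞) where
  tensorObj X Y := ⟨tensB X.bimod Y.bimod, X.conn.tensor Y.conn⟩
  tensorUnit := ⟨unitB R B, unitConn 𝒞⟩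
  tensorHom f g := ⟨mapB f.hom g.hom, Intertwines.tensor f.comm g.comm⟩
  whiskerLeft X _ _ g := ⟨mapB (BimoduleHom.id _) g.hom, Intertwines.tensor (ConnBimod.Hom.comm (𝟙 X)) g.comm⟩
  whiskerRight f Y := ⟨mapB f.hom (BimoduleHom.id _), Intertwines.tensor f.comm (ConnBimod.Hom.comm (𝟙 Y))⟩
  associator X Y Z := ConnBimod.isoMk (assocB _ _ _) (Intertwines.assoc _ _ _) (assocInvB _ _ _)
    (tensB_hom_ext₃' (by simp)) (tensB_hom_ext₃ (by simp))
  leftUnitor X := ConnBimod.isoMk (lunitB _) (Intertwines.lunit _) (lunitInvB _)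
    (BimoduleHom.ext' fun x => by simp [lunitInvB_apply])
    (tensB_hom_ext fun b x => by
      obtain ⟨b, rfl⟩ := (toUnitB (R := R)).surjective b
      simp [lunitInvB_apply, ← tmulB_balanced, rsmul_toUnitB])
  rightUnitor X := ConnBimod.isoMk (runitB _) (Intertwines.runit _) (runitInvB _)
    (BimoduleHom.ext' fun x => by
      rw [BimoduleHom.comp_apply, runitInvB_apply, runitB_tmulB, rsmul_one,
        BimoduleHom.id_apply])
    (tensB_hom_ext fun x b => by
      obtain ⟨b, rfl⟩ := (toUnitB (R := R)).surjective b
      rw [BimoduleHom.comp_apply, runitB_tmulB, runitInvB_apply, tmulB_balanced, smul_toUnitB,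
        mul_one, BimoduleHom.id_apply])

/-- The monoidal category of bimodules with bimodule connections. -/
instance : MonoidalCategory (ConnBimod 𝒞) where
  tensorHom_def f g := ConnBimod.Hom.ext (tensB_hom_ext fun x y => by rfl)
  id_tensorHom_id X Y := ConnBimod.Hom.ext (mapB_id_id _ _)
  tensorHom_comp_tensorHom f₁ f₂ g₁ g₂ := ConnBimod.Hom.ext (tensB_hom_ext fun x y => by rfl)
  whiskerLeft_id X Y := ConnBimod.Hom.ext (mapB_id_id _ _)
  id_whiskerRight X Y := ConnBimod.Hom.ext (mapB_id_id _ _)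
  associator_naturality f g h := ConnBimod.Hom.ext (tensB_hom_ext₃ fun x y z => by rfl)
  leftUnitor_naturality f := ConnBimod.Hom.ext (tensB_hom_ext fun b x => by
    exact (f.hom.map_left _ x).symm)
  rightUnitor_naturality f := ConnBimod.Hom.ext (tensB_hom_ext fun x b => by
    exact (f.hom.map_right x _).symm)
  pentagon W X Y Z := ConnBimod.Hom.ext (tensB_hom_ext₄ fun w x y z => by rfl)
  triangle X Y := ConnBimod.Hom.ext (tensB_hom_ext₃ fun x b y => by
    exact (tmulB_balanced x _ y).symm)

end Connections

/-! ### Classical geometry over a commutative algebra of functions -/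

section Classical

variable (A : Type u) [CommRing A] [Algebra ℂ A]

/-- Vector fields are the derivations of the algebra of functions. -/
abbrev VField : Type u := Derivation ℂ A A

variable {A} in
/-- The exact form `d a`, as a functional on vector fields. -/
def exactDual (a : A) : Module.Dual A (VField A) where
  toFun X := X a
  map_add' _ _ := rfl
  map_smul' _ _ := rfl

/-- The one-forms: the finite sums `∑ a db`, inside the functionals on vector fields. For the
functions on a Hausdorff, σ-compact manifold of finite dimension these are all the smooth one-forms,
as one sees by restricting the differentials of the coordinates of an embedding in some `ℝ^N`. -/
def oneForms : Submodule A (Module.Dual A (VField A)) := Submodule.span A (Set.range exactDual)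

/-- The module `Ω¹` of one-forms. -/
def OneForm : Type u := ↥(oneForms A)

instance : AddCommGroup (OneForm A) := inferInstanceAs (AddCommGroup ↥(oneForms A))

instance : Module A (OneForm A) := inferInstanceAs (Module A ↥(oneForms A))

instance : Module ℂ (OneForm A) := Module.compHom _ (algebraMap ℂ A)

variable {A} in
def OneForm.mk (ξ : Module.Dual A (VField A)) (h : ξ ∈ oneForms A) : OneForm A :=
  Subtype.mk (p := fun ξ => ξ ∈ oneForms A) ξ h

variable {A} in
/-- A one-form as a functional on vector fields. -/
def OneForm.toDual : OneForm A →ₗ[A] Module.Dual A (VField A) := (oneForms A).subtype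

variable {A} in
/-- The value `ξ(X)`. -/
def OneForm.eval (ξ : OneForm A) (X : VField A) : A := ξ.toDual X

variable {A} in
lemma OneForm.ext {ξ η : OneForm A} (h : ∀ X, ξ.eval X = η.eval X) : ξ = η :=
  Subtype.ext (LinearMap.ext h)

section OneFormLemmas

variable {A}

lemma OneForm.add_eval (ξ η : OneForm A) (X : VField A) :
    (ξ + η).eval X = ξ.eval X + η.eval X := rfl

lemma OneForm.smul_eval (a : A) (ξ : OneForm A) (X : VField A) :
    (a • ξ).eval X = a * ξ.eval X := rfl

lemma OneForm.eval_add (ξ : OneForm A) (X Y : VField A) :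
    ξ.eval (X + Y) = ξ.eval X + ξ.eval Y := map_add ξ.toDual X Y

lemma OneForm.eval_sub (ξ : OneForm A) (X Y : VField A) :
    ξ.eval (X - Y) = ξ.eval X - ξ.eval Y := map_sub ξ.toDual X Y

lemma OneForm.eval_smul (ξ : OneForm A) (a : A) (X : VField A) :
    ξ.eval (a • X) = a * ξ.eval X := map_smul ξ.toDual a X

lemma OneForm.mk_eval (ξ : Module.Dual A (VField A)) (h : ξ ∈ oneForms A) (X : VField A) :
    (OneForm.mk ξ h).eval X = ξ X := rfl

end OneFormLemmas

/-- The exterior derivative `d : A → Ω¹` on functions. -/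
def extD : Derivation ℂ A (OneForm A) :=
  Derivation.mk' (M := OneForm A)
    { toFun := fun a => OneForm.mk (exactDual a) (Submodule.subset_span ⟨a, rfl⟩)
      map_add' := fun a b => OneForm.ext fun X => map_add X a b
      map_smul' := fun c a => OneForm.ext fun X => by
        change X (c • a) = algebraMap ℂ A c * X a
        rw [Derivation.map_smul, Algebra.smul_def] }
    (fun a b => OneForm.ext fun X => X.leibniz a b)

variable {A}

lemma extD_eval (a : A) (X : VField A) : (extD A a).eval X = X a := rfl

@[elab_as_elim]
lemma OneForm.ind {p : OneForm A → Prop} (ξ : OneForm A) (hd : ∀ a, p (extD A a))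
    (h0 : p 0) (hadd : ∀ ξ η, p ξ → p η → p (ξ + η)) (hsmul : ∀ (a : A) ξ, p ξ → p (a • ξ)) :
    p ξ := by
  obtain ⟨ξ, hξ⟩ := ξ
  induction hξ using Submodule.span_induction with
  | mem x hx => obtain ⟨a, rfl⟩ := hx; exact hd a
  | zero => exact h0
  | add x y hx hy px py => exact hadd _ _ px py
  | smul a x hx px => exact hsmul a _ px

/-- `(L_Y ξ)(X) = Y(ξ(X)) - ξ([Y, X])` on functionals. -/
def lieDual (Y : VField A) (ξ : Module.Dual A (VField A)) : Module.Dual A (VField A) where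
  toFun X := Y (ξ X) - ξ ⁅Y, X⁆
  map_add' X X' := by rw [lie_add, map_add, map_add, map_add]; ring
  map_smul' a X := by
    have h : ⁅Y, a • X⁆ = a • ⁅Y, X⁆ + Y a • X := by
      ext b
      simp only [Derivation.commutator_apply, Derivation.smul_apply, Derivation.add_apply,
        smul_eq_mul, Derivation.leibniz]
      ring
    simp only [h, map_add, map_smul, smul_eq_mul, Derivation.leibniz, RingHom.id_apply]
    ring

lemma lieDual_mem (Y : VField A) (ξ : OneForm A) :
    lieDual Y ξ.toDual ∈ oneForms A := by
  induction ξ using OneForm.ind with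
  | hd a =>
    have h : lieDual Y (extD A a).toDual = exactDual (Y a) := by
      ext X
      change Y (X a) - ⁅Y, X⁆ a = X (Y a)
      rw [Derivation.commutator_apply]; ring
    rw [h]
    exact Submodule.subset_span ⟨_, rfl⟩
  | h0 =>
    have h : lieDual Y (0 : OneForm A).toDual = 0 := by
      ext X
      change Y 0 - 0 = 0
      rw [map_zero, sub_zero]
    rw [h]; exact zero_mem _
  | hadd ξ η hξ hη =>
    have h : lieDual Y (ξ + η).toDual =
        lieDual Y ξ.toDual + lieDual Y η.toDual := by
      ext X
      change Y (ξ.eval X + η.eval X) - (ξ.eval ⁅Y, X⁆ + η.eval ⁅Y, X⁆) =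
        (Y (ξ.eval X) - ξ.eval ⁅Y, X⁆) + (Y (η.eval X) - η.eval ⁅Y, X⁆)
      rw [map_add]; ring
    rw [h]; exact add_mem hξ hη
  | hsmul a ξ hξ =>
    have h : lieDual Y (a • ξ).toDual =
        Y a • ξ.toDual + a • lieDual Y ξ.toDual := by
      ext X
      change Y (a * ξ.eval X) - a * ξ.eval ⁅Y, X⁆ =
        Y a * ξ.eval X + a * (Y (ξ.eval X) - ξ.eval ⁅Y, X⁆)
      rw [Derivation.leibniz]; simp only [smul_eq_mul]; ring
    rw [h]
    exact add_mem (Submodule.smul_mem _ _ ξ.2) (Submodule.smul_mem _ _ hξ)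

/-- The Lie derivative of a one-form. -/
def lieForm (Y : VField A) (ξ : OneForm A) : OneForm A := OneForm.mk (lieDual Y ξ.toDual) (lieDual_mem Y ξ)

lemma lieForm_eval (Y : VField A) (ξ : OneForm A) (X : VField A) :
    (lieForm Y ξ).eval X = Y (ξ.eval X) - ξ.eval ⁅Y, X⁆ := rfl

lemma lieForm_add (Y : VField A) (ξ η : OneForm A) :
    lieForm Y (ξ + η) = lieForm Y ξ + lieForm Y η := by
  refine OneForm.ext fun X => ?_
  simp only [lieForm_eval, OneForm.add_eval, map_add]; ring

lemma lieForm_smul (Y : VField A) (a : A) (ξ : OneForm A) :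
    lieForm Y (a • ξ) = Y a • ξ + a • lieForm Y ξ := by
  refine OneForm.ext fun X => ?_
  simp only [lieForm_eval, OneForm.add_eval, OneForm.smul_eval, Derivation.leibniz, smul_eq_mul]
  ring

lemma lieForm_add_field (Y Y' : VField A) (ξ : OneForm A) :
    lieForm (Y + Y') ξ = lieForm Y ξ + lieForm Y' ξ := by
  refine OneForm.ext fun X => ?_
  simp only [lieForm_eval, OneForm.add_eval, OneForm.eval_add, add_lie, Derivation.add_apply]
  ring

lemma lieForm_smul_field (a : A) (Y : VField A) (ξ : OneForm A) :
    lieForm (a • Y) ξ = a • lieForm Y ξ + ξ.eval Y • extD A a := by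
  refine OneForm.ext fun X => ?_
  have h : ⁅a • Y, X⁆ = a • ⁅Y, X⁆ - X a • Y := by
    ext b
    simp only [Derivation.commutator_apply, Derivation.smul_apply, Derivation.sub_apply,
      smul_eq_mul, Derivation.leibniz]
    ring
  simp only [lieForm_eval, OneForm.add_eval, OneForm.smul_eval, extD_eval, h, OneForm.eval_sub,
    OneForm.eval_smul, Derivation.smul_apply, smul_eq_mul]
  ring

lemma lieForm_extD (Y : VField A) (a : A) : lieForm Y (extD A a) = extD A (Y a) := by
  refine OneForm.ext fun X => ?_
  simp only [lieForm_eval, extD_eval, Derivation.commutator_apply]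
  ring

/-- A connection `∇ : E → Ω¹ ⊗_A E` on an `A`-module (the sections of a bundle). -/
structure Conn (A : Type u) [CommRing A] [Algebra ℂ A] (E : Type u) [AddCommGroup E]
    [Module A E] where
  nabla : E →+ OneForm A ⊗[A] E
  leibniz : ∀ (a : A) (e : E), nabla (a • e) = extD A a ⊗ₜ[A] e + a • nabla e

variable {E F G : Type u} [AddCommGroup E] [Module A E] [AddCommGroup F] [Module A F]
  [AddCommGroup G] [Module A G]

/-- The contraction `ξ ⊗ e ↦ ξ(X) e`. -/
def contractField (X : VField A) : OneForm A ⊗[A] E →ₗ[A] E :=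
  TensorProduct.lift (LinearMap.mk₂ A (fun ξ e => ξ.eval X • e)
    (by intro ξ η e; rw [OneForm.add_eval, add_smul])
    (by intro a ξ e; rw [OneForm.smul_eval, mul_smul])
    (by intro ξ e e'; rw [smul_add])
    (by intro a ξ e; rw [smul_comm]))

@[simp] lemma contractField_tmul (X : VField A) (ξ : OneForm A) (e : E) :
    contractField X (ξ ⊗ₜ[A] e) = ξ.eval X • e := rfl

namespace Conn

variable (D : Conn A E)

/-- The covariant derivative `∇_X e`. -/
def cov (X : VField A) : E →+ E := (contractField X).toAddMonoidHom.comp D.nabla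

lemma cov_apply (X : VField A) (e : E) : D.cov X e = contractField X (D.nabla e) := rfl

lemma cov_smul (X : VField A) (a : A) (e : E) : D.cov X (a • e) = X a • e + a • D.cov X e := by
  rw [cov_apply, D.leibniz, map_add, map_smul, contractField_tmul, extD_eval, cov_apply]

lemma contractField_add (X Y : VField A) (z : OneForm A ⊗[A] E) :
    contractField (X + Y) z = contractField X z + contractField Y z := by
  induction z using TensorProduct.induction_on with
  | zero => simp
  | tmul ξ e => simp only [contractField_tmul, OneForm.eval_add, add_smul]
  | add s t hs ht => simp only [map_add, hs, ht]; abel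

lemma contractField_smul (a : A) (X : VField A) (z : OneForm A ⊗[A] E) :
    contractField (a • X) z = a • contractField X z := by
  induction z using TensorProduct.induction_on with
  | zero => simp
  | tmul ξ e => simp only [contractField_tmul, OneForm.eval_smul, mul_smul]
  | add s t hs ht => simp only [map_add, hs, ht, smul_add]

lemma cov_add_field (X Y : VField A) (e : E) : D.cov (X + Y) e = D.cov X e + D.cov Y e :=
  contractField_add X Y _

lemma cov_smul_field (a : A) (X : VField A) (e : E) : D.cov (a • X) e = a • D.cov X e :=
  contractField_smul a X _

/-- The operator `ξ ⊗ e ↦ L_Y ξ ⊗ e + ξ ⊗ ∇_Y e` on one-forms with values in `E`. -/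
def lieCov (Y : VField A) : OneForm A ⊗[A] E →+ OneForm A ⊗[A] E :=
  TensorProduct.liftAddHom
    (AddMonoidHom.mk' (fun ξ => AddMonoidHom.mk'
        (fun e => lieForm Y ξ ⊗ₜ[A] e + ξ ⊗ₜ[A] D.cov Y e)
        (by intro e e'; simp only [TensorProduct.tmul_add, map_add]; abel))
      (by
        intro ξ η
        ext e
        simp only [AddMonoidHom.mk'_apply, AddMonoidHom.add_apply, lieForm_add,
          TensorProduct.add_tmul]
        abel))
    (by
      intro a ξ e
      simp only [AddMonoidHom.mk'_apply, lieForm_smul, cov_smul, TensorProduct.add_tmul,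
        TensorProduct.tmul_add, TensorProduct.smul_tmul', TensorProduct.tmul_smul]
      abel)

lemma lieCov_tmul (Y : VField A) (ξ : OneForm A) (e : E) :
    D.lieCov Y (ξ ⊗ₜ[A] e) = lieForm Y ξ ⊗ₜ[A] e + ξ ⊗ₜ[A] D.cov Y e := rfl

lemma lieCov_smul (Y : VField A) (a : A) (z : OneForm A ⊗[A] E) :
    D.lieCov Y (a • z) = Y a • z + a • D.lieCov Y z := by
  induction z using TensorProduct.induction_on with
  | zero => simp
  | tmul ξ e =>
    rw [TensorProduct.smul_tmul', lieCov_tmul, lieCov_tmul, lieForm_smul, TensorProduct.add_tmul,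
      smul_add, TensorProduct.smul_tmul', TensorProduct.smul_tmul', TensorProduct.smul_tmul',
      add_assoc]
  | add s t hs ht => simp only [smul_add, map_add, hs, ht]; abel

lemma lieCov_add_field (Y Y' : VField A) (z : OneForm A ⊗[A] E) :
    D.lieCov (Y + Y') z = D.lieCov Y z + D.lieCov Y' z := by
  induction z using TensorProduct.induction_on with
  | zero => simp
  | tmul ξ e =>
    simp only [lieCov_tmul, lieForm_add_field, cov_add_field, TensorProduct.add_tmul,
      TensorProduct.tmul_add]
    abel
  | add s t hs ht => simp only [map_add, hs, ht]; abel

lemma lieCov_smul_field (a : A) (Y : VField A) (z : OneForm A ⊗[A] E) :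
    D.lieCov (a • Y) z = a • D.lieCov Y z + extD A a ⊗ₜ[A] contractField Y z := by
  induction z using TensorProduct.induction_on with
  | zero => simp
  | tmul ξ e =>
    simp only [lieCov_tmul, lieForm_smul_field, cov_smul_field, TensorProduct.add_tmul,
      contractField_tmul, smul_add, TensorProduct.smul_tmul', TensorProduct.tmul_smul]
    abel
  | add s t hs ht => simp only [map_add, hs, ht, TensorProduct.tmul_add, smul_add]; abel

lemma contractField_lieCov (X Y : VField A) (z : OneForm A ⊗[A] E) :
    contractField X (D.lieCov Y z) = D.cov Y (contractField X z) - contractField ⁅Y, X⁆ z := by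
  induction z using TensorProduct.induction_on with
  | zero => simp
  | tmul ξ e =>
    simp only [lieCov_tmul, map_add, contractField_tmul, lieForm_eval, cov_smul, sub_smul]
    abel
  | add s t hs ht => simp only [map_add, hs, ht]; abel

/-- The curvature contracted with a vector field `Y` in its second slot: in local coordinates
`dx^k ⊗ Y^j [∇_k, ∇_j] e`. -/
def curv : E →ₗ[A] VField A →ₗ[A] OneForm A ⊗[A] E :=
  LinearMap.mk₂ A (fun e Y => D.nabla (D.cov Y e) - D.lieCov Y (D.nabla e))
    (by intro e e' Y; simp only [map_add]; abel)
    (by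
      intro a e Y
      rw [cov_smul, map_add, D.leibniz, D.leibniz, D.leibniz, map_add, lieCov_tmul, lieCov_smul,
        lieForm_extD, smul_sub]
      abel)
    (by intro e Y Y'; rw [cov_add_field, map_add, lieCov_add_field]; abel)
    (by
      intro a e Y
      rw [cov_smul_field, D.leibniz, lieCov_smul_field, smul_sub, ← cov_apply]
      abel)

lemma curv_apply (e : E) (Y : VField A) :
    D.curv e Y = D.nabla (D.cov Y e) - D.lieCov Y (D.nabla e) := rfl

/-- The value of `curv` on a vector field `X` is the usual curvature `R(X, Y) e`. -/
lemma contractField_curv (X Y : VField A) (e : E) :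
    contractField X (D.curv e Y) =
      D.cov X (D.cov Y e) - D.cov Y (D.cov X e) - D.cov ⁅X, Y⁆ e := by
  have h : D.cov ⁅X, Y⁆ e = - D.cov ⁅Y, X⁆ e := by
    have h1 : (⁅X, Y⁆ : VField A) = (-1 : A) • ⁅Y, X⁆ := by
      rw [← lie_skew, neg_one_smul]
    rw [h1, cov_smul_field, neg_one_smul]
  rw [curv_apply, map_sub, contractField_lieCov, ← cov_apply, ← cov_apply, ← cov_apply, h]
  abel

end Conn

/-- The tensor product connection `∇(e ⊗ f) = ∇ e ⊗ f + e ⊗ ∇ f`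
(with the one-form moved to the left). -/
def Conn.tensor (DE : Conn A E) (DF : Conn A F) : Conn A (E ⊗[A] F) where
  nabla := TensorProduct.liftAddHom
    (AddMonoidHom.mk' (fun e => AddMonoidHom.mk'
        (fun f => TensorProduct.assoc A (OneForm A) E F (DE.nabla e ⊗ₜ[A] f) +
          TensorProduct.leftComm A E (OneForm A) F (e ⊗ₜ[A] DF.nabla f))
        (by intro f f'; simp only [TensorProduct.tmul_add, map_add]; abel))
      (by
        intro e e'
        ext f
        simp only [AddMonoidHom.mk'_apply, AddMonoidHom.add_apply, map_add,
          TensorProduct.add_tmul]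
        abel))
    (by
      intro a e f
      simp only [AddMonoidHom.mk'_apply, DE.leibniz, DF.leibniz, TensorProduct.add_tmul,
        TensorProduct.tmul_add, map_add, TensorProduct.smul_tmul', TensorProduct.tmul_smul,
        TensorProduct.assoc_tmul, TensorProduct.leftComm_tmul, map_smul]
      abel)
  leibniz a t := by
    induction t using TensorProduct.induction_on with
    | zero => simp
    | tmul e f =>
      simp only [TensorProduct.smul_tmul', TensorProduct.liftAddHom_tmul, AddMonoidHom.mk'_apply,
        DE.leibniz, TensorProduct.add_tmul, map_add, TensorProduct.assoc_tmul, smul_add,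
        ← map_smul]
      abel
    | add s t hs ht => simp only [smul_add, map_add, hs, ht, TensorProduct.tmul_add]; abel

lemma Conn.tensor_nabla_tmul (DE : Conn A E) (DF : Conn A F) (e : E) (f : F) :
    (DE.tensor DF).nabla (e ⊗ₜ[A] f) =
      TensorProduct.assoc A (OneForm A) E F (DE.nabla e ⊗ₜ[A] f) +
        TensorProduct.leftComm A E (OneForm A) F (e ⊗ₜ[A] DF.nabla f) := rfl

/-- The connection `d` on the trivial line bundle. -/
def Conn.triv (A : Type u) [CommRing A] [Algebra ℂ A] : Conn A A where
  nabla := AddMonoidHom.mk' (fun a => extD A a ⊗ₜ[A] (1 : A))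
    (by intro a b; rw [map_add, TensorProduct.add_tmul])
  leibniz a b := by
    simp only [AddMonoidHom.mk'_apply, smul_eq_mul, Derivation.leibniz, TensorProduct.add_tmul,
      TensorProduct.smul_tmul']
    rw [add_comm, TensorProduct.smul_tmul, smul_eq_mul, mul_one]

lemma Conn.triv_nabla (a : A) : (Conn.triv A).nabla a = extD A a ⊗ₜ[A] (1 : A) := rfl

lemma Conn.triv_cov (X : VField A) (a : A) : (Conn.triv A).cov X a = X a := by
  rw [Conn.cov_apply, Conn.triv_nabla, contractField_tmul, extD_eval, smul_eq_mul, mul_one]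

/-- A module map intertwines the connections. -/
def Parallel (DE : Conn A E) (DF : Conn A F) (T : E →ₗ[A] F) : Prop :=
  ∀ e, DF.nabla (T e) = T.lTensor (OneForm A) (DE.nabla e)

end Classical

/-! ### The monoidal category of classical bundles with connection -/

/-- A vector bundle, given by its finitely generated projective module of sections, with a
connection. -/
structure ClassicalBundle (A : Type u) [CommRing A] [Algebra ℂ A] where
  sections : Type u
  [addCommGroup : AddCommGroup sections]
  [module : Module A sections]
  [finite : Module.Finite A sections]
  [projective : Module.Projective A sections]
  conn : Conn A sections

attribute [instance] ClassicalBundle.addCommGroup ClassicalBundle.module ClassicalBundle.finite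
  ClassicalBundle.projective

section ClassicalCategory

variable {A : Type u} [CommRing A] [Algebra ℂ A]

/-- Bundle maps that intertwine the connections. -/
@[ext]
structure ClassicalBundle.Hom (X Y : ClassicalBundle A) where
  toLin : X.sections →ₗ[A] Y.sections
  parallel : Parallel X.conn Y.conn toLin

instance : Category (ClassicalBundle A) where
  Hom := ClassicalBundle.Hom
  id X := ⟨LinearMap.id, fun e => by simp⟩
  comp f g := ⟨g.toLin ∘ₗ f.toLin, fun e => by
    rw [LinearMap.lTensor_comp, LinearMap.comp_apply, LinearMap.comp_apply, ← f.parallel,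
      ← g.parallel]⟩

@[ext] lemma ClassicalBundle.hom_ext {X Y : ClassicalBundle A} {f g : X ⟶ Y}
    (h : ∀ x, f.toLin x = g.toLin x) : f = g :=
  ClassicalBundle.Hom.ext (LinearMap.ext h)

section Lemmas

variable {E E' F F' G : Type u} [AddCommGroup E] [Module A E] [AddCommGroup F] [Module A F]
  [AddCommGroup E'] [Module A E'] [AddCommGroup F'] [Module A F'] [AddCommGroup G] [Module A G]

lemma Parallel.refl (DE : Conn A E) : Parallel DE DE LinearMap.id := fun e => by simp

lemma Parallel.tensor {DE : Conn A E} {DE' : Conn A E'} {DF : Conn A F} {DF' : Conn A F'}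
    {S : E →ₗ[A] E'} {T : F →ₗ[A] F'} (hS : Parallel DE DE' S) (hT : Parallel DF DF' T) :
    Parallel (DE.tensor DF) (DE'.tensor DF') (TensorProduct.map S T) := by
  have h1 : ∀ (z : OneForm A ⊗[A] E) (f : F),
      TensorProduct.assoc A (OneForm A) E' F' (S.lTensor (OneForm A) z ⊗ₜ[A] T f) =
      (TensorProduct.map S T).lTensor (OneForm A)
        (TensorProduct.assoc A (OneForm A) E F (z ⊗ₜ[A] f)) := by
    intro z f
    induction z using TensorProduct.induction_on with
    | zero => simp
    | tmul ξ e => simp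
    | add s t hs ht => simp only [TensorProduct.add_tmul, map_add, hs, ht]
  have h2 : ∀ (e : E) (z : OneForm A ⊗[A] F),
      TensorProduct.leftComm A E' (OneForm A) F' (S e ⊗ₜ[A] T.lTensor (OneForm A) z) =
      (TensorProduct.map S T).lTensor (OneForm A)
        (TensorProduct.leftComm A E (OneForm A) F (e ⊗ₜ[A] z)) := by
    intro e z
    induction z using TensorProduct.induction_on with
    | zero => simp
    | tmul ξ e => simp
    | add s t hs ht => simp only [TensorProduct.tmul_add, map_add, hs, ht]
  intro t
  induction t using TensorProduct.induction_on with
  | zero => simp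
  | tmul e f =>
    rw [TensorProduct.map_tmul, Conn.tensor_nabla_tmul, Conn.tensor_nabla_tmul, hS e, hT f, h1, h2,
      map_add]
  | add s t hs ht => simp only [map_add, hs, ht]

lemma Parallel.symm {DE : Conn A E} {DF : Conn A F} {T : E ≃ₗ[A] F}
    (h : Parallel DE DF T.toLinearMap) : Parallel DF DE T.symm.toLinearMap := by
  intro f
  have h1 := h (T.symm f)
  simp only [LinearEquiv.coe_coe, LinearEquiv.apply_symm_apply] at h1
  rw [h1, ← LinearMap.comp_apply, ← LinearMap.lTensor_comp]
  simp

lemma Parallel.assoc (DE : Conn A E) (DF : Conn A F) (DG : Conn A G) :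
    Parallel ((DE.tensor DF).tensor DG) (DE.tensor (DF.tensor DG))
      (TensorProduct.assoc A E F G).toLinearMap := by
  intro t
  induction t using TensorProduct.induction_on with
  | zero => simp
  | tmul t g =>
    induction t using TensorProduct.induction_on with
    | zero => simp
    | tmul e f =>
      simp only [LinearEquiv.coe_coe, TensorProduct.assoc_tmul, Conn.tensor_nabla_tmul,
        TensorProduct.add_tmul, TensorProduct.tmul_add, map_add]
      have h1 : ∀ z : OneForm A ⊗[A] E,
          TensorProduct.assoc A (OneForm A) E (F ⊗[A] G) (z ⊗ₜ[A] (f ⊗ₜ[A] g)) =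
          (TensorProduct.assoc A E F G).toLinearMap.lTensor (OneForm A)
            (TensorProduct.assoc A (OneForm A) (E ⊗[A] F) G
              (TensorProduct.assoc A (OneForm A) E F (z ⊗ₜ[A] f) ⊗ₜ[A] g)) := by
        intro z
        induction z using TensorProduct.induction_on with
        | zero => simp
        | tmul ξ e => simp
        | add s t hs ht => simp only [TensorProduct.add_tmul, map_add, hs, ht]
      have h2 : ∀ z : OneForm A ⊗[A] F,
          TensorProduct.leftComm A E (OneForm A) (F ⊗[A] G)
            (e ⊗ₜ[A] TensorProduct.assoc A (OneForm A) F G (z ⊗ₜ[A] g)) =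
          (TensorProduct.assoc A E F G).toLinearMap.lTensor (OneForm A)
            (TensorProduct.assoc A (OneForm A) (E ⊗[A] F) G
              (TensorProduct.leftComm A E (OneForm A) F (e ⊗ₜ[A] z) ⊗ₜ[A] g)) := by
        intro z
        induction z using TensorProduct.induction_on with
        | zero => simp
        | tmul ξ e => simp
        | add s t hs ht =>
          simp only [TensorProduct.add_tmul, TensorProduct.tmul_add, map_add, hs, ht]
      have h3 : ∀ z : OneForm A ⊗[A] G,
          TensorProduct.leftComm A E (OneForm A) (F ⊗[A] G)
            (e ⊗ₜ[A] TensorProduct.leftComm A F (OneForm A) G (f ⊗ₜ[A] z)) =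
          (TensorProduct.assoc A E F G).toLinearMap.lTensor (OneForm A)
            (TensorProduct.leftComm A (E ⊗[A] F) (OneForm A) G ((e ⊗ₜ[A] f) ⊗ₜ[A] z)) := by
        intro z
        induction z using TensorProduct.induction_on with
        | zero => simp
        | tmul ξ e => simp
        | add s t hs ht => simp only [TensorProduct.tmul_add, map_add, hs, ht]
      rw [h1, h2, h3, add_assoc]
    | add s t hs ht => simp only [TensorProduct.add_tmul, map_add, hs, ht]
  | add s t hs ht => simp only [map_add, hs, ht]

lemma Parallel.lid (DE : Conn A E) :
    Parallel ((Conn.triv A).tensor DE) DE (TensorProduct.lid A E).toLinearMap := by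
  have h : ∀ (a : A) (z : OneForm A ⊗[A] E),
      (TensorProduct.lid A E).toLinearMap.lTensor (OneForm A)
        (TensorProduct.leftComm A A (OneForm A) E (a ⊗ₜ[A] z)) = a • z := by
    intro a z
    induction z using TensorProduct.induction_on with
    | zero => simp
    | tmul ξ e => simp
    | add s t hs ht => simp only [TensorProduct.tmul_add, map_add, hs, ht, smul_add]
  intro t
  induction t using TensorProduct.induction_on with
  | zero => simp
  | tmul a e =>
    rw [Conn.tensor_nabla_tmul, map_add, h, Conn.triv_nabla]
    simp [DE.leibniz]
  | add s t hs ht => simp only [map_add, hs, ht]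

lemma Parallel.rid (DE : Conn A E) :
    Parallel (DE.tensor (Conn.triv A)) DE (TensorProduct.rid A E).toLinearMap := by
  have h : ∀ (z : OneForm A ⊗[A] E) (a : A),
      (TensorProduct.rid A E).toLinearMap.lTensor (OneForm A)
        (TensorProduct.assoc A (OneForm A) E A (z ⊗ₜ[A] a)) = a • z := by
    intro z a
    induction z using TensorProduct.induction_on with
    | zero => simp
    | tmul ξ e => simp
    | add s t hs ht => simp only [TensorProduct.add_tmul, map_add, hs, ht, smul_add]
  intro t
  induction t using TensorProduct.induction_on with
  | zero => simp
  | tmul e a =>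
    rw [Conn.tensor_nabla_tmul, map_add, h, Conn.triv_nabla]
    simp [DE.leibniz, add_comm]
  | add s t hs ht => simp only [map_add, hs, ht]

end Lemmas

/-- An invertible bundle map that intertwines the connections is an isomorphism. -/
def ClassicalBundle.isoMk {X Y : ClassicalBundle A} (T : X.sections ≃ₗ[A] Y.sections)
    (h : Parallel X.conn Y.conn T.toLinearMap) : X ≅ Y where
  hom := ⟨T.toLinearMap, h⟩
  inv := ⟨T.symm.toLinearMap, h.symm⟩
  hom_inv_id := ClassicalBundle.hom_ext fun x => T.symm_apply_apply x
  inv_hom_id := ClassicalBundle.hom_ext fun x => T.apply_symm_apply x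

instance : MonoidalCategoryStruct (ClassicalBundle A) where
  tensorObj X Y := ⟨X.sections ⊗[A] Y.sections, X.conn.tensor Y.conn⟩
  tensorUnit := ⟨A, Conn.triv A⟩
  tensorHom f g := ⟨TensorProduct.map f.toLin g.toLin, Parallel.tensor f.parallel g.parallel⟩
  whiskerLeft X _ _ g :=
    ⟨TensorProduct.map LinearMap.id g.toLin, Parallel.tensor (Parallel.refl _) g.parallel⟩
  whiskerRight f Y :=
    ⟨TensorProduct.map f.toLin LinearMap.id, Parallel.tensor f.parallel (Parallel.refl _)⟩
  associator X Y Z := ClassicalBundle.isoMk (TensorProduct.assoc A _ _ _) (Parallel.assoc _ _ _)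
  leftUnitor X := ClassicalBundle.isoMk (TensorProduct.lid A _) (Parallel.lid _)
  rightUnitor X := ClassicalBundle.isoMk (TensorProduct.rid A _) (Parallel.rid _)

/-- The monoidal category of classical bundles with connection. -/
instance : MonoidalCategory (ClassicalBundle A) where
  tensorHom_def f g := ClassicalBundle.Hom.ext (TensorProduct.ext' fun x y => by rfl)
  id_tensorHom_id X Y := ClassicalBundle.Hom.ext TensorProduct.map_id
  tensorHom_comp_tensorHom f₁ f₂ g₁ g₂ :=
    ClassicalBundle.Hom.ext (TensorProduct.ext' fun x y => by rfl)
  whiskerLeft_id X Y := ClassicalBundle.Hom.ext TensorProduct.map_id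
  id_whiskerRight X Y := ClassicalBundle.Hom.ext TensorProduct.map_id
  associator_naturality f g h :=
    ClassicalBundle.Hom.ext (TensorProduct.ext_threefold fun x y z => by rfl)
  leftUnitor_naturality f := ClassicalBundle.Hom.ext (TensorProduct.ext' fun a x => by
    exact (f.toLin.map_smul a x).symm)
  rightUnitor_naturality f := ClassicalBundle.Hom.ext (TensorProduct.ext' fun x a => by
    exact (f.toLin.map_smul a x).symm)
  pentagon W X Y Z := ClassicalBundle.Hom.ext (TensorProduct.ext_fourfold fun w x y z => by rfl)
  triangle X Y := ClassicalBundle.Hom.ext (TensorProduct.ext_threefold fun x a y => by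
    exact (TensorProduct.smul_tmul a x y).symm)

end ClassicalCategory

/-! ### Quantisation to first order -/

section Quantisation

/-- An antisymmetric bivector `ω = ω^{ij} ∂_i ⊗ ∂_j`, given by its contraction
`ξ ↦ ω^{ij} ξ_i ∂_j` with one-forms. -/
structure Bivector (A : Type u) [CommRing A] [Algebra ℂ A] where
  sharp : OneForm A →ₗ[A] VField A
  alt : ∀ ξ : OneForm A, ξ.eval (sharp ξ) = 0

variable {A : Type u} [CommRing A] [Algebra ℂ A]
variable {E F G : Type u} [AddCommGroup E] [Module A E] [AddCommGroup F] [Module A F]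
  [AddCommGroup G] [Module A G]

namespace Bivector

variable (ω : Bivector A)

/-- The hamiltonian vector field `ω^{ij} a_{,i} ∂_j` of a function. -/
def ham (a : A) : VField A := ω.sharp (extD A a)

/-- The bracket `{a, b} = ω^{ij} a_{,i} b_{,j}`. -/
def bracket (a b : A) : A := ω.ham a b

lemma antisymm (ξ η : OneForm A) : ξ.eval (ω.sharp η) = - η.eval (ω.sharp ξ) := by
  have h := ω.alt (ξ + η)
  rw [map_add, OneForm.eval_add, OneForm.add_eval, OneForm.add_eval, ω.alt, ω.alt, zero_add,
    add_zero] at h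
  exact eq_neg_of_add_eq_zero_right h

lemma bracket_antisymm (a b : A) : ω.bracket a b = - ω.bracket b a :=
  ω.antisymm (extD A b) (extD A a)

lemma ham_add (a b : A) : ω.ham (a + b) = ω.ham a + ω.ham b := by
  rw [ham, map_add, map_add]; rfl

lemma ham_mul (a b : A) : ω.ham (a * b) = a • ω.ham b + b • ω.ham a := by
  rw [ham, Derivation.leibniz, map_add, map_smul, map_smul]; rfl

lemma ham_scalar (c : ℂ) : ω.ham (algebraMap ℂ A c) = 0 := by
  rw [ham, Derivation.map_algebraMap, map_zero]

lemma ham_zero : ω.ham 0 = 0 := by rw [ham, map_zero, map_zero]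

lemma ham_one : ω.ham 1 = 0 := by rw [ham, Derivation.map_one_eq_zero, map_zero]

/-- The contraction `ω^{ij} ξ_i η_j` of two one-forms. -/
def pairing : OneForm A →ₗ[A] OneForm A →ₗ[A] A :=
  LinearMap.mk₂ A (fun ξ η => η.eval (ω.sharp ξ))
    (by intro ξ ξ' η; rw [map_add, OneForm.eval_add])
    (by intro a ξ η; rw [map_smul, OneForm.eval_smul, smul_eq_mul])
    (by intro ξ η η'; rw [OneForm.add_eval])
    (by intro a ξ η; rw [OneForm.smul_eval, smul_eq_mul])

/-- The contraction `(ξ ⊗ e, η ⊗ f) ↦ ω^{ij} ξ_i η_j e ⊗ f`. -/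
def contract : OneForm A ⊗[A] E →ₗ[A] OneForm A ⊗[A] F →ₗ[A] E ⊗[A] F :=
  (TensorProduct.map₂ ω.pairing (TensorProduct.mk A E F)).compr₂
    (TensorProduct.lid A (E ⊗[A] F)).toLinearMap

lemma contract_tmul (ξ η : OneForm A) (e : E) (f : F) :
    ω.contract (ξ ⊗ₜ[A] e) (η ⊗ₜ[A] f) = η.eval (ω.sharp ξ) • (e ⊗ₜ[A] f) := by
  simp [contract, pairing]

lemma contract_left (ξ : OneForm A) (e : E) (w : OneForm A ⊗[A] F) :
    ω.contract (ξ ⊗ₜ[A] e) w = e ⊗ₜ[A] contractField (ω.sharp ξ) w := by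
  induction w using TensorProduct.induction_on with
  | zero => simp
  | tmul η f => rw [contract_tmul, contractField_tmul, TensorProduct.tmul_smul]
  | add s t hs ht => rw [map_add, hs, ht, map_add, TensorProduct.tmul_add]

lemma contract_right (z : OneForm A ⊗[A] E) (η : OneForm A) (f : F) :
    ω.contract z (η ⊗ₜ[A] f) = - (contractField (ω.sharp η) z ⊗ₜ[A] f) := by
  induction z using TensorProduct.induction_on with
  | zero => simp
  | tmul ξ e =>
    rw [contract_tmul, contractField_tmul, ω.antisymm, neg_smul, TensorProduct.smul_tmul']
  | add s t hs ht =>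
    rw [map_add, LinearMap.add_apply, hs, ht, map_add, TensorProduct.add_tmul, neg_add]

/-- The contraction of the curvature with `ω` on one-forms with values in `E`:
`dx^i ⊗ e ↦ ω^{ij} dx^k ⊗ [∇_k, ∇_j] e`. -/
def curvContract (D : Conn A E) : OneForm A ⊗[A] E →ₗ[A] OneForm A ⊗[A] E :=
  TensorProduct.lift (D.curv.flip ∘ₗ ω.sharp)

lemma curvContract_tmul (D : Conn A E) (ξ : OneForm A) (e : E) :
    ω.curvContract D (ξ ⊗ₜ[A] e) = D.curv e (ω.sharp ξ) := rfl

end Bivector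

/-- The Poisson-compatibility of a bivector `ω` and a linear connection `∇` on one-forms. Locally
it says `d(ω^{ij}) - ω^{kj} ∇_k(dx^i) - ω^{ik} ∇_k(dx^j) = 0`; for functions `a, b` in place of the
coordinates `x^i, x^j` this reads
`d{a, b} - ω^{kj} b_{,j} ∇_k(da) - ω^{ik} a_{,i} ∇_k(db) = 0`. -/
def PoissonCompatible (ω : Bivector A) (D : Conn A (OneForm A)) : Prop :=
  ∀ a b : A, extD A (ω.bracket a b) + D.cov (ω.ham b) (extD A a) - D.cov (ω.ham a) (extD A b) = 0

/-- The scalar `1/2`. -/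
def half (A : Type u) [CommRing A] [Algebra ℂ A] : A := algebraMap ℂ A (1 / 2)

lemma half_add_half (A : Type u) [CommRing A] [Algebra ℂ A] : half A + half A = 1 := by
  rw [half, ← map_add, ← map_one (algebraMap ℂ A)]
  norm_num

/-- The first order quantised algebra `A₁ = A ⊕ λ A`, with
`a • b = a b + (λ/2) {a, b}` for `a, b` in `A`. -/
@[ext]
structure QAlg (ω : Bivector A) where
  zeroth : A
  first : A

/-- The quantised module `Q(E) = E ⊕ λ E`. -/
@[ext]
structure QMod (ω : Bivector A) (D : Conn A E) where
  zeroth : E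
  first : E

section QAlg

variable (ω : Bivector A)

def QAlg.equivProd : QAlg ω ≃ A × A where
  toFun x := (x.zeroth, x.first)
  invFun x := ⟨x.1, x.2⟩

instance : AddCommGroup (QAlg ω) := (QAlg.equivProd ω).addCommGroup

variable {ω}

@[simp] lemma QAlg.zero_zeroth : (0 : QAlg ω).zeroth = 0 := rfl
@[simp] lemma QAlg.zero_first : (0 : QAlg ω).first = 0 := rfl
@[simp] lemma QAlg.add_zeroth (x y : QAlg ω) : (x + y).zeroth = x.zeroth + y.zeroth := rfl
@[simp] lemma QAlg.add_first (x y : QAlg ω) : (x + y).first = x.first + y.first := rfl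

instance : One (QAlg ω) := ⟨⟨1, 0⟩⟩

instance : Mul (QAlg ω) := ⟨fun x y => ⟨x.zeroth * y.zeroth,
  x.zeroth * y.first + x.first * y.zeroth + half A * ω.bracket x.zeroth y.zeroth⟩⟩

@[simp] lemma QAlg.one_zeroth : (1 : QAlg ω).zeroth = 1 := rfl
@[simp] lemma QAlg.one_first : (1 : QAlg ω).first = 0 := rfl
@[simp] lemma QAlg.mul_zeroth (x y : QAlg ω) : (x * y).zeroth = x.zeroth * y.zeroth := rfl
@[simp] lemma QAlg.mul_first (x y : QAlg ω) : (x * y).first =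
    x.zeroth * y.first + x.first * y.zeroth + half A * ω.bracket x.zeroth y.zeroth := rfl

instance : Ring (QAlg ω) where
  __ := (inferInstance : AddCommGroup (QAlg ω))
  mul_assoc x y z := by
    ext
    · simp [mul_assoc]
    · simp only [QAlg.mul_first, QAlg.mul_zeroth, Bivector.bracket, Bivector.ham_mul,
        Derivation.leibniz, Derivation.add_apply, Derivation.smul_apply, smul_eq_mul]
      ring
  one_mul x := by ext <;> simp [Bivector.bracket, Bivector.ham_one]
  mul_one x := by ext <;> simp [Bivector.bracket]
  left_distrib x y z := by
    ext
    · simp [mul_add]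
    · simp only [QAlg.mul_first, QAlg.add_first, QAlg.add_zeroth, Bivector.bracket, map_add]; ring
  right_distrib x y z := by
    ext
    · simp [add_mul]
    · simp only [QAlg.mul_first, QAlg.add_first, QAlg.add_zeroth, Bivector.bracket,
        Bivector.ham_add, Derivation.add_apply]; ring
  zero_mul x := by ext <;> simp [Bivector.bracket, Bivector.ham_zero]
  mul_zero x := by ext <;> simp [Bivector.bracket]

/-- The dual numbers `ℂ[λ]/(λ²)` in the quantised algebra. -/
def QAlg.scalar (ω : Bivector A) : DualNumber ℂ →+* QAlg ω where
  toFun r := ⟨algebraMap ℂ A r.fst, algebraMap ℂ A r.snd⟩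
  map_one' := by ext <;> simp
  map_zero' := by ext <;> simp
  map_add' r s := by ext <;> simp
  map_mul' r s := by
    ext
    · simp
    · simp only [QAlg.mul_first, Bivector.bracket, Bivector.ham_scalar, Derivation.coe_zero,
        Pi.zero_apply, mul_zero, add_zero, TrivSqZeroExt.snd_mul, smul_eq_mul, map_add, map_mul,
        MulOpposite.smul_eq_mul_unop, MulOpposite.unop_op]

instance : Algebra (DualNumber ℂ) (QAlg ω) :=
  (QAlg.scalar ω).toAlgebra' (by
    intro r x
    ext
    · exact mul_comm _ _
    · simp only [QAlg.scalar, RingHom.coe_mk, MonoidHom.coe_mk, OneHom.coe_mk, QAlg.mul_first,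
        Bivector.bracket, Bivector.ham_scalar, Derivation.coe_zero, Pi.zero_apply,
        Derivation.map_algebraMap]
      ring)

@[simp] lemma QAlg.scal_zeroth (r : DualNumber ℂ) (x : QAlg ω) :
    (r • x).zeroth = algebraMap ℂ A r.fst * x.zeroth := rfl

@[simp] lemma QAlg.scal_first (r : DualNumber ℂ) (x : QAlg ω) :
    (r • x).first = algebraMap ℂ A r.fst * x.first + algebraMap ℂ A r.snd * x.zeroth := by
  change _ + half A * ω.ham (algebraMap ℂ A r.fst) x.zeroth = _
  rw [Bivector.ham_scalar, Derivation.coe_zero, Pi.zero_apply, mul_zero, add_zero]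
  rfl

end QAlg

section QMod

def QMod.equivProd (ω : Bivector A) (D : Conn A E) : QMod ω D ≃ E × E where
  toFun x := (x.zeroth, x.first)
  invFun x := ⟨x.1, x.2⟩

variable {ω : Bivector A} {D : Conn A E}

instance : AddCommGroup (QMod ω D) := (QMod.equivProd ω D).addCommGroup

@[simp] lemma QMod.zero_zeroth : (0 : QMod ω D).zeroth = 0 := rfl
@[simp] lemma QMod.zero_first : (0 : QMod ω D).first = 0 := rfl
@[simp] lemma QMod.add_zeroth (x y : QMod ω D) : (x + y).zeroth = x.zeroth + y.zeroth := rfl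
@[simp] lemma QMod.add_first (x y : QMod ω D) : (x + y).first = x.first + y.first := rfl

instance : SMul (DualNumber ℂ) (QMod ω D) := ⟨fun r e => ⟨algebraMap ℂ A r.fst • e.zeroth,
  algebraMap ℂ A r.fst • e.first + algebraMap ℂ A r.snd • e.zeroth⟩⟩

/-- `a • e = a e + (λ/2) ω^{ij} a_{,i} ∇_j e`. -/
instance : SMul (QAlg ω) (QMod ω D) := ⟨fun x e => ⟨x.zeroth • e.zeroth,
  x.zeroth • e.first + x.first • e.zeroth + half A • D.cov (ω.ham x.zeroth) e.zeroth⟩⟩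

/-- `e • a = a e - (λ/2) ω^{ij} a_{,i} ∇_j e`. -/
instance : SMul (QAlg ω)ᵐᵒᵖ (QMod ω D) := ⟨fun x e => ⟨x.unop.zeroth • e.zeroth,
  x.unop.zeroth • e.first + x.unop.first • e.zeroth -
    half A • D.cov (ω.ham x.unop.zeroth) e.zeroth⟩⟩

@[simp] lemma QMod.scal_zeroth (r : DualNumber ℂ) (e : QMod ω D) :
    (r • e).zeroth = algebraMap ℂ A r.fst • e.zeroth := rfl
@[simp] lemma QMod.scal_first (r : DualNumber ℂ) (e : QMod ω D) : (r • e).first =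
    algebraMap ℂ A r.fst • e.first + algebraMap ℂ A r.snd • e.zeroth := rfl
@[simp] lemma QMod.smul_zeroth (x : QAlg ω) (e : QMod ω D) :
    (x • e).zeroth = x.zeroth • e.zeroth := rfl
@[simp] lemma QMod.smul_first (x : QAlg ω) (e : QMod ω D) : (x • e).first =
    x.zeroth • e.first + x.first • e.zeroth + half A • D.cov (ω.ham x.zeroth) e.zeroth := rfl
@[simp] lemma QMod.op_smul_zeroth (x : (QAlg ω)ᵐᵒᵖ) (e : QMod ω D) :
    (x • e).zeroth = x.unop.zeroth • e.zeroth := rfl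
@[simp] lemma QMod.op_smul_first (x : (QAlg ω)ᵐᵒᵖ) (e : QMod ω D) : (x • e).first =
    x.unop.zeroth • e.first + x.unop.first • e.zeroth -
      half A • D.cov (ω.ham x.unop.zeroth) e.zeroth := rfl

lemma Conn.cov_zero_field (D : Conn A E) (e : E) : D.cov 0 e = 0 := by
  have h := D.cov_smul_field 0 0 e
  rwa [zero_smul, zero_smul] at h

instance : Module (DualNumber ℂ) (QMod ω D) where
  one_smul e := by ext <;> simp
  mul_smul r s e := by
    ext
    · simp [mul_smul]
    · simp only [QMod.scal_first, QMod.scal_zeroth, TrivSqZeroExt.snd_mul, TrivSqZeroExt.fst_mul,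
        map_mul, map_add, smul_eq_mul, MulOpposite.smul_eq_mul_unop, MulOpposite.unop_op]
      module
  smul_zero r := by ext <;> simp
  smul_add r e f := by
    ext
    · simp
    · simp only [QMod.scal_first, QMod.add_first, QMod.add_zeroth]; module
  add_smul r s e := by
    ext
    · simp [add_smul]
    · simp only [QMod.scal_first, QMod.add_first, TrivSqZeroExt.fst_add,
        TrivSqZeroExt.snd_add, map_add]; module
  zero_smul e := by ext <;> simp

instance : Module (QAlg ω) (QMod ω D) where
  one_smul e := by ext <;> simp [Bivector.ham_one, Conn.cov_zero_field]
  mul_smul x y e := by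
    ext
    · simp [mul_smul]
    · simp only [QMod.smul_first, QMod.smul_zeroth, QAlg.mul_first, QAlg.mul_zeroth,
        Bivector.bracket, Bivector.ham_mul, Conn.cov_smul, Conn.cov_add_field, Conn.cov_smul_field]
      module
  smul_zero x := by ext <;> simp
  smul_add x e f := by
    ext
    · simp
    · simp only [QMod.smul_first, QMod.add_first, QMod.add_zeroth, map_add]; module
  add_smul x y e := by
    ext
    · simp [add_smul]
    · simp only [QMod.smul_first, QMod.add_first, QAlg.add_first, QAlg.add_zeroth,
        Bivector.ham_add, Conn.cov_add_field]
      module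
  zero_smul e := by ext <;> simp [Bivector.ham_zero, Conn.cov_zero_field]

instance : Module (QAlg ω)ᵐᵒᵖ (QMod ω D) where
  one_smul e := by ext <;> simp [Bivector.ham_one, Conn.cov_zero_field]
  mul_smul x y e := by
    ext
    · simp only [QMod.op_smul_zeroth, MulOpposite.unop_mul, QAlg.mul_zeroth, smul_smul, mul_comm]
    · have h : ω.ham y.unop.zeroth x.unop.zeroth = - ω.ham x.unop.zeroth y.unop.zeroth :=
        ω.bracket_antisymm _ _
      have h2 : (half A + half A) • (ω.ham x.unop.zeroth y.unop.zeroth • e.zeroth) =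
          ω.ham x.unop.zeroth y.unop.zeroth • e.zeroth := by rw [half_add_half, one_smul]
      simp only [QMod.op_smul_first, QMod.op_smul_zeroth, QAlg.mul_first, QAlg.mul_zeroth,
        Bivector.bracket, Bivector.ham_mul, Conn.cov_smul, Conn.cov_add_field,
        Conn.cov_smul_field, MulOpposite.unop_mul, h]
      module
  smul_zero x := by ext <;> simp
  smul_add x e f := by
    ext
    · simp
    · simp only [QMod.op_smul_first, QMod.add_first, QMod.add_zeroth, map_add]; module
  add_smul x y e := by
    ext
    · simp [add_smul]
    · simp only [QMod.op_smul_first, QMod.add_first, QAlg.add_first, QAlg.add_zeroth,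
        Bivector.ham_add, Conn.cov_add_field, MulOpposite.unop_add]
      module
  zero_smul e := by ext <;> simp [Bivector.ham_zero, Conn.cov_zero_field]

instance : SMulCommClass (QAlg ω) (QAlg ω)ᵐᵒᵖ (QMod ω D) where
  smul_comm x y e := by
    ext
    · exact smul_comm _ _ _
    · have h : ω.ham y.unop.zeroth x.zeroth = - ω.ham x.zeroth y.unop.zeroth :=
        ω.bracket_antisymm _ _
      simp only [QMod.op_smul_first, QMod.op_smul_zeroth, QMod.smul_first, QMod.smul_zeroth,
        Conn.cov_smul, h]
      module

instance : IsScalarTower (DualNumber ℂ) (QAlg ω) (QMod ω D) where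
  smul_assoc r x e := by
    ext
    · simp [mul_smul]
    · have h : ω.ham (algebraMap ℂ A r.fst * x.zeroth) = algebraMap ℂ A r.fst • ω.ham x.zeroth := by
        rw [Bivector.ham_mul, Bivector.ham_scalar, smul_zero, add_zero]
      simp only [QMod.smul_first, QMod.scal_first, QMod.smul_zeroth, QAlg.scal_first,
        QAlg.scal_zeroth, h, Conn.cov_smul_field]
      module

instance : IsScalarTower (DualNumber ℂ) (QAlg ω)ᵐᵒᵖ (QMod ω D) where
  smul_assoc r x e := by
    ext
    · simp [mul_smul]
    · have h : ω.ham (algebraMap ℂ A r.fst * x.unop.zeroth) =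
          algebraMap ℂ A r.fst • ω.ham x.unop.zeroth := by
        rw [Bivector.ham_mul, Bivector.ham_scalar, smul_zero, add_zero]
      simp only [QMod.op_smul_first, QMod.scal_first, QMod.op_smul_zeroth, QAlg.scal_first,
        QAlg.scal_zeroth, MulOpposite.unop_smul, h, Conn.cov_smul_field]
      module

/-- An element of `E`, in `Q(E)`. -/
def QMod.ofClassical (ω : Bivector A) (D : Conn A E) (e : E) : QMod ω D := ⟨e, 0⟩

lemma QMod.ofClassical_add (ω : Bivector A) (D : Conn A E) (e e' : E) :
    QMod.ofClassical ω D (e + e') = QMod.ofClassical ω D e + QMod.ofClassical ω D e' := by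
  ext <;> simp [QMod.ofClassical]

end QMod

/-- The bimodule `Q(E)` over the quantised algebra. -/
def QBimod (ω : Bivector A) (D : Conn A E) : BimoduleCat (DualNumber ℂ) (QAlg ω) where
  carrier := QMod ω D

/-- An element of `E`, in the bimodule `Q(E)`. -/
def QBimod.of (ω : Bivector A) (D : Conn A E) (e : E) : QBimod ω D := QMod.ofClassical ω D e

lemma QBimod.of_add (ω : Bivector A) (D : Conn A E) (e e' : E) :
    QBimod.of ω D (e + e') = QBimod.of ω D e + QBimod.of ω D e' := QMod.ofClassical_add ω D e e'

section Calculus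

variable (ω : Bivector A) (D : Conn A (OneForm A))

/-- The `λ`-linear extension of `d`. -/
def qExtD : QAlg ω →ₗ[DualNumber ℂ] QMod ω D where
  toFun x := ⟨extD A x.zeroth, extD A x.first⟩
  map_add' x y := by ext1 <;> simp
  map_smul' r x := by ext1 <;> simp [Derivation.leibniz]

variable {ω D}

lemma qExtD_leibniz (h : PoissonCompatible ω D) (x y : QAlg ω) :
    qExtD ω D (x * y) = MulOpposite.op y • qExtD ω D x + x • qExtD ω D y := by
  ext1
  · change extD A (x.zeroth * y.zeroth) = y.zeroth • extD A x.zeroth + x.zeroth • extD A y.zeroth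
    rw [Derivation.leibniz, add_comm]
  · change extD A (x.zeroth * y.first + x.first * y.zeroth +
      half A * ω.bracket x.zeroth y.zeroth) =
      (y.zeroth • extD A x.first + y.first • extD A x.zeroth -
        half A • D.cov (ω.ham y.zeroth) (extD A x.zeroth)) +
      (x.zeroth • extD A y.first + x.first • extD A y.zeroth +
        half A • D.cov (ω.ham x.zeroth) (extD A y.zeroth))
    have h1 := h x.zeroth y.zeroth
    have h2 : extD A (ω.bracket x.zeroth y.zeroth) =
        D.cov (ω.ham x.zeroth) (extD A y.zeroth) - D.cov (ω.ham y.zeroth) (extD A x.zeroth) := by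
      rw [← sub_eq_zero, ← h1]; abel
    have h3 : extD A (half A) = 0 := Derivation.map_algebraMap _ _
    rw [map_add, map_add, Derivation.leibniz, Derivation.leibniz, Derivation.leibniz, h2, h3]
    module

lemma qExtD_generated : Submodule.span (QAlg ω) (Set.range (qExtD ω D)) = ⊤ := by
  set S := Submodule.span (QAlg ω) (Set.range (qExtD ω D)) with hS
  have h1 : ∀ ξ : OneForm A, (⟨0, ξ⟩ : QMod ω D) ∈ S := by
    intro ξ
    induction ξ using OneForm.ind with
    | hd a =>
      refine Submodule.subset_span ⟨⟨0, a⟩, ?_⟩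
      ext1
      · exact map_zero (extD A)
      · rfl
    | h0 => exact zero_mem S
    | hadd ξ η hξ hη =>
      have h := add_mem hξ hη
      have h' : (⟨0, ξ⟩ + ⟨0, η⟩ : QMod ω D) = ⟨0, ξ + η⟩ := by ext1 <;> simp
      rwa [h'] at h
    | hsmul a ξ hξ =>
      have h := S.smul_mem ⟨a, 0⟩ hξ
      have h' : ((⟨a, 0⟩ : QAlg ω) • ⟨0, ξ⟩ : QMod ω D) = ⟨0, a • ξ⟩ := by ext1 <;> simp
      rwa [h'] at h
  have h2 : ∀ ξ : OneForm A, (⟨ξ, 0⟩ : QMod ω D) ∈ S := by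
    intro ξ
    induction ξ using OneForm.ind with
    | hd a =>
      refine Submodule.subset_span ⟨⟨a, 0⟩, ?_⟩
      ext1
      · rfl
      · exact map_zero (extD A)
    | h0 => exact zero_mem S
    | hadd ξ η hξ hη =>
      have h := add_mem hξ hη
      have h' : (⟨ξ, 0⟩ + ⟨η, 0⟩ : QMod ω D) = ⟨ξ + η, 0⟩ := by ext1 <;> simp
      rwa [h'] at h
    | hsmul a ξ hξ =>
      have h := sub_mem (S.smul_mem ⟨a, 0⟩ hξ) (h1 (half A • D.cov (ω.ham a) ξ))
      have h' : ((⟨a, 0⟩ : QAlg ω) • ⟨ξ, 0⟩ : QMod ω D) - ⟨0, half A • D.cov (ω.ham a) ξ⟩ =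
          ⟨a • ξ, 0⟩ := by
        rw [sub_eq_iff_eq_add]
        ext1 <;> simp
      rwa [h'] at h
  rw [eq_top_iff]
  rintro ⟨ξ, η⟩ -
  have h := add_mem (h2 ξ) (h1 η)
  have h' : (⟨ξ, 0⟩ + ⟨0, η⟩ : QMod ω D) = ⟨ξ, η⟩ := by ext1 <;> simp
  rwa [h'] at h

/-- The quantised first order calculus `d : A₁ → Ω¹A₁ = Q(Ω¹)`. -/
def qCalculus (h : PoissonCompatible ω D) : DiffCalculus (DualNumber ℂ) (QAlg ω) where
  Ω := QBimod ω D
  d := qExtD ω D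
  leibniz := qExtD_leibniz h
  generated := qExtD_generated

end Calculus

section Functor

variable (ω : Bivector A)

/-- `Q(T)` is the `λ`-linear extension of a bundle map `T` that intertwines the connections. -/
def qMap {DE : Conn A E} {DF : Conn A F} (T : E →ₗ[A] F) (hT : Parallel DE DF T) :
    BimoduleHom (QBimod ω DE) (QBimod ω DF) :=
  have hcov : ∀ X e, T (DE.cov X e) = DF.cov X (T e) := by
    intro X e
    have h : ∀ z : OneForm A ⊗[A] E,
        T (contractField X z) = contractField X (T.lTensor (OneForm A) z) := by
      intro z
      induction z using TensorProduct.induction_on with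
      | zero => simp
      | tmul ξ e => simp
      | add s t hs ht => simp only [map_add, hs, ht]
    rw [Conn.cov_apply, Conn.cov_apply, hT, h]
  { toLin :=
      { toFun := fun e : QMod ω DE => (⟨T e.zeroth, T e.first⟩ : QMod ω DF)
        map_add' := fun e f => QMod.ext (map_add T _ _) (map_add T _ _)
        map_smul' := fun r e => QMod.ext (map_smul T _ _)
          ((map_add T _ _).trans (congrArg₂ _ (map_smul T _ _) (map_smul T _ _))) }
    map_left := fun (x : QAlg ω) (e : QMod ω DE) => by
      refine QMod.ext (map_smul T _ _) ?_
      change T (x.zeroth • e.first + x.first • e.zeroth + half A • DE.cov (ω.ham x.zeroth) e.zeroth)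
        = x.zeroth • T e.first + x.first • T e.zeroth + half A • DF.cov (ω.ham x.zeroth) (T e.zeroth)
      rw [map_add, map_add, map_smul, map_smul, map_smul, hcov]
    map_right := fun (e : QMod ω DE) (x : QAlg ω) => by
      refine QMod.ext (map_smul T _ _) ?_
      change T (x.zeroth • e.first + x.first • e.zeroth - half A • DE.cov (ω.ham x.zeroth) e.zeroth)
        = x.zeroth • T e.first + x.first • T e.zeroth - half A • DF.cov (ω.ham x.zeroth) (T e.zeroth)
      rw [map_sub, map_add, map_smul, map_smul, map_smul, hcov] }

variable {ω}

lemma qMap_apply {DE : Conn A E} {DF : Conn A F} (T : E →ₗ[A] F) (hT : Parallel DE DF T)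
    (e : QMod ω DE) : qMap ω T hT e = (⟨T e.zeroth, T e.first⟩ : QMod ω DF) := rfl

variable (ω)

variable {ω} in
/-- `(v, w) ↦ v ⊗₀ w + (λ/2) ω^{ij} ∇_i v ⊗₀ ∇_j w`, extended `λ`-bilinearly. -/
def qTensFun {DE : Conn A E} {DF : Conn A F} (v : QMod ω DE) (w : QMod ω DF) :
    QMod ω (DE.tensor DF) where
  zeroth := v.zeroth ⊗ₜ[A] w.zeroth
  first := v.zeroth ⊗ₜ[A] w.first + v.first ⊗ₜ[A] w.zeroth +
    half A • ω.contract (DE.nabla v.zeroth) (DF.nabla w.zeroth)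

section

variable {ω}
variable {DE : Conn A E} {DF : Conn A F}

lemma contract_nabla_smul_left (a : A) (e : E) (f : F) :
    ω.contract (DE.nabla (a • e)) (DF.nabla f) =
      e ⊗ₜ[A] DF.cov (ω.ham a) f + a • ω.contract (DE.nabla e) (DF.nabla f) := by
  rw [DE.leibniz, map_add, LinearMap.add_apply, map_smul, LinearMap.smul_apply,
    Bivector.contract_left]
  rfl

lemma contract_nabla_smul_right (a : A) (e : E) (f : F) :
    ω.contract (DE.nabla e) (DF.nabla (a • f)) =
      a • ω.contract (DE.nabla e) (DF.nabla f) - DE.cov (ω.ham a) e ⊗ₜ[A] f := by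
  rw [DF.leibniz, map_add, map_smul, Bivector.contract_right, sub_eq_neg_add]
  rfl

lemma contract_nabla_scalar_left (c : ℂ) (e : E) (f : F) :
    ω.contract (DE.nabla (algebraMap ℂ A c • e)) (DF.nabla f) =
      algebraMap ℂ A c • ω.contract (DE.nabla e) (DF.nabla f) := by
  rw [contract_nabla_smul_left, Bivector.ham_scalar, Conn.cov_zero_field, TensorProduct.tmul_zero,
    zero_add]

lemma contract_nabla_scalar_right (c : ℂ) (e : E) (f : F) :
    ω.contract (DE.nabla e) (DF.nabla (algebraMap ℂ A c • f)) =
      algebraMap ℂ A c • ω.contract (DE.nabla e) (DF.nabla f) := by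
  rw [contract_nabla_smul_right, Bivector.ham_scalar, Conn.cov_zero_field, TensorProduct.zero_tmul,
    sub_zero]

lemma qTensFun_add_left (v v' : QMod ω DE) (w : QMod ω DF) :
    qTensFun (v + v') w = qTensFun v w + qTensFun v' w := by
  ext
  · simp [qTensFun, TensorProduct.add_tmul]
  · simp only [qTensFun, QMod.add_zeroth, QMod.add_first, TensorProduct.add_tmul, map_add,
      LinearMap.add_apply, smul_add]
    abel

lemma qTensFun_add_right (v : QMod ω DE) (w w' : QMod ω DF) :
    qTensFun v (w + w') = qTensFun v w + qTensFun v w' := by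
  ext
  · simp [qTensFun, TensorProduct.tmul_add]
  · simp only [qTensFun, QMod.add_zeroth, QMod.add_first, TensorProduct.tmul_add, map_add,
      smul_add]
    abel

lemma qTensFun_scal_left (r : DualNumber ℂ) (v : QMod ω DE) (w : QMod ω DF) :
    qTensFun (r • v) w = r • qTensFun v w := by
  ext
  · simp [qTensFun, TensorProduct.smul_tmul']
  · simp only [qTensFun, QMod.scal_zeroth, QMod.scal_first, TensorProduct.add_tmul,
      TensorProduct.tmul_add, TensorProduct.tmul_smul, ← TensorProduct.smul_tmul',
      contract_nabla_scalar_left]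
    module

lemma qTensFun_scal_right (r : DualNumber ℂ) (v : QMod ω DE) (w : QMod ω DF) :
    qTensFun v (r • w) = r • qTensFun v w := by
  ext
  · simp [qTensFun]
  · simp only [qTensFun, QMod.scal_zeroth, QMod.scal_first, TensorProduct.add_tmul,
      TensorProduct.tmul_add, TensorProduct.tmul_smul, ← TensorProduct.smul_tmul',
      contract_nabla_scalar_right]
    module

lemma qTensFun_balanced (v : QMod ω DE) (x : QAlg ω) (w : QMod ω DF) :
    qTensFun (MulOpposite.op x • v) w = qTensFun v (x • w) := by
  ext
  · simp [qTensFun, TensorProduct.smul_tmul']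
  · simp only [qTensFun, QMod.smul_zeroth, QMod.smul_first, QMod.op_smul_zeroth,
      QMod.op_smul_first, MulOpposite.unop_op, TensorProduct.add_tmul, TensorProduct.sub_tmul,
      TensorProduct.tmul_add, TensorProduct.tmul_smul, ← TensorProduct.smul_tmul',
      contract_nabla_smul_left, contract_nabla_smul_right]
    module

end

/-- The natural transformation
`q (v ⊗₁ w) = v ⊗₀ w + (λ/2) ω^{ij} ∇_i v ⊗₀ ∇_j w`, extended `λ`-linearly. -/
def qTens (DE : Conn A E) (DF : Conn A F) :
    tensB (QBimod ω DE) (QBimod ω DF) →ₗ[DualNumber ℂ] QBimod ω (DE.tensor DF) :=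
  liftB (X := QBimod ω DE) (Y := QBimod ω DF) (qTensFun (DE := DE) (DF := DF))
    qTensFun_add_left qTensFun_scal_left qTensFun_add_right qTensFun_scal_right qTensFun_balanced

lemma qTens_tmulB (DE : Conn A E) (DF : Conn A F) (v : QBimod ω DE) (w : QBimod ω DF) :
    qTens ω DE DF (v ⊗ᵇ w) = qTensFun (DE := DE) (DF := DF) v w := rfl

variable {ω} in
lemma eps_smul_eq {DE : Conn A E} {v v' : QMod ω DE} (h : v.zeroth = v'.zeroth) :
    (DualNumber.eps : DualNumber ℂ) • v = (DualNumber.eps : DualNumber ℂ) • v' := by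
  ext <;> simp [h]

variable {ω} in
lemma eps_smul_of {DE : Conn A E} (a : A) (e : E) :
    (DualNumber.eps : DualNumber ℂ) • QBimod.of ω DE (a • e) =
      (DualNumber.eps : DualNumber ℂ) • ((⟨a, 0⟩ : QAlg ω) • QBimod.of ω DE e) :=
  eps_smul_eq (v := QMod.ofClassical ω DE (a • e)) rfl

variable {ω} in
lemma eps_rsmul_of {DE : Conn A E} (a : A) (e : E) :
    (DualNumber.eps : DualNumber ℂ) • QBimod.of ω DE (a • e) =
      (DualNumber.eps : DualNumber ℂ) • rsmul (QBimod.of ω DE e) (⟨a, 0⟩ : QAlg ω) :=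
  eps_smul_eq (v := QMod.ofClassical ω DE (a • e))
    (v' := MulOpposite.op (⟨a, 0⟩ : QAlg ω) • QMod.ofClassical ω DE e) rfl

/-- The map `e ⊗₀ f ↦ λ (e ⊗₁ f)` from `E ⊗₀ F` to `Q(E) ⊗₁ Q(F)`. -/
def lamTens (DE : Conn A E) (DF : Conn A F) : E ⊗[A] F →+ tensB (QBimod ω DE) (QBimod ω DF) :=
  TensorProduct.liftAddHom
    (AddMonoidHom.mk' (fun e => AddMonoidHom.mk'
        (fun f => (DualNumber.eps : DualNumber ℂ) • (QBimod.of ω DE e ⊗ᵇ QBimod.of ω DF f))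
        (by
          intro f f'
          rw [QBimod.of_add, tmulB_add, smul_add]))
      (by
        intro e e'
        ext f
        simp only [AddMonoidHom.mk'_apply, AddMonoidHom.add_apply]
        rw [QBimod.of_add, add_tmulB, smul_add]))
    (by
      intro a e f
      simp only [AddMonoidHom.mk'_apply]
      rw [← scal_tmulB, ← tmulB_scal, eps_rsmul_of, eps_smul_of, scal_tmulB, tmulB_scal,
        tmulB_balanced])

lemma lamTens_tmul (DE : Conn A E) (DF : Conn A F) (e : E) (f : F) :
    lamTens ω DE DF (e ⊗ₜ[A] f) =
      (DualNumber.eps : DualNumber ℂ) • (QBimod.of ω DE e ⊗ᵇ QBimod.of ω DF f) := rfl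

end Functor

section FunctorObj

variable {ω : Bivector A} {D : Conn A (OneForm A)} {h : PoissonCompatible ω D}

/-- The quantisation functor: `(E, ∇_E) ↦ (Q(E), ∇_{Q(E)}, σ_{Q(E)})` on objects, for given
bimodule connections on the modules `Q(E)`, and `T ↦ Q(T)` on morphisms, once these intertwine the
bimodule connections. -/
def quantisationFunctor (C : ∀ X : ClassicalBundle A, BimodConn (qCalculus h) (QBimod ω X.conn))
    (hC : ∀ (X Y : ClassicalBundle A) (T : X ⟶ Y),
      Intertwines (C X) (C Y) (qMap ω T.toLin T.parallel)) :
    ClassicalBundle A ⥤ ConnBimod (qCalculus h) where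
  obj X := ⟨QBimod ω X.conn, C X⟩
  map {X Y} T := ⟨qMap ω T.toLin T.parallel, hC X Y T⟩
  map_id X := rfl
  map_comp S T := rfl

end FunctorObj

end Quantisation

/-! ### Smooth functions on a manifold -/

section Smooth

/-- The complex-valued smooth functions on a manifold. -/
abbrev SmoothFun (n : ℕ) (M : Type u) [TopologicalSpace M]
    [ChartedSpace (EuclideanSpace ℝ (Fin n)) M] : Type u :=
  ContMDiffMap (𝓡 n) 𝓘(ℝ, ℂ) M ℂ ((⊤ : ℕ∞) : WithTop ℕ∞)

variable {n : ℕ} {M : Type u} [TopologicalSpace M] [ChartedSpace (EuclideanSpace ℝ (Fin n)) M]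

instance : ContMDiffRing 𝓘(ℝ, ℂ) ((⊤ : ℕ∞) : WithTop ℕ∞) ℂ where
  __ := (inferInstance : ContMDiffAdd 𝓘(ℝ, ℂ) ((⊤ : ℕ∞) : WithTop ℕ∞) ℂ)
  contMDiff_mul := by
    rw [contMDiff_iff]
    refine ⟨continuous_mul, fun x y => ?_⟩
    simp only [mfld_simps, chartAt_self_eq]
    rw [contDiffOn_univ]
    exact contDiff_mul

/-- The complex constants. -/
def SmoothFun.const : ℂ →+* SmoothFun n M where
  toFun c := ContMDiffMap.const c
  map_one' := rfl
  map_mul' _ _ := rfl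
  map_zero' := rfl
  map_add' _ _ := rfl

instance : Algebra ℂ (SmoothFun n M) := SmoothFun.const.toAlgebra

end Smooth

end

/-!
The argument is algebraic: it works for every commutative `ℂ`-algebra `A` in place of the smooth
functions and needs no finiteness of the modules.

The map `q` is a bimodule map for any pair of modules with connection, and it is bijective
(`qTens_bijective`): the inverse sends `e ⊗₀ f` to `e ⊗₁ f - (λ/2) ω^{ij} ∇_i e ⊗₁ ∇_j f`, which is
`A`-balanced because the two sides differ by the same derivative terms as the two actions of `A₁`.
Moreover `q` is natural and associative (`qTensHom_mapB`, `qTensHom_assoc`). Hence every statement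
about `⊗₁` can be transported along `q` to an identity between classical tensors, at order `λ`. After
this transport the connection of `Q(E)` is `∇ - (λ/2) κ ∘ ∇` (`qNabla`), with `κ` the contraction of
the curvature with `ω`, and its braiding is the flip minus `λ` times a curvature term (`qFlip`); the
latter is a bimodule map since the flip is parallel and the curvature is `A`-linear (`qDeform`).

Compatibility with the Poisson bracket enters through two identities. Along the Hamiltonian field
`â` of a function, `L_â ξ = ∇_â ξ - ∇_{ξ^♯} da` (`PoissonCompatible.lieForm_ham`); this gives both
Leibniz rules, since `∇(∇_â e)` is the sum of a curvature and of `L_â ∇e`. For two one-forms,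
`d(η(ξ^♯)) = L_{ξ^♯} η - L_{η^♯} ξ - ∇_{ξ^♯} η + ∇_{η^♯} ξ` (`PoissonCompatible.extD_pairing`), the
difference of the sides being `A`-bilinear. From it follows a Leibniz rule for the contraction
`ω^{ij} ∇_i e ⊗ ∇_j f` with a curvature correction (`Bivector.nabla_contract`), which together with
the Leibniz rule for the curvature on `E ⊗ F` says that `q` intertwines the connections
(`qTensHom_intertwines`).
-/

noncomputable section

section Algebraic

variable {A : Type u} [CommRing A] [Algebra ℂ A]
variable {E F G E' F' : Type u} [AddCommGroup E] [Module A E] [AddCommGroup F] [Module A F]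
  [AddCommGroup G] [Module A G] [AddCommGroup E'] [Module A E'] [AddCommGroup F'] [Module A F']

/-! ### Lie derivatives of one-forms along Hamiltonian fields -/

lemma lieForm_zero (Y : VField A) : lieForm Y (0 : OneForm A) = 0 := by
  have h := lieForm_add Y 0 0
  rw [add_zero] at h
  exact left_eq_add.1 h

lemma lieForm_zero_field (ξ : OneForm A) : lieForm 0 ξ = 0 := by
  have h := lieForm_add_field 0 0 ξ
  rw [add_zero] at h
  exact left_eq_add.1 h

/-- For a Poisson-compatible connection, the Lie derivative along a Hamiltonian field differs from
the covariant derivative by a term that is linear in the one-form. -/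
lemma PoissonCompatible.lieForm_ham {ω : Bivector A} {D : Conn A (OneForm A)}
    (h : PoissonCompatible ω D) (a : A) (ξ : OneForm A) :
    lieForm (ω.ham a) ξ = D.cov (ω.ham a) ξ - D.cov (ω.sharp ξ) (extD A a) := by
  induction ξ using OneForm.ind with
  | hd b =>
    rw [lieForm_extD, ← sub_eq_zero, ← h a b]
    change extD A (ω.bracket a b) - (_ - D.cov (ω.ham b) _) = _
    abel
  | h0 => rw [lieForm_zero, map_zero, map_zero, Conn.cov_zero_field, sub_zero]
  | hadd ξ η hξ hη => rw [lieForm_add, hξ, hη, map_add, map_add, Conn.cov_add_field]; abel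
  | hsmul b ξ hξ => rw [lieForm_smul, hξ, ω.sharp.map_smul, Conn.cov_smul, Conn.cov_smul_field]; module

/-- Poisson compatibility for arbitrary one-forms in place of exact ones: the left side is
`A`-bilinear in `ξ` and `η`. -/
lemma PoissonCompatible.extD_pairing {ω : Bivector A} {D : Conn A (OneForm A)}
    (h : PoissonCompatible ω D) (ξ η : OneForm A) :
    extD A (η.eval (ω.sharp ξ)) - lieForm (ω.sharp ξ) η + lieForm (ω.sharp η) ξ +
      D.cov (ω.sharp ξ) η - D.cov (ω.sharp η) ξ = 0 := by
  induction η using OneForm.ind with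
  | hd b =>
    have h1 : lieForm (ω.sharp (extD A b)) ξ = _ := h.lieForm_ham b ξ
    rw [h1, lieForm_extD, extD_eval]
    change _ - _ + (D.cov (ω.sharp (extD A b)) ξ - _) + _ - _ = _
    abel
  | h0 =>
    have h0 : (0 : OneForm A).eval (ω.sharp ξ) = 0 := rfl
    simp [h0, lieForm_zero, lieForm_zero_field, Conn.cov_zero_field]
  | hadd η ζ hη hζ =>
    have h2 := congrArg₂ (· + ·) hη hζ
    simp only [add_zero] at h2
    rw [← h2, OneForm.add_eval]
    simp only [map_add, lieForm_add, lieForm_add_field, Conn.cov_add_field]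
    abel
  | hsmul b η hη =>
    have h2 := congrArg (b • ·) hη
    simp only [smul_zero] at h2
    rw [← h2, OneForm.smul_eval, map_smul, lieForm_smul, lieForm_smul_field, Conn.cov_smul,
      Conn.cov_smul_field, Derivation.leibniz, ω.antisymm ξ η]
    module

/-! ### Connections, curvature and tensor products -/

namespace Conn

lemma nabla_scalar (DE : Conn A E) (c : ℂ) (e : E) :
    DE.nabla (algebraMap ℂ A c • e) = algebraMap ℂ A c • DE.nabla e := by
  rw [DE.leibniz, Derivation.map_algebraMap, TensorProduct.zero_tmul, zero_add]

lemma nabla_half (DE : Conn A E) (e : E) : DE.nabla (half A • e) = half A • DE.nabla e :=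
  DE.nabla_scalar _ e

lemma tensor_cov_tmul (DE : Conn A E) (DF : Conn A F) (X : VField A) (e : E) (f : F) :
    (DE.tensor DF).cov X (e ⊗ₜ[A] f) = DE.cov X e ⊗ₜ[A] f + e ⊗ₜ[A] DF.cov X f := by
  have h1 : ∀ z : OneForm A ⊗[A] E,
      contractField X (TensorProduct.assoc A (OneForm A) E F (z ⊗ₜ[A] f)) =
        contractField X z ⊗ₜ[A] f := by
    intro z
    induction z using TensorProduct.induction_on with
    | zero => simp
    | tmul ξ e => simp [TensorProduct.smul_tmul']
    | add s t hs ht => simp only [TensorProduct.add_tmul, map_add, hs, ht]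
  have h2 : ∀ w : OneForm A ⊗[A] F,
      contractField X (TensorProduct.leftComm A E (OneForm A) F (e ⊗ₜ[A] w)) =
        e ⊗ₜ[A] contractField X w := by
    intro w
    induction w using TensorProduct.induction_on with
    | zero => simp
    | tmul ξ f => simp
    | add s t hs ht => simp only [TensorProduct.tmul_add, map_add, hs, ht]
  rw [cov_apply, tensor_nabla_tmul, map_add, h1, h2]
  rfl

/-- The difference `∇(Y ⌟ w) - L_Y w` for a form `w` with values in `E`, as a function of the vector
field `Y`. On `w = ∇e` it is the curvature of `e`. -/
def curvForm (DE : Conn A E) (w : OneForm A ⊗[A] E) : VField A →ₗ[A] OneForm A ⊗[A] E where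
  toFun Y := DE.nabla (contractField Y w) - DE.lieCov Y w
  map_add' Y Y' := by rw [contractField_add, map_add, lieCov_add_field]; abel
  map_smul' a Y := by
    rw [contractField_smul, DE.leibniz, lieCov_smul_field, RingHom.id_apply, smul_sub]; abel

lemma curvForm_apply (DE : Conn A E) (w : OneForm A ⊗[A] E) (Y : VField A) :
    DE.curvForm w Y = DE.nabla (contractField Y w) - DE.lieCov Y w := rfl

lemma curvForm_nabla (DE : Conn A E) (e : E) : DE.curvForm (DE.nabla e) = DE.curv e := rfl

lemma curvForm_add (DE : Conn A E) (w w' : OneForm A ⊗[A] E) :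
    DE.curvForm (w + w') = DE.curvForm w + DE.curvForm w' := by
  refine LinearMap.ext fun Y => ?_
  simp only [curvForm_apply, LinearMap.add_apply, map_add]; abel

lemma curvForm_zero (DE : Conn A E) : DE.curvForm 0 = 0 := by
  refine LinearMap.ext fun Y => ?_
  simp only [curvForm_apply, LinearMap.zero_apply, map_zero, sub_zero]

end Conn

lemma Parallel.cov {DE : Conn A E} {DF : Conn A F} {T : E →ₗ[A] F} (hT : Parallel DE DF T)
    (X : VField A) (e : E) : DF.cov X (T e) = T (DE.cov X e) := by
  have h : ∀ z : OneForm A ⊗[A] E,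
      contractField X (T.lTensor (OneForm A) z) = T (contractField X z) := by
    intro z
    induction z using TensorProduct.induction_on with
    | zero => simp
    | tmul ξ e => simp
    | add s t hs ht => simp only [map_add, hs, ht]
  rw [Conn.cov_apply, Conn.cov_apply, hT, h]

lemma Parallel.lieCov {DE : Conn A E} {DF : Conn A F} {T : E →ₗ[A] F} (hT : Parallel DE DF T)
    (X : VField A) (z : OneForm A ⊗[A] E) :
    DF.lieCov X (T.lTensor (OneForm A) z) = T.lTensor (OneForm A) (DE.lieCov X z) := by
  induction z using TensorProduct.induction_on with
  | zero => simp
  | tmul ξ e => simp [Conn.lieCov_tmul, hT.cov]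
  | add s t hs ht => simp only [map_add, hs, ht]

lemma Parallel.curv {DE : Conn A E} {DF : Conn A F} {T : E →ₗ[A] F} (hT : Parallel DE DF T)
    (e : E) (X : VField A) : DF.curv (T e) X = T.lTensor (OneForm A) (DE.curv e X) := by
  rw [Conn.curv_apply, Conn.curv_apply, map_sub, hT.cov, hT, hT, hT.lieCov]

lemma Parallel.curvContract {DE : Conn A E} {DF : Conn A F} {T : E →ₗ[A] F}
    (hT : Parallel DE DF T) (ω : Bivector A) (z : OneForm A ⊗[A] E) :
    ω.curvContract DF (T.lTensor (OneForm A) z) =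
      T.lTensor (OneForm A) (ω.curvContract DE z) := by
  induction z using TensorProduct.induction_on with
  | zero => simp
  | tmul ξ e => rw [LinearMap.lTensor_tmul, ω.curvContract_tmul, ω.curvContract_tmul, hT.curv]
  | add s t hs ht => simp only [map_add, hs, ht]

lemma Parallel.comm (DE : Conn A E) (DF : Conn A F) :
    Parallel (DE.tensor DF) (DF.tensor DE) (TensorProduct.comm A E F).toLinearMap := by
  have h1 : ∀ (z : OneForm A ⊗[A] E) (f : F),
      TensorProduct.leftComm A F (OneForm A) E (f ⊗ₜ[A] z) =
      (TensorProduct.comm A E F).toLinearMap.lTensor (OneForm A)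
        (TensorProduct.assoc A (OneForm A) E F (z ⊗ₜ[A] f)) := by
    intro z f
    induction z using TensorProduct.induction_on with
    | zero => simp
    | tmul ξ e => simp
    | add s t hs ht => simp only [TensorProduct.add_tmul, TensorProduct.tmul_add, map_add, hs, ht]
  have h2 : ∀ (e : E) (w : OneForm A ⊗[A] F),
      TensorProduct.assoc A (OneForm A) F E (w ⊗ₜ[A] e) =
      (TensorProduct.comm A E F).toLinearMap.lTensor (OneForm A)
        (TensorProduct.leftComm A E (OneForm A) F (e ⊗ₜ[A] w)) := by
    intro e w
    induction w using TensorProduct.induction_on with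
    | zero => simp
    | tmul ξ e => simp
    | add s t hs ht => simp only [TensorProduct.add_tmul, TensorProduct.tmul_add, map_add, hs, ht]
  intro t
  induction t using TensorProduct.induction_on with
  | zero => simp
  | tmul e f =>
    rw [LinearEquiv.coe_coe, TensorProduct.comm_tmul, Conn.tensor_nabla_tmul,
      Conn.tensor_nabla_tmul, map_add, h1, h2, add_comm]
  | add s t hs ht => simp only [map_add, hs, ht]

namespace Conn

/-- The curvature is a derivation on tensor products. -/
lemma tensor_curv_tmul (DE : Conn A E) (DF : Conn A F) (e : E) (f : F) (Y : VField A) :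
    (DE.tensor DF).curv (e ⊗ₜ[A] f) Y =
      TensorProduct.assoc A (OneForm A) E F (DE.curv e Y ⊗ₜ[A] f) +
        TensorProduct.leftComm A E (OneForm A) F (e ⊗ₜ[A] DF.curv f Y) := by
  have h1 : ∀ z : OneForm A ⊗[A] E,
      (DE.tensor DF).lieCov Y (TensorProduct.assoc A (OneForm A) E F (z ⊗ₜ[A] f)) =
      TensorProduct.assoc A (OneForm A) E F (DE.lieCov Y z ⊗ₜ[A] f) +
        TensorProduct.assoc A (OneForm A) E F (z ⊗ₜ[A] DF.cov Y f) := by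
    intro z
    induction z using TensorProduct.induction_on with
    | zero => simp
    | tmul ξ e =>
      simp only [TensorProduct.assoc_tmul, lieCov_tmul, tensor_cov_tmul, TensorProduct.add_tmul,
        TensorProduct.tmul_add, map_add]
      abel
    | add s t hs ht => simp only [TensorProduct.add_tmul, map_add, hs, ht]; abel
  have h2 : ∀ w : OneForm A ⊗[A] F,
      (DE.tensor DF).lieCov Y (TensorProduct.leftComm A E (OneForm A) F (e ⊗ₜ[A] w)) =
      TensorProduct.leftComm A E (OneForm A) F (e ⊗ₜ[A] DF.lieCov Y w) +
        TensorProduct.leftComm A E (OneForm A) F (DE.cov Y e ⊗ₜ[A] w) := by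
    intro w
    induction w using TensorProduct.induction_on with
    | zero => simp
    | tmul ξ f =>
      simp only [TensorProduct.leftComm_tmul, lieCov_tmul, tensor_cov_tmul,
        TensorProduct.tmul_add, map_add]
      abel
    | add s t hs ht => simp only [TensorProduct.tmul_add, map_add, hs, ht]; abel
  rw [curv_apply, curv_apply, curv_apply, tensor_cov_tmul, map_add, tensor_nabla_tmul,
    tensor_nabla_tmul, tensor_nabla_tmul, map_add, h1, h2, TensorProduct.sub_tmul,
    TensorProduct.tmul_sub, map_sub, map_sub]
  abel

lemma triv_curv (a : A) (Y : VField A) : (triv A).curv a Y = 0 := by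
  rw [curv_apply, triv_cov, triv_nabla, triv_nabla, lieCov_tmul, lieForm_extD, triv_cov,
    Derivation.map_one_eq_zero, TensorProduct.tmul_zero, add_zero, sub_self]

end Conn

namespace Bivector

variable (ω : Bivector A)

lemma curvContract_triv : ω.curvContract (Conn.triv A) = 0 :=
  TensorProduct.ext' fun _ a => Conn.triv_curv a _

lemma comm_contract (z : OneForm A ⊗[A] E) (w : OneForm A ⊗[A] F) :
    TensorProduct.comm A E F (ω.contract z w) = -ω.contract w z := by
  induction z using TensorProduct.induction_on with
  | zero => simp
  | tmul ξ e => rw [contract_left, contract_right, TensorProduct.comm_tmul, neg_neg]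
  | add s t hs ht => simp only [map_add, LinearMap.add_apply, hs, ht, neg_add]

lemma map_contract (S : E →ₗ[A] E') (T : F →ₗ[A] F') (z : OneForm A ⊗[A] E)
    (w : OneForm A ⊗[A] F) :
    TensorProduct.map S T (ω.contract z w) =
      ω.contract (S.lTensor (OneForm A) z) (T.lTensor (OneForm A) w) := by
  induction z using TensorProduct.induction_on with
  | zero => simp
  | tmul ξ e =>
    induction w using TensorProduct.induction_on with
    | zero => simp
    | tmul η f => simp [contract_tmul]
    | add s t hs ht => simp only [map_add, hs, ht]
  | add s t hs ht => simp only [map_add, LinearMap.add_apply, hs, ht]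

/-- `ξ ⊗ e ↦ e ⊗ C_w(ξ^♯)` with `C_w = curvForm w`, with the one-form moved to the left. -/
def curvRight (DF : Conn A F) (w : OneForm A ⊗[A] F) :
    OneForm A ⊗[A] E →ₗ[A] OneForm A ⊗[A] (E ⊗[A] F) :=
  (TensorProduct.leftComm A E (OneForm A) F).toLinearMap ∘ₗ
    (DF.curvForm w ∘ₗ ω.sharp).lTensor E ∘ₗ (TensorProduct.comm A (OneForm A) E).toLinearMap

lemma curvRight_tmul (DF : Conn A F) (w : OneForm A ⊗[A] F) (ξ : OneForm A) (e : E) :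
    ω.curvRight DF w (ξ ⊗ₜ[A] e) =
      TensorProduct.leftComm A E (OneForm A) F (e ⊗ₜ[A] DF.curvForm w (ω.sharp ξ)) := rfl

/-- `η ⊗ f ↦ C_z(η^♯) ⊗ f` with `C_z = curvForm z`. -/
def curvLeft (DE : Conn A E) (z : OneForm A ⊗[A] E) :
    OneForm A ⊗[A] F →ₗ[A] OneForm A ⊗[A] (E ⊗[A] F) :=
  (TensorProduct.assoc A (OneForm A) E F).toLinearMap ∘ₗ (DE.curvForm z ∘ₗ ω.sharp).rTensor F

lemma curvLeft_tmul (DE : Conn A E) (z : OneForm A ⊗[A] E) (η : OneForm A) (f : F) :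
    ω.curvLeft DE z (η ⊗ₜ[A] f) =
      TensorProduct.assoc A (OneForm A) E F (DE.curvForm z (ω.sharp η) ⊗ₜ[A] f) := rfl

lemma curvContract_tensor_assoc (DE : Conn A E) (DF : Conn A F) (z : OneForm A ⊗[A] E) (f : F) :
    ω.curvContract (DE.tensor DF) (TensorProduct.assoc A (OneForm A) E F (z ⊗ₜ[A] f)) =
      TensorProduct.assoc A (OneForm A) E F (ω.curvContract DE z ⊗ₜ[A] f) +
        ω.curvRight DF (DF.nabla f) z := by
  induction z using TensorProduct.induction_on with
  | zero => simp
  | tmul ξ e =>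
    rw [TensorProduct.assoc_tmul, curvContract_tmul, curvContract_tmul, curvRight_tmul,
      Conn.tensor_curv_tmul, Conn.curvForm_nabla]
  | add s t hs ht => simp only [TensorProduct.add_tmul, map_add, hs, ht]; abel

lemma curvContract_tensor_leftComm (DE : Conn A E) (DF : Conn A F) (e : E)
    (w : OneForm A ⊗[A] F) :
    ω.curvContract (DE.tensor DF) (TensorProduct.leftComm A E (OneForm A) F (e ⊗ₜ[A] w)) =
      ω.curvLeft DE (DE.nabla e) w +
        TensorProduct.leftComm A E (OneForm A) F (e ⊗ₜ[A] ω.curvContract DF w) := by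
  induction w using TensorProduct.induction_on with
  | zero => simp
  | tmul η f =>
    rw [TensorProduct.leftComm_tmul, curvContract_tmul, curvContract_tmul, curvLeft_tmul,
      Conn.tensor_curv_tmul, Conn.curvForm_nabla]
  | add s t hs ht => simp only [TensorProduct.tmul_add, map_add, hs, ht]; abel

lemma assoc_contract_assoc (z : OneForm A ⊗[A] E) (f : F) (w : OneForm A ⊗[A] G) :
    TensorProduct.assoc A E F G
        (ω.contract (TensorProduct.assoc A (OneForm A) E F (z ⊗ₜ[A] f)) w) =
      ω.contract z (TensorProduct.leftComm A F (OneForm A) G (f ⊗ₜ[A] w)) := by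
  induction z using TensorProduct.induction_on with
  | zero => simp
  | tmul ξ e =>
    induction w using TensorProduct.induction_on with
    | zero => simp
    | tmul η g => simp [contract_tmul]
    | add s t hs ht => simp only [TensorProduct.tmul_add, map_add, hs, ht]
  | add s t hs ht => simp only [TensorProduct.add_tmul, map_add, LinearMap.add_apply, hs, ht]

lemma assoc_contract_leftComm (e : E) (z : OneForm A ⊗[A] F) (w : OneForm A ⊗[A] G) :
    TensorProduct.assoc A E F G
        (ω.contract (TensorProduct.leftComm A E (OneForm A) F (e ⊗ₜ[A] z)) w) =
      e ⊗ₜ[A] ω.contract z w := by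
  induction z using TensorProduct.induction_on with
  | zero => simp
  | tmul ξ e =>
    induction w using TensorProduct.induction_on with
    | zero => simp
    | tmul η g => simp [contract_tmul]
    | add s t hs ht => simp only [TensorProduct.tmul_add, map_add, hs, ht]
  | add s t hs ht => simp only [TensorProduct.tmul_add, map_add, LinearMap.add_apply, hs, ht]

lemma contract_assoc (z : OneForm A ⊗[A] E) (w : OneForm A ⊗[A] F) (g : G) :
    ω.contract z (TensorProduct.assoc A (OneForm A) F G (w ⊗ₜ[A] g)) =
      TensorProduct.assoc A E F G (ω.contract z w ⊗ₜ[A] g) := by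
  induction z using TensorProduct.induction_on with
  | zero => simp
  | tmul ξ e =>
    induction w using TensorProduct.induction_on with
    | zero => simp
    | tmul η g => simp [contract_tmul, ← TensorProduct.smul_tmul']
    | add s t hs ht => simp only [TensorProduct.add_tmul, map_add, hs, ht]
  | add s t hs ht => simp only [TensorProduct.add_tmul, map_add, LinearMap.add_apply, hs, ht]

/-- Covariant differentiation of a contraction with `ω`: the failure of the Leibniz rule is a
difference of two curvature terms. On pure tensors `ξ ⊗ e` and `η ⊗ f`, what remains beyond these
is the expression of `PoissonCompatible.extD_pairing`. -/
lemma nabla_contract {D : Conn A (OneForm A)} (h : PoissonCompatible ω D)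
    (DE : Conn A E) (DF : Conn A F) (z : OneForm A ⊗[A] E) (w : OneForm A ⊗[A] F) :
    (DE.tensor DF).nabla (ω.contract z w) =
      TensorProduct.assoc A (OneForm A) E F (ω.contract ((D.tensor DE).nabla z) w) +
      TensorProduct.leftComm A E (OneForm A) F (ω.contract z ((D.tensor DF).nabla w)) +
      ω.curvRight DF w z - ω.curvLeft DE z w := by
  induction z using TensorProduct.induction_on with
  | zero => simp [curvLeft, Conn.curvForm_zero]
  | tmul ξ e =>
    induction w using TensorProduct.induction_on with
    | zero => simp [curvRight, Conn.curvForm_zero]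
    | tmul η f =>
      have key := congrArg (· ⊗ₜ[A] (e ⊗ₜ[A] f)) (h.extD_pairing ξ η)
      simp only [TensorProduct.add_tmul, TensorProduct.sub_tmul, TensorProduct.zero_tmul] at key
      have h1 := (D.tensor DE).cov_apply (ω.sharp η) (ξ ⊗ₜ[A] e)
      have h2 := (D.tensor DF).cov_apply (ω.sharp ξ) (η ⊗ₜ[A] f)
      rw [contract_tmul, contract_right, contract_left, ← h1, ← h2, curvRight_tmul, curvLeft_tmul,
        Conn.tensor_cov_tmul, Conn.tensor_cov_tmul, Conn.curvForm_apply, Conn.curvForm_apply,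
        contractField_tmul, contractField_tmul, Conn.leibniz, Conn.leibniz, Conn.leibniz,
        Conn.lieCov_tmul, Conn.lieCov_tmul, ω.antisymm ξ η, Conn.tensor_nabla_tmul,
        ← sub_eq_zero, ← neg_eq_zero, ← key]
      simp only [map_neg, TensorProduct.add_tmul, TensorProduct.sub_tmul, TensorProduct.tmul_add,
        TensorProduct.tmul_sub, map_add, map_sub, TensorProduct.assoc_tmul,
        TensorProduct.leftComm_tmul, TensorProduct.neg_tmul, neg_smul, TensorProduct.tmul_smul,
        ← TensorProduct.smul_tmul', map_smul]
      module
    | add s t hs ht =>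
      simp only [map_add, hs, ht, curvRight, Conn.curvForm_add, LinearMap.add_comp,
        LinearMap.lTensor_add, LinearMap.comp_add, LinearMap.add_apply]
      abel
  | add s t hs ht =>
    simp only [map_add, LinearMap.add_apply, hs, ht, curvLeft, Conn.curvForm_add,
      LinearMap.add_comp, LinearMap.rTensor_add, LinearMap.comp_add]
    abel

end Bivector

variable {ω : Bivector A} {D : Conn A (OneForm A)} {DE : Conn A E} {DF : Conn A F} {DG : Conn A G}
  {DE' : Conn A E'} {DF' : Conn A F'}

/-! ### The bimodule isomorphism `q` -/

@[simp] lemma QMod.sub_zeroth (v w : QMod ω DE) : (v - w).zeroth = v.zeroth - w.zeroth := rfl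
@[simp] lemma QMod.sub_first (v w : QMod ω DE) : (v - w).first = v.first - w.first := rfl

/-- `q` is a bimodule map. -/
def qTensHom (ω : Bivector A) (DE : Conn A E) (DF : Conn A F) :
    BimoduleHom (tensB (QBimod ω DE) (QBimod ω DF)) (QBimod ω (DE.tensor DF)) :=
  homOfTens (qTens ω DE DF)
    (fun x (v : QMod ω DE) (w : QMod ω DF) => by
      change qTensFun (x • v) w = x • qTensFun v w
      ext1
      · simp [qTensFun, TensorProduct.smul_tmul']
      · simp only [qTensFun, QMod.smul_zeroth, QMod.smul_first, TensorProduct.add_tmul,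
          ← TensorProduct.smul_tmul', contract_nabla_smul_left, Conn.tensor_cov_tmul]
        module)
    (fun (v : QMod ω DE) (w : QMod ω DF) x => by
      change qTensFun v (MulOpposite.op x • w) = MulOpposite.op x • qTensFun v w
      ext1
      · simp [qTensFun]
      · simp only [qTensFun, QMod.op_smul_zeroth, QMod.op_smul_first, MulOpposite.unop_op,
          TensorProduct.tmul_add, TensorProduct.tmul_sub, TensorProduct.tmul_smul,
          contract_nabla_smul_right, Conn.tensor_cov_tmul]
        module)

lemma qTensHom_tmulB (v : QBimod ω DE) (w : QBimod ω DF) :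
    qTensHom ω DE DF (v ⊗ᵇ w) = qTensFun (DE := DE) (DF := DF) v w := rfl

lemma QMod.of_add_eps_smul (v : QMod ω DE) :
    v = QMod.ofClassical ω DE v.zeroth +
      (DualNumber.eps : DualNumber ℂ) • QMod.ofClassical ω DE v.first := by
  ext <;> simp [QMod.ofClassical]

lemma QMod.of_smul_left (a : A) (e : E) :
    QMod.ofClassical ω DE (a • e) = (⟨a, 0⟩ : QAlg ω) • QMod.ofClassical ω DE e -
      (DualNumber.eps : DualNumber ℂ) •
        QMod.ofClassical ω DE (half A • DE.cov (ω.ham a) e) := by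
  ext <;> simp [QMod.ofClassical]

lemma QMod.of_smul_right (a : A) (e : E) :
    QMod.ofClassical ω DE (a • e) =
      MulOpposite.op (⟨a, 0⟩ : QAlg ω) • QMod.ofClassical ω DE e +
      (DualNumber.eps : DualNumber ℂ) •
        QMod.ofClassical ω DE (half A • DE.cov (ω.ham a) e) := by
  ext <;> simp [QMod.ofClassical]

lemma lamTens_tmul_eps_left (e : E) (f : F) : lamTens ω DE DF (e ⊗ₜ[A] f) =
    ((DualNumber.eps : DualNumber ℂ) • QBimod.of ω DE e) ⊗ᵇ QBimod.of ω DF f := by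
  rw [lamTens_tmul, scal_tmulB]

lemma lamTens_tmul_eps_right (e : E) (f : F) : lamTens ω DE DF (e ⊗ₜ[A] f) =
    QBimod.of ω DE e ⊗ᵇ ((DualNumber.eps : DualNumber ℂ) • QBimod.of ω DF f) := by
  rw [lamTens_tmul, tmulB_scal]

lemma qTens_lamTens (t : E ⊗[A] F) :
    qTens ω DE DF (lamTens ω DE DF t) = (⟨0, t⟩ : QMod ω (DE.tensor DF)) := by
  induction t using TensorProduct.induction_on with
  | zero => rw [map_zero, map_zero]; rfl
  | tmul e f =>
    rw [lamTens_tmul, map_smul, qTens_tmulB]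
    refine QMod.ext ?_ ?_
    · change algebraMap ℂ A (DualNumber.eps : DualNumber ℂ).fst • _ = (0 : E ⊗[A] F)
      simp
    · change algebraMap ℂ A (DualNumber.eps : DualNumber ℂ).fst • _ +
        algebraMap ℂ A (DualNumber.eps : DualNumber ℂ).snd • (e ⊗ₜ[A] f) = e ⊗ₜ[A] f
      simp
  | add s t hs ht =>
    rw [map_add, map_add, hs, ht]
    exact QMod.ext (add_zero _) rfl

/-- `e ⊗₀ f ↦ e ⊗₁ f - (λ/2) ω^{ij} ∇_i e ⊗₁ ∇_j f`, the inverse of `q` on classical tensors. -/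
def qTensInvZeroth (ω : Bivector A) (DE : Conn A E) (DF : Conn A F) :
    E ⊗[A] F →+ tensB (QBimod ω DE) (QBimod ω DF) :=
  TensorProduct.liftAddHom
    (AddMonoidHom.mk' (fun e => AddMonoidHom.mk'
        (fun f => QBimod.of ω DE e ⊗ᵇ QBimod.of ω DF f -
          lamTens ω DE DF (half A • ω.contract (DE.nabla e) (DF.nabla f)))
        (by intro f f'; simp only [QBimod.of_add, tmulB_add, map_add, smul_add]; abel))
      (by
        intro e e'
        ext f
        simp only [AddMonoidHom.mk'_apply, AddMonoidHom.add_apply, QBimod.of_add, add_tmulB,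
          map_add, LinearMap.add_apply, smul_add]
        abel))
    (by
      intro a e f
      have h1 : QBimod.of ω DE (a • e) = rsmul (QBimod.of ω DE e) (⟨a, 0⟩ : QAlg ω) +
          (DualNumber.eps : DualNumber ℂ) • QBimod.of ω DE (half A • DE.cov (ω.ham a) e) :=
        QMod.of_smul_right a e
      have h2 : QBimod.of ω DF (a • f) = (⟨a, 0⟩ : QAlg ω) • QBimod.of ω DF f -
          (DualNumber.eps : DualNumber ℂ) • QBimod.of ω DF (half A • DF.cov (ω.ham a) f) :=
        QMod.of_smul_left a f
      simp only [AddMonoidHom.mk'_apply]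
      rw [h1, h2, add_tmulB, sub_eq_add_neg (_ • _), tmulB_add, tmulB_balanced, ← lamTens_tmul_eps_left,
        ← neg_one_smul (DualNumber ℂ) (_ • QBimod.of ω DF _), tmulB_scal, ← lamTens_tmul_eps_right,
        contract_nabla_smul_left, contract_nabla_smul_right, smul_add, smul_sub, map_add, map_sub,
        neg_one_smul, TensorProduct.tmul_smul, ← TensorProduct.smul_tmul']
      abel)

lemma qTensInvZeroth_tmul (e : E) (f : F) :
    qTensInvZeroth ω DE DF (e ⊗ₜ[A] f) = QBimod.of ω DE e ⊗ᵇ QBimod.of ω DF f -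
      lamTens ω DE DF (half A • ω.contract (DE.nabla e) (DF.nabla f)) := rfl

lemma qTensInvZeroth_left (v : QMod ω DE) (w : QMod ω DF) :
    qTensInvZeroth ω DE DF (qTensFun v w).zeroth + lamTens ω DE DF (qTensFun v w).first =
      tmulB (X := QBimod ω DE) (Y := QBimod ω DF) v w := by
  have hv : v = QBimod.of ω DE v.zeroth +
      (DualNumber.eps : DualNumber ℂ) • QBimod.of ω DE v.first := QMod.of_add_eps_smul v
  have hw : w = QBimod.of ω DF w.zeroth +
      (DualNumber.eps : DualNumber ℂ) • QBimod.of ω DF w.first := QMod.of_add_eps_smul w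
  refine Eq.trans ?_
    (congrArg₂ (fun a b => tmulB (X := QBimod ω DE) (Y := QBimod ω DF) a b) hv hw).symm
  change qTensInvZeroth ω DE DF (v.zeroth ⊗ₜ[A] w.zeroth) +
    lamTens ω DE DF (v.zeroth ⊗ₜ[A] w.first + v.first ⊗ₜ[A] w.zeroth +
      half A • ω.contract (DE.nabla v.zeroth) (DF.nabla w.zeroth)) = _
  rw [add_tmulB, tmulB_add, tmulB_add, ← lamTens_tmul_eps_right, ← lamTens_tmul_eps_left, scal_tmulB,
    tmulB_scal, smul_smul, DualNumber.eps_mul_eps, zero_smul, qTensInvZeroth_tmul, map_add,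
    map_add]
  abel

lemma qTens_bijective (ω : Bivector A) (DE : Conn A E) (DF : Conn A F) :
    Function.Bijective (qTens ω DE DF) := by
  refine Function.bijective_iff_has_inverse.2 ⟨fun t : QMod ω (DE.tensor DF) =>
    qTensInvZeroth ω DE DF t.zeroth + lamTens ω DE DF t.first, fun t => ?_, fun t => ?_⟩
  · induction t using tensB_ind with
    | hmk v w => exact qTensInvZeroth_left v w
    | hadd s t hs ht =>
      rw [map_add]
      change qTensInvZeroth ω DE DF (_ + _) + lamTens ω DE DF (_ + _) = _
      rw [map_add, map_add]
      exact (add_add_add_comm _ _ _ _).trans (congrArg₂ _ hs ht)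
  · obtain ⟨t₀, t₁⟩ := t
    change qTens ω DE DF (qTensInvZeroth ω DE DF t₀ + lamTens ω DE DF t₁) = _
    have h : qTens ω DE DF (qTensInvZeroth ω DE DF t₀) = (⟨t₀, 0⟩ : QMod ω (DE.tensor DF)) := by
      induction t₀ using TensorProduct.induction_on with
      | zero => rw [map_zero, map_zero]; rfl
      | tmul e f =>
        rw [qTensInvZeroth_tmul, map_sub, qTens_lamTens, qTens_tmulB]
        refine QMod.ext (sub_zero _) ?_
        change e ⊗ₜ[A] (0 : F) + (0 : E) ⊗ₜ[A] f + half A • ω.contract (DE.nabla e) (DF.nabla f) -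
          half A • ω.contract (DE.nabla e) (DF.nabla f) = 0
        simp
      | add s t hs ht =>
        rw [map_add, map_add, hs, ht]
        exact QMod.ext rfl (add_zero _)
    rw [map_add, h, qTens_lamTens]
    exact QMod.ext (add_zero _) (zero_add _)

/-- `q` as a linear equivalence. -/
def qEquiv (ω : Bivector A) (DE : Conn A E) (DF : Conn A F) :
    tensB (QBimod ω DE) (QBimod ω DF) ≃ₗ[DualNumber ℂ] QBimod ω (DE.tensor DF) :=
  LinearEquiv.ofBijective (qTens ω DE DF) (qTens_bijective ω DE DF)

/-- The inverse of `q`, as a bimodule map. -/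
def qTensInv (ω : Bivector A) (DE : Conn A E) (DF : Conn A F) :
    BimoduleHom (QBimod ω (DE.tensor DF)) (tensB (QBimod ω DE) (QBimod ω DF)) where
  toLin := (qEquiv ω DE DF).symm.toLinearMap
  map_left x t := by
    apply (qTens_bijective ω DE DF).1
    have h := (qTensHom ω DE DF).map_left x ((qEquiv ω DE DF).symm t)
    exact ((qEquiv ω DE DF).apply_symm_apply _).trans
      ((congrArg (x • ·) ((qEquiv ω DE DF).apply_symm_apply t)).symm.trans h.symm)
  map_right t x := by
    apply (qTens_bijective ω DE DF).1
    have h := (qTensHom ω DE DF).map_right ((qEquiv ω DE DF).symm t) x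
    exact ((qEquiv ω DE DF).apply_symm_apply _).trans
      ((congrArg (rsmul · x) ((qEquiv ω DE DF).apply_symm_apply t)).symm.trans h.symm)

@[simp] lemma qTensHom_qTensInv (t : QBimod ω (DE.tensor DF)) :
    qTensHom ω DE DF (qTensInv ω DE DF t) = t := (qEquiv ω DE DF).apply_symm_apply t

@[simp] lemma qTensInv_qTensHom (t : tensB (QBimod ω DE) (QBimod ω DF)) :
    qTensInv ω DE DF (qTensHom ω DE DF t) = t := (qEquiv ω DE DF).symm_apply_apply t

lemma qTensHom_injective : Function.Injective (qTensHom ω DE DF).toLin :=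
  (qTens_bijective ω DE DF).1

/-! ### Deformed bundle maps -/

/-- The bimodule map `T + λ R`, for a parallel bundle map `T` and an arbitrary bundle map `R`. -/
def qDeform (ω : Bivector A) {DE : Conn A E} {DF : Conn A F} (T : E →ₗ[A] F)
    (hT : Parallel DE DF T) (R : E →ₗ[A] F) : BimoduleHom (QBimod ω DE) (QBimod ω DF) where
  toLin :=
    { toFun := fun e : QMod ω DE => (⟨T e.zeroth, T e.first + R e.zeroth⟩ : QMod ω DF)
      map_add' := fun e f => QMod.ext (map_add T _ _) (by
        change T (e.first + f.first) + R (e.zeroth + f.zeroth) =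
          T e.first + R e.zeroth + (T f.first + R f.zeroth)
        rw [map_add, map_add]; abel)
      map_smul' := fun r e => QMod.ext (map_smul T _ _) (by
        change T (algebraMap ℂ A r.fst • e.first + algebraMap ℂ A r.snd • e.zeroth) +
            R (algebraMap ℂ A r.fst • e.zeroth) =
          algebraMap ℂ A r.fst • (T e.first + R e.zeroth) + algebraMap ℂ A r.snd • T e.zeroth
        simp only [map_add, map_smul]; module) }
  map_left := fun (x : QAlg ω) (e : QMod ω DE) => QMod.ext (map_smul T _ _) (by
    change T (x.zeroth • e.first + x.first • e.zeroth + half A • DE.cov (ω.ham x.zeroth) e.zeroth) +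
        R (x.zeroth • e.zeroth) =
      x.zeroth • (T e.first + R e.zeroth) + x.first • T e.zeroth +
        half A • DF.cov (ω.ham x.zeroth) (T e.zeroth)
    simp only [map_add, map_smul, hT.cov]; module)
  map_right := fun (e : QMod ω DE) (x : QAlg ω) => QMod.ext (map_smul T _ _) (by
    change T (x.zeroth • e.first + x.first • e.zeroth - half A • DE.cov (ω.ham x.zeroth) e.zeroth) +
        R (x.zeroth • e.zeroth) =
      x.zeroth • (T e.first + R e.zeroth) + x.first • T e.zeroth -
        half A • DF.cov (ω.ham x.zeroth) (T e.zeroth)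
    simp only [map_add, map_sub, map_smul, hT.cov]; module)

/-- Naturality of `q`, for deformed maps in the first factor. -/
lemma qTensHom_mapB_qDeform (S : E →ₗ[A] E') (hS : Parallel DE DE' S) (R : E →ₗ[A] E')
    (T : F →ₗ[A] F') (hT : Parallel DF DF' T) (t : tensB (QBimod ω DE) (QBimod ω DF)) :
    qTensHom ω DE' DF' (mapB (qDeform ω S hS R) (qMap ω T hT) t) =
      qDeform ω (TensorProduct.map S T) (hS.tensor hT) (TensorProduct.map R T)
        (qTensHom ω DE DF t) := by
  induction t using tensB_ind with
  | hmk v w =>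
    rw [mapB_tmulB, qTensHom_tmulB, qTensHom_tmulB]
    refine QMod.ext rfl ?_
    obtain ⟨v₀, v₁⟩ := v
    obtain ⟨w₀, w₁⟩ := w
    change S v₀ ⊗ₜ[A] T w₁ + (S v₁ + R v₀) ⊗ₜ[A] T w₀ +
        half A • ω.contract (DE'.nabla (S v₀)) (DF'.nabla (T w₀)) =
      TensorProduct.map S T (v₀ ⊗ₜ[A] w₁ + v₁ ⊗ₜ[A] w₀ +
        half A • ω.contract (DE.nabla v₀) (DF.nabla w₀)) + TensorProduct.map R T (v₀ ⊗ₜ[A] w₀)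
    simp only [map_add, map_smul, TensorProduct.map_tmul, ω.map_contract, hS v₀, hT w₀,
      TensorProduct.add_tmul]
    abel
  | hadd s t hs ht => simp only [map_add, hs, ht]

lemma qMap_eq_qDeform (T : E →ₗ[A] F) (hT : Parallel DE DF T) :
    qMap ω T hT = qDeform ω T hT 0 :=
  BimoduleHom.ext' fun _ => QMod.ext rfl (add_zero _).symm

/-- `q` is natural. -/
lemma qTensHom_mapB (S : E →ₗ[A] E') (hS : Parallel DE DE' S)
    (T : F →ₗ[A] F') (hT : Parallel DF DF' T) (t : tensB (QBimod ω DE) (QBimod ω DF)) :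
    qTensHom ω DE' DF' (mapB (qMap ω S hS) (qMap ω T hT) t) =
      qMap ω (TensorProduct.map S T) (hS.tensor hT) (qTensHom ω DE DF t) := by
  rw [qMap_eq_qDeform S, qTensHom_mapB_qDeform, qMap_eq_qDeform, TensorProduct.map_zero_left]

/-- `q` is associative. -/
lemma qTensHom_assoc (v : QBimod ω DE) (w : QBimod ω DF) (u : QBimod ω DG) :
    qMap ω (TensorProduct.assoc A E F G).toLinearMap (Parallel.assoc DE DF DG)
        (qTensHom ω (DE.tensor DF) DG (qTensHom ω DE DF (v ⊗ᵇ w) ⊗ᵇ u)) =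
      qTensHom ω DE (DF.tensor DG) (v ⊗ᵇ qTensHom ω DF DG (w ⊗ᵇ u)) := by
  obtain ⟨v₀, v₁⟩ := v
  obtain ⟨w₀, w₁⟩ := w
  obtain ⟨u₀, u₁⟩ := u
  refine QMod.ext rfl ?_
  change TensorProduct.assoc A E F G ((v₀ ⊗ₜ[A] w₀) ⊗ₜ[A] u₁ +
      (v₀ ⊗ₜ[A] w₁ + v₁ ⊗ₜ[A] w₀ + half A • ω.contract (DE.nabla v₀) (DF.nabla w₀)) ⊗ₜ[A] u₀ +
      half A • ω.contract ((DE.tensor DF).nabla (v₀ ⊗ₜ[A] w₀)) (DG.nabla u₀)) =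
    v₀ ⊗ₜ[A] (w₀ ⊗ₜ[A] u₁ + w₁ ⊗ₜ[A] u₀ + half A • ω.contract (DF.nabla w₀) (DG.nabla u₀)) +
      v₁ ⊗ₜ[A] (w₀ ⊗ₜ[A] u₀) +
      half A • ω.contract (DE.nabla v₀) ((DF.tensor DG).nabla (w₀ ⊗ₜ[A] u₀))
  rw [Conn.tensor_nabla_tmul, Conn.tensor_nabla_tmul]
  simp only [map_add, map_smul, TensorProduct.add_tmul, TensorProduct.tmul_add,
    LinearMap.add_apply, ← TensorProduct.smul_tmul', TensorProduct.tmul_smul,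
    TensorProduct.assoc_tmul, ω.assoc_contract_assoc, ω.assoc_contract_leftComm, ω.contract_assoc]
  module

/-! ### The quantised connection -/

/-- The quantised connection composed with `q`, that is `∇ - (λ/2) κ ∘ ∇` with the contracted
curvature `κ = curvContract`, extended `λ`-linearly. -/
def qNabla (ω : Bivector A) (D : Conn A (OneForm A)) (DE : Conn A E) :
    QBimod ω DE →ₗ[DualNumber ℂ] QBimod ω (D.tensor DE) where
  toFun := fun e : QMod ω DE => (⟨DE.nabla e.zeroth,
    DE.nabla e.first - half A • ω.curvContract DE (DE.nabla e.zeroth)⟩ : QMod ω (D.tensor DE))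
  map_add' := fun e f => QMod.ext (map_add _ _ _) (by
    change DE.nabla (e.first + f.first) -
        half A • ω.curvContract DE (DE.nabla (e.zeroth + f.zeroth)) =
      DE.nabla e.first - half A • ω.curvContract DE (DE.nabla e.zeroth) +
        (DE.nabla f.first - half A • ω.curvContract DE (DE.nabla f.zeroth))
    simp only [map_add, smul_add]; abel)
  map_smul' := fun r e => QMod.ext (DE.nabla_scalar _ _) (by
    change DE.nabla (algebraMap ℂ A r.fst • e.first + algebraMap ℂ A r.snd • e.zeroth) -
        half A • ω.curvContract DE (DE.nabla (algebraMap ℂ A r.fst • e.zeroth)) =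
      algebraMap ℂ A r.fst •
          (DE.nabla e.first - half A • ω.curvContract DE (DE.nabla e.zeroth)) +
        algebraMap ℂ A r.snd • DE.nabla e.zeroth
    simp only [map_add, DE.nabla_scalar, map_smul]; module)

/-- The Lie derivative of `E`-valued one-forms along a Hamiltonian field, in terms of covariant
derivatives. -/
lemma PoissonCompatible.lieCov_ham (h : PoissonCompatible ω D) (a : A) (z : OneForm A ⊗[A] E) :
    DE.lieCov (ω.ham a) z =
      (D.tensor DE).cov (ω.ham a) z + ω.contract (D.nabla (extD A a)) z := by
  induction z using TensorProduct.induction_on with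
  | zero => simp
  | tmul ξ e =>
    rw [Conn.lieCov_tmul, h.lieForm_ham, Conn.tensor_cov_tmul, ω.contract_right, ← Conn.cov_apply,
      TensorProduct.sub_tmul]
    abel
  | add s t hs ht => simp only [map_add, hs, ht]; abel

/-- `∇(∇_â e)` for a Hamiltonian field `â`: the curvature and a Lie derivative. -/
lemma PoissonCompatible.nabla_cov_ham (h : PoissonCompatible ω D) (a : A) (e : E) :
    DE.nabla (DE.cov (ω.ham a) e) = DE.curv e (ω.ham a) +
      ((D.tensor DE).cov (ω.ham a) (DE.nabla e) +
        ω.contract (D.nabla (extD A a)) (DE.nabla e)) := by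
  rw [← h.lieCov_ham, Conn.curv_apply, sub_add_cancel]

/-- The left Leibniz rule, transported along `q`. At order `λ` the curvature in
`∇(∇_â e)` cancels against the curvature term of the connection and leaves a Lie derivative, which
`PoissonCompatible.lieCov_ham` evaluates. -/
lemma qNabla_leibniz_left (h : PoissonCompatible ω D) (x : QAlg ω) (e : QBimod ω DE) :
    qNabla ω D DE (x • e) =
      qTensHom ω D DE (tmulB (X := QBimod ω D) (qExtD ω D x) e) + x • qNabla ω D DE e := by
  obtain ⟨e₀, e₁⟩ := e
  refine QMod.ext (DE.leibniz x.zeroth e₀) ?_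
  change DE.nabla (x.zeroth • e₁ + x.first • e₀ + half A • DE.cov (ω.ham x.zeroth) e₀) -
      half A • ω.curvContract DE (DE.nabla (x.zeroth • e₀)) =
    extD A x.zeroth ⊗ₜ[A] e₁ + extD A x.first ⊗ₜ[A] e₀ +
      half A • ω.contract (D.nabla (extD A x.zeroth)) (DE.nabla e₀) +
    (x.zeroth • (DE.nabla e₁ - half A • ω.curvContract DE (DE.nabla e₀)) +
      x.first • DE.nabla e₀ + half A • (D.tensor DE).cov (ω.ham x.zeroth) (DE.nabla e₀))
  have hc : ω.curvContract DE (extD A x.zeroth ⊗ₜ[A] e₀) = DE.curv e₀ (ω.ham x.zeroth) := rfl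
  simp only [map_add, DE.nabla_half, DE.leibniz x.zeroth, DE.leibniz x.first, map_smul, hc,
    h.nabla_cov_ham]
  module

/-- `e ⊗ ξ ↦ ω^{ij} ξ_i dx^k ⊗ [∇_k, ∇_j] e`: the curvature of `e`, contracted with the vector field
`ξ^♯`. -/
def braidCurv (ω : Bivector A) (DE : Conn A E) : E ⊗[A] OneForm A →ₗ[A] OneForm A ⊗[A] E :=
  TensorProduct.lift (DE.curv.compl₂ ω.sharp)

/-- The quantised braiding, transported along `q` on both sides: the classical flip, corrected by
the curvature. -/
def qFlip (ω : Bivector A) (D : Conn A (OneForm A)) (DE : Conn A E) :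
    BimoduleHom (QBimod ω (DE.tensor D)) (QBimod ω (D.tensor DE)) :=
  qDeform ω (TensorProduct.comm A E (OneForm A)).toLinearMap (Parallel.comm DE D)
    (-braidCurv ω DE)

/-- The right Leibniz rule, transported along `q`. Here the two curvature terms add up instead of
cancelling, which is what the curvature term of the braiding accounts for. -/
lemma qNabla_leibniz_right (h : PoissonCompatible ω D) (e : QBimod ω DE) (x : QAlg ω) :
    qNabla ω D DE (rsmul e x) = rsmul (qNabla ω D DE e) x +
      qFlip ω D DE (qTensHom ω DE D (tmulB (Y := QBimod ω D) e (qExtD ω D x))) := by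
  obtain ⟨e₀, e₁⟩ := e
  refine QMod.ext ((DE.leibniz x.zeroth e₀).trans (add_comm _ _)) ?_
  change DE.nabla (x.zeroth • e₁ + x.first • e₀ - half A • DE.cov (ω.ham x.zeroth) e₀) -
      half A • ω.curvContract DE (DE.nabla (x.zeroth • e₀)) =
    (x.zeroth • (DE.nabla e₁ - half A • ω.curvContract DE (DE.nabla e₀)) +
      x.first • DE.nabla e₀ - half A • (D.tensor DE).cov (ω.ham x.zeroth) (DE.nabla e₀)) +
    (TensorProduct.comm A E (OneForm A) (e₀ ⊗ₜ[A] extD A x.first + e₁ ⊗ₜ[A] extD A x.zeroth +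
      half A • ω.contract (DE.nabla e₀) (D.nabla (extD A x.zeroth))) +
      -DE.curv e₀ (ω.ham x.zeroth))
  have hc : ω.curvContract DE (extD A x.zeroth ⊗ₜ[A] e₀) = DE.curv e₀ (ω.ham x.zeroth) := rfl
  have hh : DE.curv e₀ (ω.ham x.zeroth) = half A • DE.curv e₀ (ω.ham x.zeroth) +
      half A • DE.curv e₀ (ω.ham x.zeroth) := by
    rw [← add_smul, half_add_half, one_smul]
  rw [map_sub, hh]
  simp only [map_add, DE.nabla_half, DE.leibniz x.zeroth, DE.leibniz x.first, map_smul, hc,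
    h.nabla_cov_ham, TensorProduct.comm_tmul, ω.comm_contract]
  module

/-- The bimodule connection on `Q(E)`. -/
def qConn (h : PoissonCompatible ω D) (DE : Conn A E) :
    BimodConn (qCalculus h) (QBimod ω DE) where
  nabla := (qTensInv ω D DE).toLin ∘ₗ qNabla ω D DE
  braid := (qTensInv ω D DE).comp ((qFlip ω D DE).comp (qTensHom ω DE D))
  leibniz_left x e := by
    apply qTensHom_injective (ω := ω) (DE := D) (DF := DE)
    have h1 := qTensHom_qTensInv (ω := ω) (qNabla ω D DE (x • e))
    have h2 : qTensHom ω D DE (tmulB (X := QBimod ω D) (qExtD ω D x) e +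
        x • qTensInv ω D DE (qNabla ω D DE e)) =
        qTensHom ω D DE (tmulB (X := QBimod ω D) (qExtD ω D x) e) + x • qNabla ω D DE e := by
      rw [map_add, BimoduleHom.map_left, qTensHom_qTensInv]
    exact h1.trans ((qNabla_leibniz_left h x e).trans h2.symm)
  leibniz_right e x := by
    apply qTensHom_injective (ω := ω) (DE := D) (DF := DE)
    have h1 := qTensHom_qTensInv (ω := ω) (qNabla ω D DE (rsmul e x))
    have h2 : qTensHom ω D DE (rsmul (qTensInv ω D DE (qNabla ω D DE e)) x +
        qTensInv ω D DE (qFlip ω D DE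
          (qTensHom ω DE D (tmulB (Y := QBimod ω D) e (qExtD ω D x))))) =
        rsmul (qNabla ω D DE e) x +
          qFlip ω D DE (qTensHom ω DE D (tmulB (Y := QBimod ω D) e (qExtD ω D x))) := by
      rw [map_add, BimoduleHom.map_right, qTensHom_qTensInv, qTensHom_qTensInv]
    exact h1.trans ((qNabla_leibniz_right h e x).trans h2.symm)

variable (h : PoissonCompatible ω D)

lemma qTensHom_qConn_nabla (e : QBimod ω DE) :
    qTensHom ω D DE ((qConn h DE).nabla e) = qNabla ω D DE e :=
  qTensHom_qTensInv _

lemma qTensHom_qConn_braid (t : tensB (QBimod ω DE) (QBimod ω D)) :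
    qTensHom ω D DE ((qConn h DE).braid t) = qFlip ω D DE (qTensHom ω DE D t) :=
  qTensHom_qTensInv _

/-- Parallel maps intertwine the quantised connections. -/
lemma qConn_intertwines (T : E →ₗ[A] F) (hT : Parallel DE DF T) :
    Intertwines (qConn h DE) (qConn h DF) (qMap ω T hT) := by
  intro e
  apply qTensHom_injective (ω := ω) (DE := D) (DF := DF)
  refine (qTensHom_qConn_nabla h _).trans ?_
  have h1 := qTensHom_mapB (ω := ω) LinearMap.id (Parallel.refl D) T hT ((qConn h DE).nabla e)
  refine Eq.trans ?_ h1.symm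
  rw [qTensHom_qConn_nabla]
  obtain ⟨e₀, e₁⟩ := e
  refine QMod.ext (hT e₀) ?_
  change DF.nabla (T e₁) - half A • ω.curvContract DF (DF.nabla (T e₀)) =
    T.lTensor (OneForm A) (DE.nabla e₁ - half A • ω.curvContract DE (DE.nabla e₀))
  rw [hT e₀, hT e₁, hT.curvContract, map_sub, map_smul]

/-! ### Compatibility of `q` with the tensor product connections -/

/-- `q` on a triple tensor product, through either bracketing. -/
lemma qTensHom_mapB_assocB (t : tensB (QBimod ω DE) (QBimod ω DF)) (u : QBimod ω DG) :
    qTensHom ω DE (DF.tensor DG)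
        (mapB (BimoduleHom.id (QBimod ω DE)) (qTensHom ω DF DG)
          (assocB (QBimod ω DE) (QBimod ω DF) (QBimod ω DG) (t ⊗ᵇ u))) =
      qMap ω (TensorProduct.assoc A E F G).toLinearMap (Parallel.assoc DE DF DG)
        (qTensHom ω (DE.tensor DF) DG (qTensHom ω DE DF t ⊗ᵇ u)) := by
  induction t using tensB_ind with
  | hmk v w =>
    rw [assocB_tmulB, mapB_tmulB, BimoduleHom.id_apply, qTensHom_assoc]
  | hadd s t hs ht => simp only [add_tmulB, map_add, hs, ht]

/-- The curvature term of the flip past `E`, on `E ⊗ Ω¹ ⊗ F`. -/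
lemma assoc_braidCurv (e : E) (w : OneForm A ⊗[A] F) :
    TensorProduct.assoc A (OneForm A) E F ((braidCurv ω DE).rTensor F
      ((TensorProduct.assoc A E (OneForm A) F).symm (e ⊗ₜ[A] w))) =
      ω.curvLeft DE (DE.nabla e) w := by
  induction w using TensorProduct.induction_on with
  | zero => simp
  | tmul η f => rfl
  | add s t hs ht => simp only [TensorProduct.tmul_add, map_add, hs, ht]

/-- The flip past `E`, on `E ⊗ Ω¹ ⊗ F`. -/
lemma assoc_comm_assoc_symm (t : E ⊗[A] (OneForm A ⊗[A] F)) :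
    TensorProduct.assoc A (OneForm A) E F
      (TensorProduct.map (TensorProduct.comm A E (OneForm A)).toLinearMap LinearMap.id
        ((TensorProduct.assoc A E (OneForm A) F).symm t)) =
      TensorProduct.leftComm A E (OneForm A) F t := by
  induction t using TensorProduct.induction_on with
  | zero => simp
  | tmul e w =>
    induction w using TensorProduct.induction_on with
    | zero => simp
    | tmul η f => rfl
    | add s t hs ht => simp only [TensorProduct.tmul_add, map_add, hs, ht]
  | add s t hs ht => simp only [map_add, hs, ht]

/-- Moving a one-form past `E` in `E ⊗ Ω¹ ⊗ F` by the flip with its curvature correction: the map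
`braidPast` of the quantised connection, transported along `q`. -/
def qLeftComm (ω : Bivector A) (D : Conn A (OneForm A)) (DE : Conn A E) (DF : Conn A F) :
    BimoduleHom (QBimod ω (DE.tensor (D.tensor DF))) (QBimod ω (D.tensor (DE.tensor DF))) :=
  (qMap ω (TensorProduct.assoc A (OneForm A) E F).toLinearMap (Parallel.assoc D DE DF)).comp
    ((qDeform ω (TensorProduct.map (TensorProduct.comm A E (OneForm A)).toLinearMap LinearMap.id)
      ((Parallel.comm DE D).tensor (Parallel.refl DF))
      (TensorProduct.map (-braidCurv ω DE) LinearMap.id)).comp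
    (qMap ω (TensorProduct.assoc A E (OneForm A) F).symm.toLinearMap
      (Parallel.assoc DE D DF).symm))

/-- Passing a one-form through `E` by the quantised braiding becomes, under `q`, the corrected
flip: by associativity and naturality of `q` only the two outer maps remain. -/
lemma qTensHom_braidPast (v : QBimod ω DE) (t : tensB (QBimod ω D) (QBimod ω DF)) :
    qTensHom ω D (DE.tensor DF)
        (mapB (BimoduleHom.id (QBimod ω D)) (qTensHom ω DE DF)
          (braidPast (qConn h DE) (QBimod ω DF) (v ⊗ᵇ t))) =
      qLeftComm ω D DE DF (qTensHom ω DE (D.tensor DF) (v ⊗ᵇ qTensHom ω D DF t)) := by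
  induction t using tensB_ind with
  | hmk ξ w =>
    refine (congrArg (fun s => qTensHom ω D (DE.tensor DF)
        (mapB (BimoduleHom.id (QBimod ω D)) (qTensHom ω DE DF) s))
        (braidPast_tmulB (qConn h DE) (QBimod ω DF) v ξ w)).trans ?_
    refine (qTensHom_mapB_assocB _ _).trans ?_
    have h1 := qTensHom_qConn_braid h (v ⊗ᵇ ξ)
    have h2 := qTensHom_mapB_qDeform (ω := ω) (TensorProduct.comm A E (OneForm A)).toLinearMap
      (Parallel.comm DE D) (-braidCurv ω DE) LinearMap.id (Parallel.refl DF)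
      (qTensHom ω DE D (v ⊗ᵇ ξ) ⊗ᵇ w)
    have h3 := qTensHom_assoc v ξ w
    rw [qLeftComm, BimoduleHom.comp_apply, BimoduleHom.comp_apply, ← h3]
    have h4 : ∀ t, qMap ω (TensorProduct.assoc A E (OneForm A) F).symm.toLinearMap
        (Parallel.assoc DE D DF).symm (qMap ω (TensorProduct.assoc A E (OneForm A) F).toLinearMap
        (Parallel.assoc DE D DF) t) = t := fun t =>
      QMod.ext (LinearEquiv.symm_apply_apply _ _) (LinearEquiv.symm_apply_apply _ _)
    rw [h4]
    refine congrArg (qMap ω _ (Parallel.assoc D DE DF)) ?_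
    refine Eq.trans ?_ h2
    exact congrArg (fun s => qTensHom ω (D.tensor DE) DF (s ⊗ᵇ w)) h1
  | hadd s t hs ht =>
    have h1 := (congrArg (braidPast (qConn h DE) (QBimod ω DF)).toLin (tmulB_add v s t)).trans
      (map_add (braidPast (qConn h DE) (QBimod ω DF)).toLin _ _)
    have h2 := (congrArg (mapB (BimoduleHom.id (QBimod ω D)) (qTensHom ω DE DF)).toLin h1).trans
      (map_add (mapB (BimoduleHom.id (QBimod ω D)) (qTensHom ω DE DF)).toLin _ _)
    refine ((congrArg (qTensHom ω D (DE.tensor DF)).toLin h2).trans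
      (map_add (qTensHom ω D (DE.tensor DF)).toLin _ _)).trans ?_
    simp only [map_add, tmulB_add]
    exact congrArg₂ (· + ·) hs ht

/-- `q` intertwines the tensor product of the quantised connections with the quantised tensor
product connection. -/
lemma qTensHom_intertwines (DE : Conn A E) (DF : Conn A F) :
    Intertwines ((qConn h DE).tensor (qConn h DF)) (qConn h (DE.tensor DF))
      (qTensHom ω DE DF) := by
  intro t
  induction t using tensB_ind with
  | hadd s t hs ht => simp only [map_add, hs, ht]
  | hmk v w =>
    apply qTensHom_injective (ω := ω) (DE := D) (DF := DE.tensor DF)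
    refine (qTensHom_qConn_nabla h _).trans ?_
    rw [BimodConn.tensor_nabla_tmulB, map_add]
    have h1 := qTensHom_mapB_assocB (DG := DF) ((qConn h DE).nabla v) w
    have h2 := qTensHom_braidPast h v ((qConn h DF).nabla w)
    rw [qTensHom_qConn_nabla] at h1 h2
    refine Eq.trans ?_ ((map_add (qTensHom ω D (DE.tensor DF)).toLin _ _).trans
      (congrArg₂ (· + ·) h1 h2)).symm
    obtain ⟨v₀, v₁⟩ := v
    obtain ⟨w₀, w₁⟩ := w
    refine QMod.ext ?_ ?_
    · change (DE.tensor DF).nabla (v₀ ⊗ₜ[A] w₀) =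
        TensorProduct.assoc A (OneForm A) E F (DE.nabla v₀ ⊗ₜ[A] w₀) +
        TensorProduct.assoc A (OneForm A) E F
          (TensorProduct.map (TensorProduct.comm A E (OneForm A)).toLinearMap LinearMap.id
            ((TensorProduct.assoc A E (OneForm A) F).symm (v₀ ⊗ₜ[A] DF.nabla w₀)))
      rw [assoc_comm_assoc_symm, Conn.tensor_nabla_tmul]
    · change (DE.tensor DF).nabla (v₀ ⊗ₜ[A] w₁ + v₁ ⊗ₜ[A] w₀ +
            half A • ω.contract (DE.nabla v₀) (DF.nabla w₀)) -
          half A • ω.curvContract (DE.tensor DF) ((DE.tensor DF).nabla (v₀ ⊗ₜ[A] w₀)) =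
        TensorProduct.assoc A (OneForm A) E F (DE.nabla v₀ ⊗ₜ[A] w₁ +
          (DE.nabla v₁ - half A • ω.curvContract DE (DE.nabla v₀)) ⊗ₜ[A] w₀ +
          half A • ω.contract ((D.tensor DE).nabla (DE.nabla v₀)) (DF.nabla w₀)) +
        TensorProduct.assoc A (OneForm A) E F
          (TensorProduct.map (TensorProduct.comm A E (OneForm A)).toLinearMap LinearMap.id
            ((TensorProduct.assoc A E (OneForm A) F).symm
              (v₀ ⊗ₜ[A] (DF.nabla w₁ - half A • ω.curvContract DF (DF.nabla w₀)) +
                v₁ ⊗ₜ[A] DF.nabla w₀ +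
                half A • ω.contract (DE.nabla v₀) ((D.tensor DF).nabla (DF.nabla w₀)))) +
          (-braidCurv ω DE).rTensor F
            ((TensorProduct.assoc A E (OneForm A) F).symm (v₀ ⊗ₜ[A] DF.nabla w₀)))
      -- Half of the curvature term of the braiding is the `e`-part of the curvature of `E ⊗ F`, the
      -- other half comes from differentiating the contraction.
      have hh : ω.curvLeft DE (DE.nabla v₀) (DF.nabla w₀) =
          half A • ω.curvLeft DE (DE.nabla v₀) (DF.nabla w₀) +
            half A • ω.curvLeft DE (DE.nabla v₀) (DF.nabla w₀) := by
        rw [← add_smul, half_add_half, one_smul]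
      rw [map_add (TensorProduct.assoc A (OneForm A) E F) (TensorProduct.map _ _ _),
        assoc_comm_assoc_symm, LinearMap.rTensor_neg, LinearMap.neg_apply, map_neg,
        assoc_braidCurv, hh, map_add, map_add, Conn.nabla_half, ω.nabla_contract h,
        Conn.tensor_nabla_tmul, Conn.tensor_nabla_tmul, Conn.tensor_nabla_tmul, map_add,
        ω.curvContract_tensor_assoc, ω.curvContract_tensor_leftComm]
      simp only [map_add, map_sub, map_smul, TensorProduct.sub_tmul, TensorProduct.tmul_sub,
        ← TensorProduct.smul_tmul', TensorProduct.tmul_smul]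
      module

/-! ### The unit -/

/-- The identification of `A₁` with `Q(A)`. -/
def qUnit (ω : Bivector A) :
    BimoduleHom (unitB (DualNumber ℂ) (QAlg ω)) (QBimod ω (Conn.triv A)) where
  toLin :=
    { toFun := fun a : QAlg ω => (⟨a.zeroth, a.first⟩ : QMod ω (Conn.triv A))
      map_add' := fun _ _ => rfl
      map_smul' := fun r a => QMod.ext rfl (QAlg.scal_first r a) }
  map_left := fun b (c : QAlg ω) => QMod.ext rfl (by
    change b.zeroth * c.first + b.first * c.zeroth + half A * ω.ham b.zeroth c.zeroth =
      b.zeroth * c.first + b.first * c.zeroth +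
        half A * (Conn.triv A).cov (ω.ham b.zeroth) c.zeroth
    rw [Conn.triv_cov])
  map_right := fun (c : QAlg ω) b => QMod.ext (mul_comm _ _) (by
    change c.zeroth * b.first + c.first * b.zeroth + half A * ω.bracket c.zeroth b.zeroth =
      b.zeroth * c.first + b.first * c.zeroth -
        half A * (Conn.triv A).cov (ω.ham b.zeroth) c.zeroth
    rw [Conn.triv_cov, ω.bracket_antisymm, Bivector.bracket]; ring)

/-- The inverse of `qUnit`. -/
def qUnitInv (ω : Bivector A) :
    BimoduleHom (QBimod ω (Conn.triv A)) (unitB (DualNumber ℂ) (QAlg ω)) where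
  toLin :=
    { toFun := fun a : QMod ω (Conn.triv A) => (⟨a.zeroth, a.first⟩ : QAlg ω)
      map_add' := fun _ _ => rfl
      map_smul' := fun r a => QAlg.ext rfl
        (QAlg.scal_first r (⟨a.zeroth, a.first⟩ : QAlg ω)).symm }
  map_left := fun b (c : QMod ω (Conn.triv A)) => congrArg
    (fun d : QMod ω (Conn.triv A) => (⟨d.zeroth, d.first⟩ : QAlg ω))
    ((qUnit ω).map_left b (toUnitB ⟨c.zeroth, c.first⟩)).symm
  map_right := fun (c : QMod ω (Conn.triv A)) b => congrArg
    (fun d : QMod ω (Conn.triv A) => (⟨d.zeroth, d.first⟩ : QAlg ω))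
    ((qUnit ω).map_right (toUnitB ⟨c.zeroth, c.first⟩) b).symm

lemma triv_nabla_one : (Conn.triv A).nabla 1 = 0 := by
  rw [Conn.triv_nabla, Derivation.map_one_eq_zero, TensorProduct.zero_tmul]

/-- The trivial line bundle is flat, so its quantised connection is `d`. -/
lemma qUnit_intertwines (h : PoissonCompatible ω D) :
    Intertwines (unitConn (qCalculus h)) (qConn h (Conn.triv A)) (qUnit ω) := by
  intro a
  apply qTensHom_injective (ω := ω) (DE := D) (DF := Conn.triv A)
  refine (qTensHom_qConn_nabla h _).trans ?_
  obtain ⟨a₀, a₁⟩ := a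
  refine QMod.ext rfl ?_
  change (Conn.triv A).nabla a₁ -
      half A • ω.curvContract (Conn.triv A) ((Conn.triv A).nabla a₀) =
    extD A a₀ ⊗ₜ[A] (0 : A) + extD A a₁ ⊗ₜ[A] (1 : A) +
      half A • ω.contract (D.nabla (extD A a₀)) ((Conn.triv A).nabla 1)
  rw [ω.curvContract_triv, triv_nabla_one]
  simp [Conn.triv_nabla]

lemma qTensHom_lunit {DE : Conn A E} (a : unitB (DualNumber ℂ) (QAlg ω)) (e : QBimod ω DE) :
    qMap ω (TensorProduct.lid A E).toLinearMap (Parallel.lid DE)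
      (qTensHom ω (Conn.triv A) DE (qUnit ω a ⊗ᵇ e)) = lunitB (QBimod ω DE) (a ⊗ᵇ e) := by
  obtain ⟨a, rfl⟩ := (toUnitB (R := DualNumber ℂ)).surjective a
  rw [lunitB_tmulB]
  obtain ⟨e₀, e₁⟩ := e
  refine QMod.ext rfl ?_
  change TensorProduct.lid A E (a.zeroth ⊗ₜ[A] e₁ + a.first ⊗ₜ[A] e₀ +
      half A • ω.contract (extD A a.zeroth ⊗ₜ[A] (1 : A)) (DE.nabla e₀)) =
    a.zeroth • e₁ + a.first • e₀ + half A • DE.cov (ω.ham a.zeroth) e₀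
  rw [ω.contract_left, map_add, map_add, map_smul, TensorProduct.lid_tmul, TensorProduct.lid_tmul,
    TensorProduct.lid_tmul, one_smul]
  rfl

lemma qTensHom_runit {DE : Conn A E} (e : QBimod ω DE) (a : unitB (DualNumber ℂ) (QAlg ω)) :
    qMap ω (TensorProduct.rid A E).toLinearMap (Parallel.rid DE)
      (qTensHom ω DE (Conn.triv A) (e ⊗ᵇ qUnit ω a)) = runitB (QBimod ω DE) (e ⊗ᵇ a) := by
  obtain ⟨a, rfl⟩ := (toUnitB (R := DualNumber ℂ)).surjective a
  rw [runitB_tmulB]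
  obtain ⟨e₀, e₁⟩ := e
  refine QMod.ext rfl ?_
  change TensorProduct.rid A E (e₀ ⊗ₜ[A] a.first + e₁ ⊗ₜ[A] a.zeroth +
      half A • ω.contract (DE.nabla e₀) (extD A a.zeroth ⊗ₜ[A] (1 : A))) =
    a.zeroth • e₁ + a.first • e₀ - half A • DE.cov (ω.ham a.zeroth) e₀
  rw [ω.contract_right, map_add, map_add, map_smul, map_neg, TensorProduct.rid_tmul,
    TensorProduct.rid_tmul, TensorProduct.rid_tmul, one_smul, ← Conn.cov_apply]
  change _ + half A • (-DE.cov (ω.ham a.zeroth) e₀) = _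
  module

/-! ### The monoidal functor -/

/-- The monoidal structure of the quantisation functor, given by `q`. -/
def qCoreMonoidal (h : PoissonCompatible ω D) :
    (quantisationFunctor (fun X => qConn h X.conn)
      (fun _ _ T => qConn_intertwines h T.toLin T.parallel)).CoreMonoidal where
  εIso := ConnBimod.isoMk (qUnit ω) (qUnit_intertwines h) (qUnitInv ω) rfl rfl
  μIso X Y := ConnBimod.isoMk (qTensHom ω X.conn Y.conn) (qTensHom_intertwines h X.conn Y.conn)
    (qTensInv ω X.conn Y.conn) (BimoduleHom.ext' qTensHom_qTensInv)
    (BimoduleHom.ext' qTensInv_qTensHom)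
  μIso_hom_natural_left f Z := ConnBimod.hom_ext fun t =>
    qTensHom_mapB f.toLin f.parallel LinearMap.id (Parallel.refl Z.conn) t
  μIso_hom_natural_right Z f := ConnBimod.hom_ext fun t =>
    qTensHom_mapB LinearMap.id (Parallel.refl Z.conn) f.toLin f.parallel t
  associativity _ _ _ := ConnBimod.Hom.ext (tensB_hom_ext₃ fun x y z => qTensHom_assoc x y z)
  left_unitality _ := ConnBimod.Hom.ext (tensB_hom_ext fun a x => (qTensHom_lunit a x).symm)
  right_unitality _ := ConnBimod.Hom.ext (tensB_hom_ext fun x a => (qTensHom_runit x a).symm)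

/-! ### The explicit formulas -/

lemma qConn_nabla_of (h : PoissonCompatible ω D) (DE : Conn A E) (e : E) :
    (qConn h DE).nabla (QBimod.of ω DE e) =
      (LinearEquiv.ofBijective (qTens ω D DE) (qTens_bijective ω D DE)).symm
          (QBimod.of ω (D.tensor DE) (DE.nabla e)) -
        lamTens ω D DE (half A • ω.curvContract DE (DE.nabla e)) := by
  apply (qTens_bijective ω D DE).1
  have hq : qTens ω D DE ((LinearEquiv.ofBijective (qTens ω D DE) (qTens_bijective ω D DE)).symm
      (QBimod.of ω (D.tensor DE) (DE.nabla e))) = QBimod.of ω (D.tensor DE) (DE.nabla e) :=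
    LinearEquiv.apply_symm_apply (LinearEquiv.ofBijective _ (qTens_bijective ω D DE)) _
  rw [map_sub, qTens_lamTens, hq]
  refine (qTensHom_qConn_nabla h _).trans ?_
  refine QMod.ext (sub_zero _).symm ?_
  change DE.nabla 0 - half A • ω.curvContract DE (DE.nabla e) =
    0 - half A • ω.curvContract DE (DE.nabla e)
  rw [map_zero]

lemma qConn_braid_of (h : PoissonCompatible ω D) (DE : Conn A E) (e : E) (ξ : OneForm A) :
    (qConn h DE).braid (QBimod.of ω DE e ⊗ᵇ QBimod.of ω D ξ) =
      QBimod.of ω D ξ ⊗ᵇ QBimod.of ω DE e +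
        lamTens ω D DE (TensorProduct.comm _ _ _ (ω.contract (DE.nabla e) (D.nabla ξ)) -
          DE.curv e (ω.sharp ξ)) := by
  apply (qTens_bijective ω D DE).1
  rw [map_add, qTens_lamTens, qTens_tmulB]
  refine (qTensHom_qConn_braid h _).trans ?_
  refine QMod.ext (add_zero _).symm ?_
  change TensorProduct.comm A E (OneForm A) (e ⊗ₜ[A] (0 : OneForm A) + (0 : E) ⊗ₜ[A] ξ +
      half A • ω.contract (DE.nabla e) (D.nabla ξ)) + -DE.curv e (ω.sharp ξ) =
    ξ ⊗ₜ[A] (0 : E) + (0 : OneForm A) ⊗ₜ[A] e + half A • ω.contract (D.nabla ξ) (DE.nabla e) +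
      (TensorProduct.comm _ _ _ (ω.contract (DE.nabla e) (D.nabla ξ)) - DE.curv e (ω.sharp ξ))
  have hh : ω.contract (D.nabla ξ) (DE.nabla e) =
      half A • ω.contract (D.nabla ξ) (DE.nabla e) +
        half A • ω.contract (D.nabla ξ) (DE.nabla e) := by
    rw [← add_smul, half_add_half, one_smul]
  rw [map_add, map_smul, ω.comm_contract, TensorProduct.tmul_zero, TensorProduct.zero_tmul,
    TensorProduct.tmul_zero, TensorProduct.zero_tmul, add_zero, map_zero, zero_add]
  nth_rewrite 3 [hh]
  module

end Algebraic

theorem theorem3p5 {n : ℕ} (M : Type u) [TopologicalSpace M]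
    [ChartedSpace (EuclideanSpace ℝ (Fin n)) M]
    [IsManifold (𝓡 n) ((⊤ : ℕ∞) : WithTop ℕ∞) M] [T2Space M] [SigmaCompactSpace M]
    (ω : Bivector (SmoothFun n M)) (D : Conn (SmoothFun n M) (OneForm (SmoothFun n M)))
    (h : PoissonCompatible ω D) :
    ∃ C : ∀ X : ClassicalBundle (SmoothFun n M), BimodConn (qCalculus h) (QBimod ω X.conn),
      (∀ X : ClassicalBundle (SmoothFun n M), ∃ hq : Function.Bijective (qTens ω D X.conn),
        ∀ e : X.sections,
          (C X).nabla (QBimod.of ω X.conn e) =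
            (LinearEquiv.ofBijective (qTens ω D X.conn) hq).symm
                (QBimod.of ω (D.tensor X.conn) (X.conn.nabla e)) -
              lamTens ω D X.conn
                (half (SmoothFun n M) • ω.curvContract X.conn (X.conn.nabla e))) ∧
      (∀ (X : ClassicalBundle (SmoothFun n M)) (e : X.sections) (ξ : OneForm (SmoothFun n M)),
        (C X).braid (QBimod.of ω X.conn e ⊗ᵇ QBimod.of ω D ξ) =
          QBimod.of ω D ξ ⊗ᵇ QBimod.of ω X.conn e +
            lamTens ω D X.conn
              (TensorProduct.comm _ _ _ (ω.contract (X.conn.nabla e) (D.nabla ξ)) -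
                X.conn.curv e (ω.sharp ξ))) ∧
      ∃ hC : ∀ (X Y : ClassicalBundle (SmoothFun n M)) (T : X ⟶ Y),
          Intertwines (C X) (C Y) (qMap ω T.toLin T.parallel),
        ∃ mon : (quantisationFunctor C hC).Monoidal,
          (∀ (X Y : ClassicalBundle (SmoothFun n M))
            (t : tensB (QBimod ω X.conn) (QBimod ω Y.conn)),
            (Functor.LaxMonoidal.μ (quantisationFunctor C hC) X Y).hom t =
              qTens ω X.conn Y.conn t) ∧
          (∀ a : QAlg ω,
            (Functor.LaxMonoidal.ε (quantisationFunctor C hC)).hom (toUnitB a) =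
              (⟨a.zeroth, a.first⟩ : QMod ω (Conn.triv (SmoothFun n M)))) := by
  refine ⟨fun X => qConn h X.conn, fun X => ⟨qTens_bijective ω D X.conn, qConn_nabla_of h X.conn⟩,
    fun X => qConn_braid_of h X.conn, fun _ _ T => qConn_intertwines h T.toLin T.parallel,
    (qCoreMonoidal h).toMonoidal, fun _ _ _ => rfl, fun _ => rfl⟩

end
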